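/- Let $s,t\ge 6$ be integers such that $t$ is even or $s=t$, and put $S=s-4$, $T=t-4$. Conventions. A loop in a simplicial complex $X$ is a subcomplex isomorphic to a triangulation of the circle. A filling diagram $(D,f)$ for a loop $\gamma$ is a simplicial map $f\colon D\to X$ from a triangulated $2$-disc $D$ that restricts to an isomorphism $\partial D\to\gamma$; it is minimal if $D$ has the least possible number of triangles among all filling diagrams for $\gamma$. A $k$-vertex of $D$ is an interior vertex of $D$ with exactly $k$ neighbours. Let $A,B$ be sets of vertices of $D$. The pair $(A,B)$ is called alternating if the interior vertices of $D$ are the disjoint union of $A$ and $B$, $A$ consists of $s$-vertices, $B$ consists of $t$-vertices, every neighbour of a vertex of $A$ is in $B$ or on the boundary, and the neighbours of every vertex of $B$ form a full cycle $(v_1,\dots,v_t)$ in $D$ in which the $v_i$ with $i$ odd are in $B$ or on the boundary and the $v_i$ with $i$ even are in $A$ or on the boundary. A flag, simply connected simplicial complex $X$ is $(s,t)$-uniform if for every loop $\gamma$ in $X$ and every minimal filling diagram $(D,f)$ for $\gamma$ the following holds: if $s=t$, every interior vertex of $D$ is a $t$-vertex; if $s\ne t$, the pair (set of $s$-vertices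 of $D$, set of $t$-vertices of $D$) is alternating. Let $X$ be an $(s,t)$-uniform simplicial complex, $\gamma$ a loop in $X$, $(D,f)$ a minimal filling diagram for $\gamma$, and $v$ an interior vertex of $D$. For $n\ge 0$ let the sphere $S_n$ be the set of edges of $D$ both of whose endpoints are at distance $n$ from $v$ in the $1$-skeleton of $D$. Let $(A,B)$ be the pair (set of $s$-vertices of $D$, set of $t$-vertices of $D$) or, if $s=t$ is even, any alternating pair. Let $V_n$ and $W_n$ be the sets of vertices in $A$, respectively in $B$, that are endpoints of edges of $S_n$. Let $E_n$ be the set of edges of $S_n$ spanned by a vertex of $A$ and a vertex of $B$, and $F_n$ the set of edges of $S_n$ spanned by two vertices of $B$. Let $n\ge 4$ and consider the recurrence $$x_n=\frac T2\,x_{n-1}+\Bigl(\frac{ST}2-2\Bigr)x_{n-2}+\frac T2\,x_{n-3}-x_{n-4}.\qquad(*)$$ 1. If all vertices of $D$ at distance less than $n$ from $v$ are interior, then the sphere lengths $x_k=|S_k|$ satisfy $(*)$. 2. If all vertices of $D$ at distance at most $n$ from $v$ are interior, then each of the sequences $x_k=|V_k|$, $x_k=|W_k|$, $x_k=|E_k|$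 and $x_k=|F_k|$ satisfies $(*)$. -/

import Mathlib

universe u v

noncomputable section

namespace STUniform

open Classical in
/-- The 1-skeleton of a simplicial complex, as a graph. -/
def skeleton {V : Type u} (K : AbstractSimplicialComplex V) : SimpleGraph V where
  Adj x y := x ≠ y ∧ ({x, y} : Finset V) ∈ K.faces
  symm := ⟨fun x y h => ⟨h.1.symm, by rw [Finset.pair_comm]; exact h.2⟩⟩
  loopless := ⟨fun _ h => h.1 rfl⟩

/-- A complex is flag if every nonempty finite set of pairwise adjacent vertices is a simplex. -/
def IsFlag {V : Type u} (K : AbstractSimplicialComplex V) : Prop :=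
  ∀ σ : Finset V, σ.Nonempty → (σ : Set V).Pairwise (skeleton K).Adj → σ ∈ K.faces

open Classical in
/-- Homotopy (with fixed ends) of edge paths: generated by deleting a backtracking and by
replacing two sides of a triangle of `K` by the third one. -/
inductive EdgeHomotopic {V : Type u} (K : AbstractSimplicialComplex V) :
    ∀ {x y : V}, (skeleton K).Walk x y → (skeleton K).Walk x y → Prop
  | refl {x y : V} (p : (skeleton K).Walk x y) : EdgeHomotopic K p p
  | symm {x y : V} {p q : (skeleton K).Walk x y} :
      EdgeHomotopic K p q → EdgeHomotopic K q p
  | trans {x y : V} {p q r : (skeleton K).Walk x y} :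
      EdgeHomotopic K p q → EdgeHomotopic K q r → EdgeHomotopic K p r
  | append {x y z : V} {p p' : (skeleton K).Walk x y} {q q' : (skeleton K).Walk y z} :
      EdgeHomotopic K p p' → EdgeHomotopic K q q' →
        EdgeHomotopic K (p.append q) (p'.append q')
  | backtrack {x y : V} (h : (skeleton K).Adj x y) :
      EdgeHomotopic K (.cons h (.cons h.symm .nil)) .nil
  | triangle {x y z : V} (hxy : (skeleton K).Adj x y) (hyz : (skeleton K).Adj y z)
      (hxz : (skeleton K).Adj x z) (hf : ({x, y, z} : Finset V) ∈ K.faces) :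
      EdgeHomotopic K (.cons hxy (.cons hyz .nil)) (.cons hxz .nil)

/-- Simple connectedness: connected, with trivial edge-path group. -/
def IsSimplyConnected {V : Type u} (K : AbstractSimplicialComplex V) : Prop :=
  (skeleton K).Connected ∧
    ∀ (x : V) (p : (skeleton K).Walk x x), EdgeHomotopic K p .nil

/-- A loop (cycle) in `K`: a subcomplex isomorphic to a triangulation of the circle, that is,
a finite connected 2-regular subgraph of the 1-skeleton. -/
def IsLoop {V : Type u} {K : AbstractSimplicialComplex V} (γ : (skeleton K).Subgraph) : Prop :=
  γ.verts.Finite ∧ γ.Connected ∧ ∀ x ∈ γ.verts, (γ.neighborSet x).ncard = 2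

/-- The set of 2-simplices. -/
def triangles {V : Type u} (K : AbstractSimplicialComplex V) : Set (Finset V) :=
  {σ | σ ∈ K.faces ∧ σ.card = 3}

open Classical in
/-- The vertices which together with `x` and `y` span a 2-simplex. -/
def apexes {V : Type u} (K : AbstractSimplicialComplex V) (x y : V) : Set V :=
  {z | z ≠ x ∧ z ≠ y ∧ ({x, y, z} : Finset V) ∈ K.faces}

/-- The link of the vertex `x` in a complex of dimension at most 2, as a graph on the
neighbours of `x`. -/
def linkGraph {V : Type u} (K : AbstractSimplicialComplex V) (x : V) :
    SimpleGraph ((skeleton K).neighborSet x) :=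
  SimpleGraph.fromRel fun y z => (z : V) ∈ apexes K x y

open Classical in
theorem apexes_comm {V : Type u} (K : AbstractSimplicialComplex V) (x y : V) :
    apexes K x y = apexes K y x := by
  ext z
  simp only [apexes, Set.mem_ofPred_eq, Finset.insert_comm x y {z}]
  tauto

/-- The graph of boundary edges: the edges which lie in exactly one 2-simplex. -/
def boundary {V : Type u} (D : AbstractSimplicialComplex V) : SimpleGraph V where
  Adj x y := (skeleton D).Adj x y ∧ (apexes D x y).ncard = 1
  symm := ⟨fun x y h => ⟨h.1.symm, by rw [apexes_comm]; exact h.2⟩⟩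
  loopless := ⟨fun x h => (skeleton D).irrefl h.1⟩

/-- A vertex is a boundary vertex if it lies on a boundary edge, and interior otherwise. -/
def IsBoundary {V : Type u} (D : AbstractSimplicialComplex V) (x : V) : Prop :=
  ∃ y, (boundary D).Adj x y

def IsInterior {V : Type u} (D : AbstractSimplicialComplex V) (x : V) : Prop :=
  ¬ IsBoundary D x

/-- Triangulated 2-discs: finite connected triangulated surfaces (each vertex link is a cycle or
a path with at least one edge, i.e. a finite connected graph with all degrees 1 or 2), with
nonempty boundary and with Euler characteristic 1.  By the classification of compact surfaces
these are precisely the simplicial complexes homeomorphic to the closed 2-disc. -/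
structure IsDisc {V : Type u} (D : AbstractSimplicialComplex V) : Prop where
  finite : Finite V
  connected : (skeleton D).Connected
  card_le : ∀ σ ∈ D.faces, σ.card ≤ 3
  link_connected : ∀ x, (linkGraph D x).Connected
  link_degree : ∀ x y, (skeleton D).Adj x y →
    (apexes D x y).ncard = 1 ∨ (apexes D x y).ncard = 2
  boundary_nonempty : ∃ x, IsBoundary D x
  euler : (Nat.card V : ℤ) - (skeleton D).edgeSet.ncard + (triangles D).ncard = 1

open Classical in
/-- `(D, f)` is a filling diagram for `γ`: `D` is a triangulated disc and `f` is a simplicial map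
which restricts to an isomorphism of the boundary cycle onto `γ`. -/
structure IsFilling {U : Type u} {X : AbstractSimplicialComplex U} (γ : (skeleton X).Subgraph)
    {V : Type v} (D : AbstractSimplicialComplex V) (f : V → U) : Prop where
  disc : IsDisc D
  simplicial : ∀ σ ∈ D.faces, σ.image f ∈ X.faces
  injOn : Set.InjOn f {x | IsBoundary D x}
  image_eq : f '' {x | IsBoundary D x} = γ.verts
  adj_iff : ∀ x y, IsBoundary D x → IsBoundary D y →
    ((boundary D).Adj x y ↔ γ.Adj (f x) (f y))

/-- A filling diagram with the least number of 2-simplices. -/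
def IsMinimalFilling {U : Type u} {X : AbstractSimplicialComplex U}
    (γ : (skeleton X).Subgraph) {V : Type v} (D : AbstractSimplicialComplex V)
    (f : V → U) : Prop :=
  IsFilling γ D f ∧
    ∀ (V' : Type v) (D' : AbstractSimplicialComplex V') (f' : V' → U),
      IsFilling γ D' f' → (triangles D).ncard ≤ (triangles D').ncard

/-- The set of `k`-vertices of `D`: the interior vertices with exactly `k` neighbours. -/
def kVertices {V : Type u} (D : AbstractSimplicialComplex V) (k : ℕ) : Set V :=
  {x | IsInterior D x ∧ ((skeleton D).neighborSet x).ncard = k}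

/-- The interior vertices of `D` are split into a set `A` of vertices with `s` neighbours and
a set `B` of vertices with `t` neighbours in such a way that neighbours of a vertex of `A` are in
`B` or on the boundary, and the neighbours of a vertex of `B` form a full cycle whose members are
alternately in `B` (or on the boundary) and in `A` (or on the boundary).
The cycle is indexed from `0`, so the odd positions `1, 3, …` of the cycle
`(v_1, …, v_t)` are the even indices here. -/
structure IsAlternating {V : Type u} (D : AbstractSimplicialComplex V) (s t : ℕ)
    (A B : Set V) : Prop where
  union : A ∪ B = {x | IsInterior D x}
  disjoint : Disjoint A B
  left : A ⊆ kVertices D s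
  right : B ⊆ kVertices D t
  nbrs_left : ∀ x ∈ A, ∀ y, (skeleton D).Adj x y → y ∈ B ∨ IsBoundary D y
  nbrs_right : ∀ x ∈ B, ∃ c : Fin t → V, Function.Injective c ∧
    Set.range c = (skeleton D).neighborSet x ∧
    (∀ i j : Fin t, (skeleton D).Adj (c i) (c j) ↔
      (i.val + 1) % t = j.val ∨ (j.val + 1) % t = i.val) ∧
    (∀ i : Fin t, Even i.val → c i ∈ B ∨ IsBoundary D (c i)) ∧
    (∀ i : Fin t, Odd i.val → c i ∈ A ∨ IsBoundary D (c i))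

/-- `(s,t)`-uniform complexes.  (For `s = t` this is `t`-uniformity.) -/
structure IsUniform {U : Type u} (X : AbstractSimplicialComplex U) (s t : ℕ) : Prop where
  four_le_left : 4 ≤ s
  four_le_right : 4 ≤ t
  flag : IsFlag X
  simplyConnected : IsSimplyConnected X
  of_eq : s = t → ∀ γ : (skeleton X).Subgraph, IsLoop γ →
    ∀ (V : Type v) (D : AbstractSimplicialComplex V) (f : V → U),
      IsMinimalFilling γ D f → ∀ x, IsInterior D x → x ∈ kVertices D t
  of_ne : s ≠ t → ∀ γ : (skeleton X).Subgraph, IsLoop γ →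
    ∀ (V : Type v) (D : AbstractSimplicialComplex V) (f : V → U),
      IsMinimalFilling γ D f → IsAlternating D s t (kVertices D s) (kVertices D t)

/-- The sphere of radius `n` about `o`: the edges spanned by the vertices at distance `n`. -/
def sphere {V : Type u} (D : AbstractSimplicialComplex V) (o : V) (n : ℕ) : Set (Sym2 V) :=
  {e | e ∈ (skeleton D).edgeSet ∧ ∀ x ∈ e, (skeleton D).dist o x = n}

/-- The vertices of `A` on the sphere; only vertices on edges of the sphere are considered, so
there are none for radius `0`. -/
def sphereVerts {V : Type u} (D : AbstractSimplicialComplex V) (A : Set V) (o : V) (n : ℕ) :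
    Set V :=
  {x | x ∈ A ∧ ∃ e ∈ sphere D o n, x ∈ e}

/-- The edges of the sphere spanned by a vertex of `A` and a vertex of `B`. -/
def sphereEdges {V : Type u} (D : AbstractSimplicialComplex V) (A B : Set V) (o : V) (n : ℕ) :
    Set (Sym2 V) :=
  {e | e ∈ sphere D o n ∧ ∃ a ∈ A, ∃ b ∈ B, e = s(a, b)}

/-- The recurrence
`x_n = T/2 x_{n-1} + (ST/2 - 2) x_{n-2} + T/2 x_{n-3} - x_{n-4}` at the index `n`, where
`S = s - 4` and `T = t - 4`; used for `n ≥ 4` only. -/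
def RecAt (s t : ℕ) (x : ℕ → ℕ) (n : ℕ) : Prop :=
  (x n : ℚ) = ((t : ℚ) - 4) / 2 * x (n - 1) +
    (((s : ℚ) - 4) * ((t : ℚ) - 4) / 2 - 2) * x (n - 2) +
    ((t : ℚ) - 4) / 2 * x (n - 3) - x (n - 4)

end STUniform

end

/-! Two facts carry the theorem: balls in `D` look like balls in a nonpositively curved plane, and
the spheres then obey linear relations obtained by counting triangles between consecutive levels.

Geometry. All interior vertices have at least six neighbours. By induction on the radius
(`IsDisc.downAt`), as long as the vertices at distance less than `k` are interior, the neighbours at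
distance `k - 1` of a vertex of the sphere of radius `k ≥ 1` are pairwise adjacent, and each edge of
the sphere has exactly one common neighbour at distance `k - 1`. If the vertices at distance `k` are
interior too, their links are cycles of length at least six, and this forces every such vertex to
have one or two neighbours below and exactly two on its level. The induction step excludes thin
regions between a short path outside a sphere and an arc of that sphere, using the Gauss–Bonnet
inequality `IsDisc.gauss_bonnet`. Regions are 2-chains modulo two, not topological subdiscs: Euler
characteristic 1 gives vanishing first homology (`IsDisc.exists_bd₂_eq`), and a region bounded by a
minimal cycle has Euler characteristic at least 1 (`IsDisc.euler_region`).

Counting. Write `N = |S|`, `V`, `W` for sphere lengths and numbers of `A`- and `B`-vertices.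
Splitting the link of each vertex at level `n ≥ 1` into its lower, level and upper parts and summing
gives `N (n+1) + N (n-1) = S V n + T W n` (`IsSurfaceGraph.card_sphere_add`). Counting edges between
`B`-vertices in the same way gives `V (n+1) + V (n-1) = (T/2) W n`
(`IsAlternatingBall.card_left_add`). Since `N = V + W`, the difference is `W (n+1) + W (n-1) = S V n
+ (T/2) W n`. Eliminating one of the two sequences yields the recurrence for `V` and for `W`, hence
for `E = 2V` and `F = W - V`. For `N` the outermost term enters only through the degree count one
level further in, so the last sphere may touch the boundary. When `s = t` the degree count alone
reads `N (n+1) + N (n-1) = T N n`, which implies the recurrence also for odd `t`. -/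

namespace STUniform

open Finset Module

/-! ### Dimension counts for short complexes over the field with two elements -/

section LinearAlgebra

variable {α β γ : Type*} [Fintype α] [Fintype β] [Fintype γ]

/-- Rank count: `d₁` has corank at most one, so its kernel has dimension at most `|β| - |α| + 1 ≤
|γ|`, and `|γ|` is the rank of the injective map `d₂`. This turns an Euler characteristic bound into
vanishing first homology. -/
theorem exists_preimage_of_card [DecidableEq α]
    (d₁ : (β → ZMod 2) →ₗ[ZMod 2] (α → ZMod 2))
    (d₂ : (γ → ZMod 2) →ₗ[ZMod 2] (β → ZMod 2)) (hcomp : ∀ r, d₁ (d₂ r) = 0)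
    (hinj : ∀ r, d₂ r = 0 → r = 0) (o : α)
    (hrange : ∀ a, ∃ z, d₁ z = Pi.single a 1 + Pi.single o 1)
    (hcard : Fintype.card β + 1 ≤ Fintype.card α + Fintype.card γ)
    (z : β → ZMod 2) (hz : d₁ z = 0) : ∃ r, d₂ r = z := by
  have htop : LinearMap.range d₁ ⊔ Submodule.span (ZMod 2) {Pi.single o 1} = ⊤ := by
    rw [eq_top_iff, ← (Pi.basisFun (ZMod 2) α).span_eq, Submodule.span_le]
    rintro _ ⟨a, rfl⟩
    obtain ⟨y, hy⟩ := hrange a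
    have : (Pi.basisFun (ZMod 2) α) a = d₁ y + Pi.single o 1 := by
      ext i
      simp [hy, add_assoc, CharTwo.add_self_eq_zero]
    rw [this]
    exact add_mem (Submodule.mem_sup_left ⟨y, rfl⟩)
      (Submodule.mem_sup_right (Submodule.mem_span_singleton_self _))
  have h1 : Fintype.card α ≤ finrank (ZMod 2) (LinearMap.range d₁) + 1 := by
    have h := Submodule.finrank_add_le_finrank_add_finrank (LinearMap.range d₁)
      (Submodule.span (ZMod 2) {(Pi.single o 1 : α → ZMod 2)})
    rw [htop, finrank_top, Module.finrank_fintype_fun_eq_card] at h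
    have h' := finrank_span_le_card (R := ZMod 2) {(Pi.single o 1 : α → ZMod 2)}
    simp only [Set.toFinset_singleton, card_singleton] at h'
    omega
  have h2 := LinearMap.finrank_range_add_finrank_ker d₁
  have h3 := LinearMap.finrank_range_of_inj
    ((injective_iff_map_eq_zero d₂).2 hinj)
  rw [Module.finrank_fintype_fun_eq_card] at h2 h3
  have h4 : LinearMap.range d₂ ≤ LinearMap.ker d₁ := by
    rintro _ ⟨r, rfl⟩
    exact hcomp r
  have h5 := Submodule.eq_of_le_of_finrank_le h4 (by omega)
  have : z ∈ LinearMap.range d₂ := by rw [h5]; exact hz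
  exact this

/-- The opposite direction: the image of `d₁` lies in the hyperplane of vectors with sum zero, so it
has rank at most `|α| - 1`, while exactness bounds its kernel by `|γ|`. -/
theorem card_add_one_le_of_exact [Nonempty α]
    (d₁ : (β → ZMod 2) →ₗ[ZMod 2] (α → ZMod 2))
    (d₂ : (γ → ZMod 2) →ₗ[ZMod 2] (β → ZMod 2)) (hsum : ∀ z, ∑ a, d₁ z a = 0)
    (hex : ∀ z, d₁ z = 0 → ∃ r, d₂ r = z) :
    Fintype.card β + 1 ≤ Fintype.card α + Fintype.card γ := by
  classical
  have h1 := LinearMap.finrank_range_add_finrank_ker d₁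
  have h2 := LinearMap.finrank_range_le d₂
  have h3 : LinearMap.ker d₁ ≤ LinearMap.range d₂ := fun z hz => hex z hz
  have h4 := Submodule.finrank_mono h3
  have h5 : finrank (ZMod 2) (LinearMap.range d₁) < Fintype.card α := by
    rw [← Module.finrank_fintype_fun_eq_card (ZMod 2) (η := α)]
    apply Submodule.finrank_lt
    intro htop
    obtain ⟨a⟩ := ‹Nonempty α›
    have : (Pi.single a 1 : α → ZMod 2) ∈ LinearMap.range d₁ := htop ▸ Submodule.mem_top
    obtain ⟨z, hz⟩ := this
    have := hsum z
    rw [hz] at this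
    simp at this
  rw [Module.finrank_fintype_fun_eq_card] at h1 h2
  omega

end LinearAlgebra

theorem zmod_two_eq_zero_or_one (a : ZMod 2) : a = 0 ∨ a = 1 := by
  revert a; decide

/-! ### Distance levels in a connected graph -/

section Levels

variable {V : Type*} {G : SimpleGraph V}

theorem dist_le_add_one (hG : G.Connected) (o : V) {x y : V} (h : G.Adj x y) :
    G.dist o y ≤ G.dist o x + 1 := by
  have := hG.dist_triangle (u := o) (v := x) (w := y)
  rwa [SimpleGraph.dist_eq_one_iff_adj.2 h] at this

theorem exists_adj_dist_eq (hG : G.Connected) {o x : V} {k : ℕ} (hk : G.dist o x = k + 1) :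
    ∃ y, G.Adj x y ∧ G.dist o y = k := by
  obtain ⟨p, hp⟩ := hG.exists_walk_length_eq_dist x o
  rw [SimpleGraph.dist_comm, hk] at hp
  cases p with
  | nil => simp at hp
  | @cons _ y _ hxy p =>
    simp only [SimpleGraph.Walk.length_cons, add_left_inj] at hp
    have h1 : G.dist y o ≤ k := hp ▸ SimpleGraph.dist_le p
    have h2 := dist_le_add_one hG o hxy.symm
    rw [SimpleGraph.dist_comm] at h1
    exact ⟨y, hxy, by omega⟩

end Levels

/-! ### Chains modulo two and the homology of a disc -/

section Chains

open Classical

variable {V : Type v} [Fintype V] (D : AbstractSimplicialComplex V)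

/-- The finite set of 2-simplices. -/
noncomputable def tri : Finset (Finset V) := {σ | σ ∈ D.faces ∧ σ.card = 3}

/-- The 2-simplices which contain the edge `e`. -/
noncomputable def trisOn (e : Sym2 V) : Finset (Finset V) := {σ ∈ tri D | e ∈ σ.sym2}

/-- The boundary map from 2-chains to 1-chains, with coefficients modulo two. -/
noncomputable def bd₂ : (Finset V → ZMod 2) →ₗ[ZMod 2] (Sym2 V → ZMod 2) where
  toFun r e := ∑ σ ∈ trisOn D e, r σ
  map_add' r r' := by ext e; simp [sum_add_distrib]
  map_smul' a r := by ext e; simp [mul_sum]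

/-- The boundary map from 1-chains to 0-chains, with coefficients modulo two. -/
noncomputable def bd₁ : (Sym2 V → ZMod 2) →ₗ[ZMod 2] (V → ZMod 2) where
  toFun z x := ∑ y ∈ (skeleton D).neighborFinset x, z s(x, y)
  map_add' z z' := by ext e; simp [sum_add_distrib]
  map_smul' a z := by ext e; simp [mul_sum]

variable {D}

theorem bd₂_apply (r : Finset V → ZMod 2) (e : Sym2 V) :
    bd₂ D r e = ∑ σ ∈ trisOn D e, r σ := rfl

theorem bd₁_apply (z : Sym2 V → ZMod 2) (x : V) :
    bd₁ D z x = ∑ y ∈ (skeleton D).neighborFinset x, z s(x, y) := rfl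

theorem mem_tri {σ : Finset V} : σ ∈ tri D ↔ σ ∈ D.faces ∧ σ.card = 3 := by simp [tri]

theorem mem_trisOn {σ : Finset V} {x y : V} :
    σ ∈ trisOn D s(x, y) ↔ σ ∈ tri D ∧ x ∈ σ ∧ y ∈ σ := by simp [trisOn]

theorem adj_of_mem_tri {σ : Finset V} (hσ : σ ∈ tri D) {x y : V} (hx : x ∈ σ) (hy : y ∈ σ)
    (hxy : x ≠ y) : (skeleton D).Adj x y :=
  ⟨hxy, (D.isRelLowerSet_faces (mem_tri.1 hσ).1).2
    (by intro w hw; simp at hw; rcases hw with rfl | rfl <;> assumption) (by simp)⟩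

theorem eq_of_mem_tri {σ : Finset V} (hσ : σ ∈ tri D) {x y z : V} (hx : x ∈ σ) (hy : y ∈ σ)
    (hz : z ∈ σ) (hxy : x ≠ y) (hxz : x ≠ z) (hyz : y ≠ z) : σ = {x, y, z} := by
  symm
  apply eq_of_subset_of_card_le
  · intro w hw
    simp at hw
    rcases hw with rfl | rfl | rfl <;> assumption
  · rw [(mem_tri.1 hσ).2, card_eq_three.2 ⟨x, y, z, hxy, hxz, hyz, rfl⟩]

theorem mem_apexes_iff {x y z : V} (hxy : x ≠ y) :
    z ∈ apexes D x y ↔ {x, y, z} ∈ tri D := by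
  rw [mem_tri]
  constructor
  · rintro ⟨h1, h2, h3⟩
    refine ⟨?_, card_eq_three.2 ⟨x, y, z, hxy, h1.symm, h2.symm, rfl⟩⟩
    convert h3
  · rintro ⟨h1, h2⟩
    refine ⟨?_, ?_, ?_⟩
    · rintro rfl
      have : ({z, y, z} : Finset V) = {z, y} := by ext; simp; tauto
      rw [this] at h2
      have := card_le_two (a := z) (b := y)
      omega
    · rintro rfl
      have : ({x, z, z} : Finset V) = {x, z} := by ext; simp
      rw [this] at h2
      have := card_le_two (a := x) (b := z)
      omega
    · convert h1

theorem exists_apex_of_mem_trisOn {σ : Finset V} {x y : V} (hxy : x ≠ y)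
    (hσ : σ ∈ trisOn D s(x, y)) : ∃ z, z ∈ apexes D x y ∧ σ = {x, y, z} := by
  obtain ⟨h1, hx, hy⟩ := mem_trisOn.1 hσ
  have hc : ((σ.erase x).erase y).card = 1 := by
    rw [card_erase_of_mem (mem_erase.2 ⟨hxy.symm, hy⟩), card_erase_of_mem hx, (mem_tri.1 h1).2]
  obtain ⟨z, hz⟩ := card_eq_one.1 hc
  have hz' : z ∈ (σ.erase x).erase y := by rw [hz]; simp
  simp only [mem_erase] at hz'
  have h := eq_of_mem_tri h1 hx hy hz'.2.2 hxy hz'.2.1.symm hz'.1.symm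
  exact ⟨z, (mem_apexes_iff hxy).2 (h ▸ h1), h⟩

theorem card_trisOn_eq_ncard {x y : V} (hxy : x ≠ y) :
    #(trisOn D s(x, y)) = (apexes D x y).ncard := by
  rw [← Set.ncard_coe_finset]
  symm
  apply Set.ncard_congr (fun z _ => {x, y, z})
  · intro z hz
    simp only [mem_coe, mem_trisOn]
    exact ⟨(mem_apexes_iff hxy).1 hz, by simp, by simp⟩
  · intro z w hz hw h
    have : z ∈ ({x, y, w} : Finset V) := by rw [← h]; simp
    simp at this
    rcases this with rfl | rfl | h
    · exact absurd rfl hz.1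
    · exact absurd rfl hz.2.1
    · exact h
  · intro σ hσ
    obtain ⟨z, hz, h⟩ := exists_apex_of_mem_trisOn hxy hσ
    exact ⟨z, hz, h.symm⟩

theorem neighborFinset_filter_mem {σ : Finset V} (hσ : σ ∈ tri D) {x : V} (hx : x ∈ σ) :
    {y ∈ (skeleton D).neighborFinset x | y ∈ σ} = σ.erase x := by
  ext y
  simp only [mem_filter, SimpleGraph.mem_neighborFinset, mem_erase]
  exact ⟨fun h => ⟨h.1.ne', h.2⟩, fun h => ⟨adj_of_mem_tri hσ hx h.2 h.1.symm, h.2⟩⟩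

theorem card_neighborFinset_filter_mem {σ : Finset V} (hσ : σ ∈ tri D) {x : V} (hx : x ∈ σ) :
    #{y ∈ (skeleton D).neighborFinset x | y ∈ σ} = 2 := by
  rw [neighborFinset_filter_mem hσ hx, card_erase_of_mem hx, (mem_tri.1 hσ).2]

/-- A triangle at `x` has exactly two of its edges at `x`. Modulo two this gives that the boundary
of a boundary vanishes; over the naturals it counts the triangles at a vertex. -/
theorem sum_neighbor_trisOn {M : Type*} [AddCommMonoid M] (g : Finset V → M) (x : V) :
    ∑ y ∈ (skeleton D).neighborFinset x, ∑ σ ∈ trisOn D s(x, y), g σ =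
      ∑ σ ∈ tri D with x ∈ σ, 2 • g σ := by
  have h : ∀ y, ∑ σ ∈ trisOn D s(x, y), g σ =
      ∑ σ ∈ tri D with x ∈ σ, if y ∈ σ then g σ else 0 := by
    intro y
    rw [← sum_filter, filter_filter]
    apply sum_congr _ (fun _ _ => rfl)
    ext σ
    simp [mem_trisOn]
  simp_rw [h]
  rw [sum_comm]
  apply sum_congr rfl
  intro σ hσ
  rw [mem_filter] at hσ
  rw [← sum_filter, sum_const, card_neighborFinset_filter_mem hσ.1 hσ.2]

theorem bd₁_bd₂ (r : Finset V → ZMod 2) : bd₁ D (bd₂ D r) = 0 := by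
  ext x
  rw [bd₁_apply]
  simp_rw [bd₂_apply]
  rw [sum_neighbor_trisOn]
  apply sum_eq_zero
  intro σ _
  rw [two_nsmul, CharTwo.add_self_eq_zero]

theorem bd₁_single {x y : V} (h : (skeleton D).Adj x y) :
    bd₁ D (Pi.single s(x, y) 1) = Pi.single x 1 + Pi.single y 1 := by
  ext w
  rw [bd₁_apply, Pi.add_apply]
  have hne := h.ne
  by_cases hwx : w = x
  · subst hwx
    rw [sum_eq_single y]
    · simp [hne]
    · intro b _ hb
      rw [Pi.single_apply, if_neg]
      rw [Sym2.eq_iff]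
      rintro (h | h)
      · exact hb h.2
      · exact hne h.1
    · intro h'
      exact absurd (by simpa using h) h'
  · by_cases hwy : w = y
    · subst hwy
      rw [sum_eq_single x]
      · simp [hwx, Sym2.eq_swap]
      · intro b _ hb
        rw [Pi.single_apply, if_neg]
        rw [Sym2.eq_iff]
        rintro (h | h)
        · exact hwx h.1
        · exact hb h.2
      · intro h'
        exact absurd (by simpa using h.symm) h'
    · rw [sum_eq_zero]
      · simp [hwx, hwy]
      · intro b _
        rw [Pi.single_apply, if_neg]
        rw [Sym2.eq_iff]
        rintro (h | h)
        · exact hwx h.1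
        · exact hwy h.1

theorem IsDisc.card_trisOn (hD : IsDisc D) {x y : V} (h : (skeleton D).Adj x y) :
    #(trisOn D s(x, y)) = 1 ∨ #(trisOn D s(x, y)) = 2 := by
  rw [card_trisOn_eq_ncard h.ne]
  exact hD.link_degree x y h

theorem IsInterior.card_trisOn (hD : IsDisc D) {x y : V} (hx : IsInterior D x)
    (h : (skeleton D).Adj x y) : #(trisOn D s(x, y)) = 2 := by
  rcases hD.card_trisOn h with h1 | h1
  · exact absurd ⟨y, h, by rw [← card_trisOn_eq_ncard h.ne]; exact h1⟩ hx
  · exact h1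

/-- A set of neighbours of `x` which is closed under adjacency in the link is everything. -/
theorem IsDisc.link_induction (hD : IsDisc D) (x : V) (P : V → Prop) {y₀ : V}
    (h₀ : (skeleton D).Adj x y₀) (hP : P y₀)
    (hstep : ∀ y z, (skeleton D).Adj x y → P y → {x, y, z} ∈ tri D → P z) :
    ∀ y, (skeleton D).Adj x y → P y := by
  intro y hy
  obtain ⟨p⟩ := (hD.link_connected x).preconnected ⟨y₀, h₀⟩ ⟨y, hy⟩
  suffices H : ∀ (a b : (skeleton D).neighborSet x) (_ : (linkGraph D x).Walk a b),
      P a → P b from H _ _ p hP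
  intro a b p
  induction p with
  | nil => exact id
  | @cons a b c hab _ ih =>
    intro ha
    apply ih
    have hadj : (skeleton D).Adj x a := a.2
    have hbdj : (skeleton D).Adj x b := b.2
    rw [linkGraph, SimpleGraph.fromRel_adj] at hab
    rcases hab.2 with h | h
    · exact hstep a b hadj ha ((mem_apexes_iff hadj.ne).1 h)
    · refine hstep a b hadj ha ?_
      have := (mem_apexes_iff hbdj.ne).1 h
      rwa [pair_comm] at this

/-- An edge lies in one or two triangles, so a triangle of the chain can cancel at the edge only
against a second one. -/
theorem IsDisc.eq_one_of_bd₂_eq_zero (hD : IsDisc D) {r : Finset V → ZMod 2} {x y : V}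
    (h : (skeleton D).Adj x y) (hr : bd₂ D r s(x, y) = 0) {σ : Finset V}
    (hσ : σ ∈ trisOn D s(x, y)) (hrσ : r σ = 1) :
    #(trisOn D s(x, y)) = 2 ∧ ∀ σ' ∈ trisOn D s(x, y), r σ' = 1 := by
  rw [bd₂_apply] at hr
  rcases hD.card_trisOn h with hc | hc
  · obtain ⟨τ, hτ⟩ := card_eq_one.1 hc
    rw [hτ] at hσ hr
    simp at hσ hr
    subst hσ
    rw [hr] at hrσ
    exact absurd hrσ (by decide)
  · refine ⟨hc, ?_⟩
    obtain ⟨a, b, hab, hs⟩ := card_eq_two.1 hc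
    rw [hs] at hσ hr ⊢
    rw [sum_pair hab] at hr
    simp only [mem_insert, mem_singleton] at hσ
    have key : ∀ p q : ZMod 2, p + q = 0 → p = q := by decide
    have := key _ _ hr
    intro σ' hσ'
    simp only [mem_insert, mem_singleton] at hσ'
    rcases hσ with rfl | rfl <;> rcases hσ' with rfl | rfl <;> simp_all

/-- Cancellation passes from a triangle at `x` to its neighbour across an edge at `x`; as the link
is connected, it reaches the whole star. -/
theorem IsDisc.star_full (hD : IsDisc D) {r : Finset V → ZMod 2} {x : V}
    (hr : ∀ y, (skeleton D).Adj x y → bd₂ D r s(x, y) = 0) {σ : Finset V}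
    (hσ : σ ∈ tri D) (hxσ : x ∈ σ) (hrσ : r σ = 1) (y : V) (hy : (skeleton D).Adj x y) :
    #(trisOn D s(x, y)) = 2 ∧ ∀ σ' ∈ trisOn D s(x, y), r σ' = 1 := by
  obtain ⟨y₀, hy₀⟩ : (σ.erase x).Nonempty := by
    rw [← card_pos, card_erase_of_mem hxσ, (mem_tri.1 hσ).2]; norm_num
  rw [mem_erase] at hy₀
  have h₀ := adj_of_mem_tri hσ hxσ hy₀.2 hy₀.1.symm
  have := hD.link_induction x (fun y => ∃ σ ∈ trisOn D s(x, y), r σ = 1) h₀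
    ⟨σ, mem_trisOn.2 ⟨hσ, hxσ, hy₀.2⟩, hrσ⟩ (by
      rintro y z hy ⟨τ, hτ, hrτ⟩ hz
      have h1 := (hD.eq_one_of_bd₂_eq_zero hy (hr y hy) hτ hrτ).2 {x, y, z}
        (mem_trisOn.2 ⟨hz, by simp, by simp⟩)
      exact ⟨_, mem_trisOn.2 ⟨hz, by simp, by simp⟩, h1⟩) y hy
  obtain ⟨τ, hτ, hrτ⟩ := this
  exact hD.eq_one_of_bd₂_eq_zero hy (hr y hy) hτ hrτ

theorem IsDisc.exists_trisOn (hD : IsDisc D) {x y : V} (h : (skeleton D).Adj x y) :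
    ∃ σ, σ ∈ trisOn D s(x, y) := by
  have : #(trisOn D s(x, y)) ≠ 0 := by rcases hD.card_trisOn h with h | h <;> omega
  exact card_ne_zero.1 this

/-- Vanishing second homology: a nonzero 2-cycle would fill the star of one vertex, then of every
vertex by connectedness, in particular the star of a boundary vertex. -/
theorem IsDisc.eq_zero_of_bd₂_eq_zero (hD : IsDisc D) {r : Finset V → ZMod 2}
    (hr : ∀ e ∈ (skeleton D).edgeSet, bd₂ D r e = 0) {σ : Finset V} (hσ : σ ∈ tri D) :
    r σ = 0 := by
  rcases zmod_two_eq_zero_or_one (r σ) with h | h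
  · exact h
  exfalso
  have hr' : ∀ x y, (skeleton D).Adj x y → bd₂ D r s(x, y) = 0 := fun x y h => hr _ h
  obtain ⟨x₀, hx₀⟩ : σ.Nonempty := by
    rw [← card_pos, (mem_tri.1 hσ).2]; norm_num
  have key : ∀ x, ∃ σ ∈ tri D, x ∈ σ ∧ r σ = 1 := by
    intro x
    obtain ⟨p⟩ := hD.connected.preconnected x₀ x
    suffices H : ∀ (a b : V) (_ : (skeleton D).Walk a b),
      (∃ σ ∈ tri D, a ∈ σ ∧ r σ = 1) → ∃ σ ∈ tri D, b ∈ σ ∧ r σ = 1 from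
        H _ _ p ⟨σ, hσ, hx₀, h⟩
    intro a b p
    induction p with
    | nil => exact id
    | @cons a b c hab _ ih =>
      rintro ⟨τ, hτ, haτ, hrτ⟩
      apply ih
      obtain ⟨ρ, hρ⟩ := hD.exists_trisOn hab
      exact ⟨ρ, (mem_trisOn.1 hρ).1, (mem_trisOn.1 hρ).2.2,
        (hD.star_full (hr' a) hτ haτ hrτ b hab).2 ρ hρ⟩
  -- A boundary edge lies in one triangle only, so nothing can cancel there.
  obtain ⟨x, y, hxy, hc⟩ := hD.boundary_nonempty
  obtain ⟨τ, hτ, hxτ, hrτ⟩ := key x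
  have := (hD.star_full (hr' x) hτ hxτ hrτ y hxy).1
  rw [card_trisOn_eq_ncard hxy.ne] at this
  omega

/-- A 1-chain joining `x` to `o`, made of edges with an end closer to `o` than `x`. -/
theorem IsDisc.exists_chain (hD : IsDisc D) (o x : V) :
    ∃ c : Sym2 V → ZMod 2, bd₁ D c = Pi.single x 1 + Pi.single o 1 ∧
      ∀ e, c e ≠ 0 → e ∈ (skeleton D).edgeSet ∧
        ∃ y ∈ e, (skeleton D).dist o y < (skeleton D).dist o x := by
  generalize hk : (skeleton D).dist o x = k
  induction k generalizing x with
  | zero =>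
    have : o = x := hD.connected.dist_eq_zero_iff.1 hk
    subst this
    refine ⟨0, ?_, by simp⟩
    ext i
    simp [CharTwo.add_self_eq_zero]
  | succ k ih =>
    obtain ⟨y, hxy, hy⟩ := exists_adj_dist_eq hD.connected hk
    obtain ⟨c, hc, hsupp⟩ := ih y hy
    refine ⟨Pi.single s(x, y) 1 + c, ?_, ?_⟩
    · rw [map_add, hc, bd₁_single hxy]
      ext i
      simp only [Pi.add_apply]
      linear_combination (CharTwo.add_self_eq_zero ((Pi.single y 1 : V → ZMod 2) i))
    · intro e he
      by_cases h : e = s(x, y)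
      · subst h
        exact ⟨hxy, y, by simp, by omega⟩
      · have : c e ≠ 0 := by simpa [h] using he
        obtain ⟨h1, z, hz, hlt⟩ := hsupp e this
        exact ⟨h1, z, hz, by omega⟩

theorem bd₁_congr {z z' : Sym2 V → ZMod 2} (h : ∀ e ∈ (skeleton D).edgeSet, z e = z' e) :
    bd₁ D z = bd₁ D z' := by
  ext x
  rw [bd₁_apply, bd₁_apply]
  exact sum_congr rfl fun y hy => h _ (by simpa using hy)

theorem bd₂_congr {r r' : Finset V → ZMod 2} (h : ∀ σ ∈ tri D, r σ = r' σ) :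
    bd₂ D r = bd₂ D r' := by
  ext e
  rw [bd₂_apply, bd₂_apply]
  exact sum_congr rfl fun σ hσ => h σ (mem_filter.1 hσ).1

/-- The first homology of a disc vanishes. -/
theorem IsDisc.exists_bd₂_eq (hD : IsDisc D) {z : Sym2 V → ZMod 2} (hz : bd₁ D z = 0) :
    ∃ r : Finset V → ZMod 2, (∀ σ ∉ tri D, r σ = 0) ∧
      ∀ e ∈ (skeleton D).edgeSet, bd₂ D r e = z e := by
  -- The chain spaces contain coordinates at pairs and sets that are not simplices. Restriction to
  -- actual edges and triangles, with extension by zero as inverse, makes their dimensions the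
  -- numbers in the Euler characteristic.
  let i₁ : {e // e ∈ (skeleton D).edgeFinset} → Sym2 V := Subtype.val
  let i₂ : {σ // σ ∈ tri D} → Finset V := Subtype.val
  have e₁ : ∀ (w : {e // e ∈ (skeleton D).edgeFinset} → ZMod 2) (e), 
      Function.ExtendByZero.linearMap (ZMod 2) i₁ w (i₁ e) = w e :=
    fun w e => Subtype.val_injective.extend_apply _ _ _
  have e₂ : ∀ (w : {σ // σ ∈ tri D} → ZMod 2) (e), 
      Function.ExtendByZero.linearMap (ZMod 2) i₂ w (i₂ e) = w e :=
    fun w e => Subtype.val_injective.extend_apply _ _ _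
  have r₁ : ∀ w : Sym2 V → ZMod 2,
      bd₁ D (Function.ExtendByZero.linearMap (ZMod 2) i₁ (fun e => w e.1)) = bd₁ D w :=
    fun w => bd₁_congr fun e he => e₁ (fun e => w e.1) ⟨e, by simpa using he⟩
  obtain ⟨o⟩ := hD.connected.nonempty
  obtain ⟨r, hr⟩ := exists_preimage_of_card
    (bd₁ D ∘ₗ Function.ExtendByZero.linearMap (ZMod 2) i₁)
    (LinearMap.funLeft _ _ i₁ ∘ₗ bd₂ D ∘ₗ Function.ExtendByZero.linearMap (ZMod 2) i₂)
    (fun r => (r₁ _).trans (bd₁_bd₂ _))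
    (fun r hr => by
      ext σ
      rw [← e₂ r σ]
      refine hD.eq_zero_of_bd₂_eq_zero (fun e he => ?_) σ.2
      exact congrFun hr ⟨e, by simpa using he⟩)
    o
    (fun a => by
      obtain ⟨c, hc, -⟩ := hD.exists_chain o a
      exact ⟨fun e => c e.1, (r₁ c).trans hc⟩)
    (by
      have h := hD.euler
      have h1 : (skeleton D).edgeSet.ncard = #(skeleton D).edgeFinset := by
        rw [← Set.ncard_coe_finset, SimpleGraph.coe_edgeFinset]
      have h2 : (triangles D).ncard = #(tri D) := by
        rw [← Set.ncard_coe_finset]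
        congr 1
        ext σ
        simp [triangles, mem_tri]
      rw [Nat.card_eq_fintype_card, h1, h2] at h
      rw [Fintype.card_coe, Fintype.card_coe]
      omega)
    (fun e => z e.1) ((r₁ z).trans hz)
  refine ⟨Function.ExtendByZero.linearMap (ZMod 2) i₂ r, ?_, ?_⟩
  · intro σ hσ
    refine Function.extend_apply' _ _ _ ?_
    rintro ⟨τ, rfl⟩
    exact hσ τ.2
  · intro e he
    exact congrFun hr ⟨e, by simpa using he⟩

end Chains

/-! ### Regions bounded by a minimal cycle, and the Gauss–Bonnet inequality -/

section GaussBonnet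

open Classical

variable {V : Type v} [Fintype V] {D : AbstractSimplicialComplex V}

theorem sum_neighbor_eq_sum_edge {M : Type*} [AddCommMonoid M] (G : SimpleGraph V)
    (g : Sym2 V → M) (x : V) :
    ∑ y ∈ G.neighborFinset x, g s(x, y) = ∑ e ∈ G.edgeFinset with x ∈ e, g e := by
  apply sum_bij (fun y _ => s(x, y))
  · intro y hy
    simpa using hy
  · intro y _ y' _ h
    exact Sym2.congr_right.1 h
  · intro e he
    simp only [mem_filter, SimpleGraph.mem_edgeFinset] at he
    obtain ⟨y, rfl⟩ := he.2
    exact ⟨y, by simpa using he.1, rfl⟩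
  · intros; rfl

theorem sum_sum_neighbor {M : Type*} [AddCommMonoid M] (G : SimpleGraph V) (g : Sym2 V → M) :
    ∑ x, ∑ y ∈ G.neighborFinset x, g s(x, y) = ∑ e ∈ G.edgeFinset, 2 • g e := by
  simp_rw [sum_neighbor_eq_sum_edge, sum_filter]
  rw [sum_comm]
  apply sum_congr rfl
  intro e he
  rw [← sum_filter, sum_const]
  congr 1
  induction e with
  | _ a b =>
    have hab : G.Adj a b := by simpa using he
    have : ({x | x ∈ s(a, b)} : Finset V) = {a, b} := by ext; simp
    rw [this, card_pair hab.ne]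

variable (D)

/-- The number of 2-simplices of the chain `r` at the vertex `x`. -/
noncomputable def starCount (r : Finset V → ZMod 2) (x : V) : ℕ :=
  #{σ ∈ tri D | x ∈ σ ∧ r σ = 1}

/-- The number of edges of the chain `z` at the vertex `x`. -/
noncomputable def degOf (z : Sym2 V → ZMod 2) (x : V) : ℕ :=
  #{y ∈ (skeleton D).neighborFinset x | z s(x, y) = 1}

variable {D}

/-- A 1-cycle which contains no smaller nonzero 1-cycle. -/
def IsCircuit (D : AbstractSimplicialComplex V) (z : Sym2 V → ZMod 2) : Prop :=
  ∀ z' : Sym2 V → ZMod 2, bd₁ D z' = 0 →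
    (∀ e, z' e ≠ 0 → e ∈ (skeleton D).edgeSet ∧ z e ≠ 0) →
    (∀ e, z' e = 0) ∨ ∀ e ∈ (skeleton D).edgeSet, z' e = z e

/-- The closure of the region has vanishing first homology. A 1-cycle in it is filled by some chain
`p` of the disc; the part `q` of `p` outside the region has its boundary inside the bounding
circuit, so by minimality that boundary is zero or the whole circuit. Vanishing second homology
gives `q = 0` in the first case and excludes the second, so `p` lies in the region. -/
theorem IsDisc.euler_region (hD : IsDisc D) {r : Finset V → ZMod 2}
    (hcirc : IsCircuit D (bd₂ D r)) {σ₀ : Finset V} (hσ₀ : σ₀ ∈ tri D) (hr₀ : r σ₀ = 1) :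
    #{e ∈ (skeleton D).edgeFinset | ∃ σ ∈ tri D, r σ = 1 ∧ e ∈ σ.sym2} + 1 ≤
      #{x : V | ∃ σ ∈ tri D, r σ = 1 ∧ x ∈ σ} + #{σ ∈ tri D | r σ = 1} := by
  set ES := {e ∈ (skeleton D).edgeFinset | ∃ σ ∈ tri D, r σ = 1 ∧ e ∈ σ.sym2} with hES
  set VS := ({x : V | ∃ σ ∈ tri D, r σ = 1 ∧ x ∈ σ} : Finset V) with hVS
  set R := {σ ∈ tri D | r σ = 1} with hR
  let i₀ : {x // x ∈ VS} → V := Subtype.val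
  let i₁ : {e // e ∈ ES} → Sym2 V := Subtype.val
  let i₂ : {σ // σ ∈ R} → Finset V := Subtype.val
  let X₁ := Function.ExtendByZero.linearMap (ZMod 2) i₁
  let X₂ := Function.ExtendByZero.linearMap (ZMod 2) i₂
  have e₁ : ∀ (w : {e // e ∈ ES} → ZMod 2) (e), X₁ w (i₁ e) = w e :=
    fun w e => Subtype.val_injective.extend_apply _ _ _
  have e₁' : ∀ (w : {e // e ∈ ES} → ZMod 2) (e), e ∉ ES → X₁ w e = 0 := by
    intro w e he
    refine Function.extend_apply' _ _ _ ?_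
    rintro ⟨τ, rfl⟩
    exact he τ.2
  have e₂ : ∀ (w : {σ // σ ∈ R} → ZMod 2) (e), X₂ w (i₂ e) = w e :=
    fun w e => Subtype.val_injective.extend_apply _ _ _
  have e₂' : ∀ (w : {σ // σ ∈ R} → ZMod 2) (e), e ∉ R → X₂ w e = 0 := by
    intro w e he
    refine Function.extend_apply' _ _ _ ?_
    rintro ⟨τ, rfl⟩
    exact he τ.2
  have hout : ∀ w, ∀ x ∉ VS, bd₁ D (X₁ w) x = 0 := by
    intro w x hx
    rw [bd₁_apply]
    apply sum_eq_zero
    intro y _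
    apply e₁'
    intro h
    apply hx
    obtain ⟨σ, hσ, hrσ, h2⟩ := (mem_filter.1 h).2
    exact mem_filter.2 ⟨mem_univ _, σ, hσ, hrσ, (mk_mem_sym2_iff.1 h2).1⟩
  have hne : Nonempty {x // x ∈ VS} := by
    obtain ⟨x₀, hx₀⟩ : σ₀.Nonempty := by
      rw [← card_pos, (mem_tri.1 hσ₀).2]; norm_num
    exact ⟨⟨x₀, mem_filter.2 ⟨mem_univ _, σ₀, hσ₀, hr₀, hx₀⟩⟩⟩
  have := card_add_one_le_of_exact
    (LinearMap.funLeft _ _ i₀ ∘ₗ bd₁ D ∘ₗ X₁)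
    (LinearMap.funLeft _ _ i₁ ∘ₗ bd₂ D ∘ₗ X₂)
    (fun z => by
      have h1 : ∑ a : {x // x ∈ VS}, bd₁ D (X₁ z) a.1 = ∑ x, bd₁ D (X₁ z) x := by
        rw [Finset.sum_coe_sort VS (fun x => bd₁ D (X₁ z) x)]
        exact sum_subset (subset_univ _) fun x _ hx => hout z x hx
      refine h1.trans ?_
      simp_rw [bd₁_apply]
      rw [sum_sum_neighbor]
      apply sum_eq_zero
      intro e _
      rw [two_nsmul, CharTwo.add_self_eq_zero])
    (fun z hz => by
      have hz' : bd₁ D (X₁ z) = 0 := by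
        ext x
        by_cases hx : x ∈ VS
        · exact congrFun hz ⟨x, hx⟩
        · exact hout z x hx
      obtain ⟨p, hp, hpz⟩ := hD.exists_bd₂_eq hz'
      let q : Finset V → ZMod 2 := fun σ => if r σ = 1 then 0 else p σ
      -- Such an edge carries a triangle outside the region. If it also carries one inside, it lies
      -- on the circuit; if not, it is no edge of the region, where the cycle, and with it the
      -- boundary of `q`, vanishes.
      have hq0 : ∀ e, bd₂ D q e ≠ 0 → e ∈ (skeleton D).edgeSet → bd₂ D r e ≠ 0 := by
        intro e he hedge
        have hn : ∃ τ ∈ trisOn D e, q τ ≠ 0 := exists_ne_zero_of_sum_ne_zero he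
        obtain ⟨τ, hτ, hqτ⟩ := hn
        have hrτ : r τ ≠ 1 := by
          intro h
          simp [q, h] at hqτ
        by_cases hsome : ∃ σ ∈ trisOn D e, r σ = 1
        · obtain ⟨σ, hσ, hrσ⟩ := hsome
          intro h0
          induction e with
          | _ a b => exact hrτ ((hD.eq_one_of_bd₂_eq_zero hedge h0 hσ hrσ).2 τ hτ)
        · exfalso
          apply he
          have h1 : bd₂ D q e = bd₂ D p e := by
            rw [bd₂_apply, bd₂_apply]
            apply sum_congr rfl
            intro σ hσ
            have : r σ ≠ 1 := fun h => hsome ⟨σ, hσ, h⟩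
            simp [q, this]
          rw [h1, hpz e hedge]
          apply e₁'
          intro h
          obtain ⟨σ, hσ, hrσ, h2⟩ := (mem_filter.1 h).2
          exact hsome ⟨σ, mem_filter.2 ⟨hσ, h2⟩, hrσ⟩
      have hq : ∀ σ ∈ tri D, q σ = 0 := by
        have hz'' : ∀ e ∈ (skeleton D).edgeSet,
            (if e ∈ (skeleton D).edgeSet then bd₂ D q e else 0) = bd₂ D q e := by
          intro e he
          rw [if_pos he]
        rcases hcirc (fun e => if e ∈ (skeleton D).edgeSet then bd₂ D q e else 0)
          ((bd₁_congr hz'').trans (bd₁_bd₂ q))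
          (by
            intro e he
            by_cases h : e ∈ (skeleton D).edgeSet
            · rw [if_pos h] at he
              exact ⟨h, hq0 e he h⟩
            · rw [if_neg h] at he
              exact absurd rfl he) with h | h
        · intro σ hσ
          refine hD.eq_zero_of_bd₂_eq_zero (r := q) (fun e he => ?_) hσ
          rw [← h e, if_pos he]
        · exfalso
          -- Here `q + r` is a 2-cycle, but it takes the value one at `σ₀`.
          have h3 := hD.eq_zero_of_bd₂_eq_zero (r := q + r) (fun e he => by
            have := h e he
            simp only [if_pos he] at this
            rw [map_add, Pi.add_apply, this, CharTwo.add_self_eq_zero]) hσ₀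
          simp [q, hr₀] at h3
      refine ⟨fun σ => p σ.1, ?_⟩
      have hX : bd₂ D (X₂ fun σ => p σ.1) = bd₂ D p := by
        apply bd₂_congr
        intro σ hσ
        by_cases h : r σ = 1
        · exact e₂ (fun σ => p σ.1) ⟨σ, mem_filter.2 ⟨hσ, h⟩⟩
        · rw [e₂' _ _ (fun h' => h (mem_filter.1 h').2)]
          have := hq σ hσ
          simp only [q, if_neg h] at this
          exact this.symm
      ext e
      have h5 : bd₂ D (X₂ fun σ => p σ.1) e.1 = z e := by
        rw [hX, hpz e.1 (by simpa using (mem_filter.1 e.2).1)]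
        exact e₁ z e
      exact h5)
  rwa [Fintype.card_coe, Fintype.card_coe, Fintype.card_coe] at this

theorem two_mul_starCount (r : Finset V → ZMod 2) (x : V) :
    2 * starCount D r x =
      ∑ y ∈ (skeleton D).neighborFinset x, #{σ ∈ trisOn D s(x, y) | r σ = 1} := by
  have h := sum_neighbor_trisOn (D := D) (fun σ => if r σ = 1 then 1 else 0) x
  simp only [← card_filter] at h
  rw [h, starCount, ← filter_filter, card_filter, mul_sum]
  simp

/-- An edge of the region lies in two of its triangles, or in one of them and on the bounding cycle.
Summed over all edges this is `3F + b = 2E`, with `b` the length of the boundary. -/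
theorem IsDisc.card_filter_trisOn (hD : IsDisc D) (r : Finset V → ZMod 2) {x y : V}
    (h : (skeleton D).Adj x y) :
    #{σ ∈ trisOn D s(x, y) | r σ = 1} + (if bd₂ D r s(x, y) = 1 then 1 else 0) =
      2 * if ∃ σ ∈ tri D, r σ = 1 ∧ s(x, y) ∈ σ.sym2 then 1 else 0 := by
  have hb : bd₂ D r s(x, y) = (#{σ ∈ trisOn D s(x, y) | r σ = 1} : ZMod 2) := by
    rw [bd₂_apply, card_filter]
    push_cast
    apply sum_congr rfl
    intro σ _
    rcases zmod_two_eq_zero_or_one (r σ) with h | h <;> simp [h]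
  have hle : #{σ ∈ trisOn D s(x, y) | r σ = 1} ≤ 2 := by
    refine (card_filter_le _ _).trans ?_
    rcases hD.card_trisOn h with h | h <;> omega
  have hex : (∃ σ ∈ tri D, r σ = 1 ∧ s(x, y) ∈ σ.sym2) ↔
      #{σ ∈ trisOn D s(x, y) | r σ = 1} ≠ 0 := by
    rw [card_ne_zero]
    constructor
    · rintro ⟨σ, h1, h2, h3⟩
      exact ⟨σ, mem_filter.2 ⟨mem_filter.2 ⟨h1, h3⟩, h2⟩⟩
    · rintro ⟨σ, hσ⟩
      rw [mem_filter, trisOn, mem_filter] at hσ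
      exact ⟨σ, hσ.1.1, hσ.2, hσ.1.2⟩
  rw [hb]
  simp only [hex]
  generalize #{σ ∈ trisOn D s(x, y) | r σ = 1} = c at hle ⊢
  interval_cases c <;> decide

/-- The combinatorial Gauss–Bonnet inequality for the region bounded by a circuit. -/
theorem IsDisc.gauss_bonnet (hD : IsDisc D)
    (hdeg : ∀ x, IsInterior D x → 6 ≤ #((skeleton D).neighborFinset x))
    {r : Finset V → ZMod 2} (hcirc : IsCircuit D (bd₂ D r)) (X : Finset V) (hXne : X.Nonempty)
    (hd : ∀ x, degOf D (bd₂ D r) x = 0 ∨ degOf D (bd₂ D r) x = 2)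
    (hX : ∀ x ∈ X, degOf D (bd₂ D r) x = 2)
    (hX' : ∀ x ∉ X, degOf D (bd₂ D r) x = 2 → 3 ≤ starCount D r x) :
    6 + ∑ x ∈ X, starCount D r x ≤ 3 * #X := by
  set z := bd₂ D r with hz
  set ES := {e ∈ (skeleton D).edgeFinset | ∃ σ ∈ tri D, r σ = 1 ∧ e ∈ σ.sym2} with hES
  set VS := ({x : V | ∃ σ ∈ tri D, r σ = 1 ∧ x ∈ σ} : Finset V) with hVS
  set R := {σ ∈ tri D | r σ = 1} with hR
  have hmemVS : ∀ x, degOf D z x ≠ 0 → x ∈ VS := by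
    intro x hx
    obtain ⟨y, hy⟩ := card_ne_zero.1 hx
    have hy := (mem_filter.1 hy).2
    have : bd₂ D r s(x, y) ≠ 0 := by rw [← hz, hy]; decide
    obtain ⟨σ, hσ, hne⟩ := exists_ne_zero_of_sum_ne_zero this
    have h1 : r σ = 1 := (zmod_two_eq_zero_or_one _).resolve_left hne
    exact mem_filter.2 ⟨mem_univ _, σ, (mem_trisOn.1 hσ).1, h1, (mem_trisOn.1 hσ).2.1⟩
  have heuler : #ES + 1 ≤ #VS + #R := by
    obtain ⟨x, hx⟩ := hXne
    obtain ⟨σ, h1, h2, h3⟩ := (mem_filter.1 (hmemVS x (by rw [hX x hx]; norm_num))).2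
    exact hD.euler_region hcirc h1 h2
  have hstar : ∑ x, starCount D r x = 3 * #R := by
    simp only [starCount, card_filter]
    rw [sum_comm, hR, card_filter, mul_sum]
    apply sum_congr rfl
    intro σ hσ
    by_cases h : r σ = 1
    · simp only [h, and_true]
      rw [← card_filter]
      simp [(mem_tri.1 hσ).2]
    · simp [h]
  have hedges : 3 * #R + #{e ∈ (skeleton D).edgeFinset | z e = 1} = 2 * #ES := by
    have h1 : ∑ x, 2 * starCount D r x =
        ∑ e ∈ (skeleton D).edgeFinset, 2 • #{σ ∈ trisOn D e | r σ = 1} := by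
      rw [← sum_sum_neighbor]
      exact sum_congr rfl fun x _ => two_mul_starCount r x
    rw [← mul_sum, hstar] at h1
    have h2 : ∑ e ∈ (skeleton D).edgeFinset, #{σ ∈ trisOn D e | r σ = 1} = 3 * #R := by
      simp only [smul_eq_mul] at h1
      rw [← mul_sum] at h1
      omega
    rw [← h2, card_filter, ← sum_add_distrib, hES, card_filter, mul_sum]
    apply sum_congr rfl
    intro e he
    induction e with
    | _ a b => exact hD.card_filter_trisOn r (by simpa using he)
  have hdegs : ∑ x, degOf D z x = 2 * #{e ∈ (skeleton D).edgeFinset | z e = 1} := by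
    simp only [degOf, card_filter]
    rw [sum_sum_neighbor (skeleton D) (fun e => if z e = 1 then 1 else 0), mul_sum]
    simp
  have hzero : ∀ x ∉ VS, starCount D r x = 0 := by
    intro x hx
    rw [starCount, card_eq_zero, filter_eq_empty_iff]
    rintro σ hσ ⟨h1, h2⟩
    exact hx (mem_filter.2 ⟨mem_univ _, σ, hσ, h2, h1⟩)
  have hzero' : ∀ x ∉ VS, degOf D z x = 0 := fun x hx => by
    by_contra h
    exact hx (hmemVS x h)
  have hstar' : ∑ x ∈ VS, starCount D r x = 3 * #R := by
    rw [← hstar]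
    exact sum_subset (subset_univ _) fun x _ hx => hzero x hx
  have hdegs' : ∑ x ∈ VS, degOf D z x = 2 * #{e ∈ (skeleton D).edgeFinset | z e = 1} := by
    rw [← hdegs]
    exact sum_subset (subset_univ _) fun x _ hx => hzero' x hx
  -- The sum is `12V - 6F - 6b`, as the stars add up to `3F` and the degrees to `2b`. By `3F + b =
  -- 2E` this equals `12(V - E + F)`.
  have hmain : (12 : ℤ) ≤ ∑ x ∈ VS, (12 - 2 * (starCount D r x : ℤ) - 3 * degOf D z x) := by
    rw [sum_sub_distrib, sum_sub_distrib, ← mul_sum, ← mul_sum]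
    have a1 : (∑ x ∈ VS, (starCount D r x : ℤ)) = 3 * #R := by exact_mod_cast hstar'
    have a2 : (∑ x ∈ VS, (degOf D z x : ℤ)) =
      2 * #{e ∈ (skeleton D).edgeFinset | z e = 1} := by exact_mod_cast hdegs'
    rw [a1, a2, sum_const, nsmul_eq_mul]
    omega
  -- Off the circuit the region contains the full star, so the vertex is interior in `D` and has as
  -- many triangles as neighbours, at least six; its weight is then at most zero.
  have hint : ∀ x ∈ VS, degOf D z x = 0 → 6 ≤ starCount D r x := by
    intro x hx h0
    obtain ⟨σ, hσ, hrσ, hxσ⟩ := (mem_filter.1 hx).2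
    have hr : ∀ y, (skeleton D).Adj x y → bd₂ D r s(x, y) = 0 := by
      intro y hy
      refine (zmod_two_eq_zero_or_one _).resolve_right fun h => ?_
      rw [degOf, card_eq_zero, filter_eq_empty_iff] at h0
      exact h0 (by simpa using hy) h
    have hfull := hD.star_full hr hσ hxσ hrσ
    have hintr : IsInterior D x := by
      rintro ⟨y, hy, hc⟩
      have := (hfull y hy).1
      rw [card_trisOn_eq_ncard hy.ne] at this
      omega
    have h2 := two_mul_starCount (D := D) r x
    have h3 : ∑ y ∈ (skeleton D).neighborFinset x, #{σ ∈ trisOn D s(x, y) | r σ = 1} =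
        ∑ y ∈ (skeleton D).neighborFinset x, 2 := by
      apply sum_congr rfl
      intro y hy
      have hy' : (skeleton D).Adj x y := by simpa using hy
      rw [filter_true_of_mem (hfull y hy').2, (hfull y hy').1]
    rw [h3, sum_const, smul_eq_mul] at h2
    have := hdeg x hintr
    omega
  have hsub : X ⊆ VS := fun x hx => hmemVS x (by rw [hX x hx]; norm_num)
  have hle : ∑ x ∈ VS, (12 - 2 * (starCount D r x : ℤ) - 3 * degOf D z x) ≤
      ∑ x ∈ X, (12 - 2 * (starCount D r x : ℤ) - 3 * degOf D z x) := by
    rw [← sum_sdiff hsub]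
    have : ∑ x ∈ VS \ X, (12 - 2 * (starCount D r x : ℤ) - 3 * degOf D z x) ≤ 0 := by
      apply sum_nonpos
      intro x hx
      rw [mem_sdiff] at hx
      rcases hd x with h | h
      · have := hint x hx.1 h
        omega
      · have := hX' x hx.2 h
        omega
    omega
  have hfin : ∑ x ∈ X, (12 - 2 * (starCount D r x : ℤ) - 3 * degOf D z x) =
      ∑ x ∈ X, (6 - 2 * (starCount D r x : ℤ)) := by
    apply sum_congr rfl
    intro x hx
    rw [hX x hx]
    ring
  replace hle := hmain.trans hle
  rw [hfin, sum_sub_distrib, ← mul_sum, sum_const, nsmul_eq_mul] at hle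
  have a3 : (∑ x ∈ X, (starCount D r x : ℤ)) = ((∑ x ∈ X, starCount D r x : ℕ) : ℤ) := by
    push_cast; rfl
  rw [a3] at hle
  omega

end GaussBonnet

/-! ### First application: three-cycles bound triangles -/

section Regions

open Classical

variable {V : Type v} [Fintype V] {D : AbstractSimplicialComplex V}

theorem degOf_eq_card {z : Sym2 V → ZMod 2} {x : V} (S : Finset V)
    (hS : ∀ y ∈ S, (skeleton D).Adj x y ∧ z s(x, y) = 1)
    (hS' : ∀ y ∉ S, (skeleton D).Adj x y → z s(x, y) = 0) : degOf D z x = #S := by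
  rw [degOf]
  congr 1
  ext y
  simp only [mem_filter, SimpleGraph.mem_neighborFinset]
  refine ⟨fun h => ?_, hS y⟩
  by_contra hy
  rw [hS' y hy h.1] at h
  exact absurd h.2 (by decide)

theorem degOf_eq_zero_iff {z : Sym2 V → ZMod 2} {x : V} :
    degOf D z x = 0 ↔ ∀ y, (skeleton D).Adj x y → z s(x, y) = 0 := by
  rw [degOf, card_eq_zero, filter_eq_empty_iff]
  simp only [SimpleGraph.mem_neighborFinset]
  refine forall₂_congr fun y _ => ?_
  rcases zmod_two_eq_zero_or_one (z s(x, y)) with h | h <;> simp [h]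

theorem bd₁_eq_add {z : Sym2 V → ZMod 2} {x a b : V} (hab : a ≠ b)
    (ha : (skeleton D).Adj x a) (hb : (skeleton D).Adj x b)
    (h : ∀ y, (skeleton D).Adj x y → y ≠ a → y ≠ b → z s(x, y) = 0) :
    bd₁ D z x = z s(x, a) + z s(x, b) := by
  rw [bd₁_apply, ← sum_pair (f := fun y => z s(x, y)) hab]
  symm
  apply sum_subset
  · intro y hy
    simp only [mem_insert, mem_singleton] at hy
    rcases hy with rfl | rfl <;> simpa
  · intro y hy hy'
    simp only [mem_insert, mem_singleton, not_or] at hy'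
    exact h y (by simpa using hy) hy'.1 hy'.2

theorem exists_tri_of_bd₂_ne_zero {r : Finset V → ZMod 2} {x y : V}
    (h : bd₂ D r s(x, y) ≠ 0) : ∃ σ ∈ trisOn D s(x, y), r σ = 1 := by
  obtain ⟨σ, hσ, hne⟩ := exists_ne_zero_of_sum_ne_zero h
  exact ⟨σ, hσ, (zmod_two_eq_zero_or_one _).resolve_left hne⟩

theorem one_le_starCount {r : Finset V → ZMod 2} {x y : V} (h : bd₂ D r s(x, y) ≠ 0) :
    1 ≤ starCount D r x := by
  obtain ⟨σ, hσ, hr⟩ := exists_tri_of_bd₂_ne_zero h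
  rw [mem_trisOn] at hσ
  exact card_pos.2 ⟨σ, mem_filter.2 ⟨hσ.1, hσ.2.1, hr⟩⟩

/-- If only one triangle of the region sits at a corner, both boundary edges at that corner are
sides of it. -/
theorem mem_tri_of_starCount_le_one {r : Finset V → ZMod 2} {x y w : V}
    (hc : starCount D r x ≤ 1) (hxy : (skeleton D).Adj x y) (hxw : (skeleton D).Adj x w)
    (hyw : y ≠ w) (h : bd₂ D r s(x, y) ≠ 0) (h' : bd₂ D r s(x, w) ≠ 0) :
    {x, y, w} ∈ tri D ∧ r {x, y, w} = 1 := by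
  obtain ⟨σ, hσ, hr⟩ := exists_tri_of_bd₂_ne_zero h
  obtain ⟨τ, hτ, hr'⟩ := exists_tri_of_bd₂_ne_zero h'
  rw [mem_trisOn] at hσ hτ
  have : σ = τ := card_le_one.1 hc σ (mem_filter.2 ⟨hσ.1, hσ.2.1, hr⟩) τ
    (mem_filter.2 ⟨hτ.1, hτ.2.1, hr'⟩)
  subst this
  rw [← eq_of_mem_tri hσ.1 hσ.2.1 hσ.2.2 hτ.2.2 hxy.ne hxw.ne hyw]
  exact ⟨hσ.1, hr⟩

/-- In a disc whose interior vertices have at least six neighbours, 3-cycles bound simplices. -/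
theorem IsDisc.flag (hD : IsDisc D)
    (hdeg : ∀ x, IsInterior D x → 6 ≤ #((skeleton D).neighborFinset x)) {x y w : V}
    (hxy : (skeleton D).Adj x y) (hxw : (skeleton D).Adj x w) (hyw : (skeleton D).Adj y w) :
    {x, y, w} ∈ tri D := by
  have hxyn := hxy.ne
  have hxwn := hxw.ne
  have hywn := hyw.ne
  let z : Sym2 V → ZMod 2 := fun e => if e = s(x, y) ∨ e = s(x, w) ∨ e = s(y, w) then 1 else 0
  have hz0 : bd₁ D z = 0 := by
    have : z = Pi.single s(x, y) 1 + Pi.single s(x, w) 1 + Pi.single s(y, w) 1 := by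
      ext e
      have h1 : s(x, y) ≠ s(x, w) := by rw [Ne, Sym2.eq_iff]; tauto
      have h2 : s(x, y) ≠ s(y, w) := by rw [Ne, Sym2.eq_iff]; tauto
      have h3 : s(x, w) ≠ s(y, w) := by rw [Ne, Sym2.eq_iff]; tauto
      simp only [z, Pi.add_apply, Pi.single_apply]
      by_cases a : e = s(x, y)
      · simp [a, h1, h2]
      · by_cases b : e = s(x, w)
        · simp [b, h1.symm, h3]
        · simp [a, b]
    rw [this, map_add, map_add, bd₁_single hxy, bd₁_single hxw, bd₁_single hyw]
    ext i
    simp only [Pi.add_apply, Pi.zero_apply]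
    generalize (Pi.single x 1 : V → ZMod 2) i = a
    generalize (Pi.single y 1 : V → ZMod 2) i = b
    generalize (Pi.single w 1 : V → ZMod 2) i = c
    revert a b c
    decide
  have zz : ∀ {z' : Sym2 V → ZMod 2}, (∀ e, z' e ≠ 0 → z e ≠ 0) →
      (∀ p, p ≠ y → p ≠ w → z' s(x, p) = 0) ∧ (∀ p, p ≠ x → p ≠ w → z' s(y, p) = 0) ∧
      (∀ p, p ≠ x → p ≠ y → z' s(w, p) = 0) ∧
      ∀ p q, p ≠ x → p ≠ y → p ≠ w → z' s(p, q) = 0 := by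
    intro z' hz'
    have aux : ∀ e, (e ≠ s(x, y) ∧ e ≠ s(x, w) ∧ e ≠ s(y, w)) → z' e = 0 := by
      rintro e ⟨h1, h2, h3⟩
      by_contra h
      exact hz' e h (by simp [z, h1, h2, h3])
    refine ⟨fun p h1 h2 => aux _ ?_, fun p h1 h2 => aux _ ?_, fun p h1 h2 => aux _ ?_,
      fun p q h1 h2 h3 => aux _ ?_⟩ <;> simp only [Ne, Sym2.eq_iff] <;> tauto
  obtain ⟨r, -, hr⟩ := hD.exists_bd₂_eq hz0
  have hcirc : IsCircuit D (bd₂ D r) := by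
    intro z' h1 h2
    have h3 : ∀ e, z' e ≠ 0 → z e ≠ 0 := by
      intro e he
      obtain ⟨a, b⟩ := h2 e he
      rwa [hr e a] at b
    obtain ⟨zx, zy, zw, -⟩ := zz h3
    have ex := congrFun h1 x
    rw [bd₁_eq_add hywn hxy hxw (fun p _ => zx p)] at ex
    have ey := congrFun h1 y
    rw [bd₁_eq_add hxwn hxy.symm hyw (fun p _ => zy p), Sym2.eq_swap] at ey
    simp only [Pi.zero_apply] at ex ey
    have hk : ∀ a b c : ZMod 2, a + b = 0 → a + c = 0 →
        (a = 0 ∧ b = 0 ∧ c = 0) ∨ (a = 1 ∧ b = 1 ∧ c = 1) := by decide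
    rcases hk _ _ _ ex ey with ⟨a, b, c⟩ | ⟨a, b, c⟩
    · left
      intro e
      by_contra he
      have := h3 e he
      simp only [z, ne_eq, ite_eq_right_iff, one_ne_zero, imp_false, not_not] at this
      rcases this with rfl | rfl | rfl <;> exact he (by assumption)
    · right
      intro e he
      rw [hr e he]
      by_cases h : e = s(x, y) ∨ e = s(x, w) ∨ e = s(y, w)
      · have hze : z e = 1 := by simp only [z, if_pos h]
        rw [hze]
        rcases h with rfl | rfl | rfl <;> assumption
      · have hze : z e = 0 := by simp only [z, if_neg h]
        rw [hze]
        by_contra h'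
        exact h3 e h' hze
  have dcongr : ∀ u, degOf D (bd₂ D r) u = degOf D z u := by
    intro u
    rw [degOf, degOf]
    congr 1
    apply filter_congr
    intro p hp
    rw [hr _ (by simpa using hp)]
  obtain ⟨zx, zy, zw, z4⟩ := zz (z' := z) (fun _ => id)
  have dx : degOf D z x = 2 := by
    rw [← card_pair hywn]
    apply degOf_eq_card
    · intro p hp
      simp only [mem_insert, mem_singleton] at hp
      rcases hp with rfl | rfl <;> simp [z, hxy, hxw]
    · intro p hp _
      simp only [mem_insert, mem_singleton, not_or] at hp
      exact zx p hp.1 hp.2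
  have dy : degOf D z y = 2 := by
    rw [← card_pair hxwn]
    apply degOf_eq_card
    · intro p hp
      simp only [mem_insert, mem_singleton] at hp
      rcases hp with rfl | rfl <;> simp [z, hxy.symm, hyw]
    · intro p hp _
      simp only [mem_insert, mem_singleton, not_or] at hp
      exact zy p hp.1 hp.2
  have dw : degOf D z w = 2 := by
    rw [← card_pair hxyn]
    apply degOf_eq_card
    · intro p hp
      simp only [mem_insert, mem_singleton] at hp
      rcases hp with rfl | rfl <;> simp [z, hxw.symm, hyw.symm]
    · intro p hp _
      simp only [mem_insert, mem_singleton, not_or] at hp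
      exact zw p hp.1 hp.2
  have dall : ∀ u, u ∉ ({x, y, w} : Finset V) → degOf D z u = 0 := by
    intro u hu
    simp only [mem_insert, mem_singleton, not_or] at hu
    exact degOf_eq_zero_iff.2 fun p _ => z4 u p hu.1 hu.2.1 hu.2.2
  have dmem : ∀ u ∈ ({x, y, w} : Finset V), degOf D z u = 2 := by
    intro u hu
    simp only [mem_insert, mem_singleton] at hu
    rcases hu with rfl | rfl | rfl <;> assumption
  -- The three triangle counts add up to at most `3 * 3 - 6 = 3`. Those at `y` and `w` are positive,
  -- so a single triangle remains at `x`.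
  have hgb := hD.gauss_bonnet hdeg hcirc {x, y, w} (by simp)
    (fun u => by
      rw [dcongr]
      by_cases hu : u ∈ ({x, y, w} : Finset V)
      · exact Or.inr (dmem u hu)
      · exact Or.inl (dall u hu))
    (fun u hu => by rw [dcongr]; exact dmem u hu)
    (fun u hu h => by rw [dcongr, dall u hu] at h; omega)
  have b1 : bd₂ D r s(x, y) ≠ 0 := by rw [hr _ hxy]; simp [z]
  have b2 : bd₂ D r s(x, w) ≠ 0 := by rw [hr _ hxw]; simp [z]
  have c2 := one_le_starCount (Sym2.eq_swap ▸ b1)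
  have c3 := one_le_starCount (Sym2.eq_swap ▸ b2)
  rw [card_eq_three.2 ⟨x, y, w, hxyn, hxwn, hywn, rfl⟩, sum_insert (by simp [hxyn, hxwn]),
    sum_pair hywn] at hgb
  exact (mem_tri_of_starCount_le_one (by omega) hxy hxw hywn b1 b2).1

end Regions

/-! ### Regions between a sphere and a path outside it -/

section Spheres

open Classical

variable {V : Type v} [Fintype V] {D : AbstractSimplicialComplex V}

/-- The local structure of the sphere of radius `k` about `o`: it is a cycle, and at each of its
vertices at least two edges point away from `o`. -/
structure SphereAt (D : AbstractSimplicialComplex V) (o : V) (k : ℕ) : Prop where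
  nbrs : ∀ x, (skeleton D).dist o x = k → ∃ y₁ y₂ z₁ z₂ : V, y₁ ≠ y₂ ∧ z₁ ≠ z₂ ∧
    (skeleton D).Adj x y₁ ∧ (skeleton D).Adj x y₂ ∧
    (skeleton D).dist o y₁ = k ∧ (skeleton D).dist o y₂ = k ∧
    (skeleton D).dist o z₁ = k + 1 ∧ (skeleton D).dist o z₂ = k + 1 ∧
    (∀ y, (skeleton D).Adj x y → (skeleton D).dist o y = k → y = y₁ ∨ y = y₂) ∧
    (∀ p, k ≤ (skeleton D).dist o p → (skeleton D).Adj x p → (skeleton D).Adj y₁ p → p = z₁) ∧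
    (∀ p, k ≤ (skeleton D).dist o p → (skeleton D).Adj x p → (skeleton D).Adj y₂ p → p = z₂)
  connected : ∀ x y, (skeleton D).dist o x = k → (skeleton D).dist o y = k →
    Relation.ReflTransGen (fun a b => (skeleton D).Adj a b ∧ (skeleton D).dist o b = k) x y

/-- A 2-chain outside the ball of radius `k` whose boundary is `q`, up to edges of the sphere of
radius `k`. -/
structure IsOuterRegion (D : AbstractSimplicialComplex V) (o : V) (k : ℕ) (q : Sym2 V → ZMod 2)
    (r : Finset V → ZMod 2) : Prop where
  le_dist : ∀ σ ∈ tri D, r σ = 1 → ∀ x ∈ σ, k ≤ (skeleton D).dist o x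
  bd : ∀ x y, (skeleton D).Adj x y →
    ¬ ((skeleton D).dist o x = k ∧ (skeleton D).dist o y = k) → bd₂ D r s(x, y) = q s(x, y)

/-- Join the ends of `q` to `o` by geodesics inside the ball, fill the resulting cycle, and discard
the triangles that enter the ball. At an edge with an end beyond the sphere no triangle is discarded
and the geodesics contribute nothing; at an edge with an end strictly inside every triangle is
discarded, and `q` is zero there. -/
theorem IsDisc.exists_outerRegion (hD : IsDisc D) (o : V) (k : ℕ) {q : Sym2 V → ZMod 2}
    {w₁ w₂ : V} (h₁ : (skeleton D).dist o w₁ = k) (h₂ : (skeleton D).dist o w₂ = k)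
    (hq : bd₁ D q = Pi.single w₁ 1 + Pi.single w₂ 1)
    (hsupp : ∀ e, q e ≠ 0 → e ∈ (skeleton D).edgeSet ∧ ∃ x ∈ e, k < (skeleton D).dist o x) :
    ∃ r, IsOuterRegion D o k q r := by
  obtain ⟨c₁, hc₁, hs₁⟩ := hD.exists_chain o w₁
  obtain ⟨c₂, hc₂, hs₂⟩ := hD.exists_chain o w₂
  have h0 : bd₁ D (q + c₁ + c₂) = 0 := by
    rw [map_add, map_add, hq, hc₁, hc₂]
    ext i
    simp only [Pi.add_apply, Pi.zero_apply]
    generalize (Pi.single w₁ 1 : V → ZMod 2) i = a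
    generalize (Pi.single w₂ 1 : V → ZMod 2) i = b
    generalize (Pi.single o 1 : V → ZMod 2) i = c
    revert a b c
    decide
  obtain ⟨r₀, -, hr₀⟩ := hD.exists_bd₂_eq h0
  let r : Finset V → ZMod 2 :=
    fun σ => if ∀ x ∈ σ, k ≤ (skeleton D).dist o x then r₀ σ else 0
  have hdist := fun {x y : V} (h : (skeleton D).Adj x y) => dist_le_add_one hD.connected o h
  have hlow : ∀ x y, (skeleton D).Adj x y → (skeleton D).dist o x < k →
      bd₂ D r s(x, y) = q s(x, y) := by
    intro x y hxy hx
    have hy := hdist hxy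
    have : q s(x, y) = 0 := by
      by_contra hne
      obtain ⟨u, hu, hlt⟩ := (hsupp _ hne).2
      rw [Sym2.mem_iff] at hu
      rcases hu with rfl | rfl <;> omega
    rw [this, bd₂_apply]
    apply sum_eq_zero
    intro σ hσ
    simp only [r]
    rw [if_neg]
    intro h
    have := h x (mem_trisOn.1 hσ).2.1
    omega
  have hhigh : ∀ x y, (skeleton D).Adj x y → k < (skeleton D).dist o x →
      bd₂ D r s(x, y) = q s(x, y) := by
    intro x y hxy hx
    have hy := hdist hxy.symm
    have hzero : ∀ (c : Sym2 V → ZMod 2) (w : V), (skeleton D).dist o w = k →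
        (∀ e, c e ≠ 0 → e ∈ (skeleton D).edgeSet ∧
          ∃ y ∈ e, (skeleton D).dist o y < (skeleton D).dist o w) → c s(x, y) = 0 := by
      intro c w hw hc
      by_contra hne
      obtain ⟨u, hu, hlt⟩ := (hc _ hne).2
      rw [Sym2.mem_iff] at hu
      rcases hu with rfl | rfl <;> omega
    have h3 := hr₀ s(x, y) hxy
    rw [Pi.add_apply, Pi.add_apply, hzero c₁ w₁ h₁ hs₁, hzero c₂ w₂ h₂ hs₂, add_zero,
      add_zero] at h3
    rw [← h3, bd₂_apply, bd₂_apply]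
    apply sum_congr rfl
    intro σ hσ
    obtain ⟨hσ, hxσ, -⟩ := mem_trisOn.1 hσ
    simp only [r]
    rw [if_pos]
    intro u hu
    by_cases hux : u = x
    · subst hux; omega
    · have := hdist (adj_of_mem_tri hσ hu hxσ hux)
      omega
  refine ⟨r, ?_, ?_⟩
  · intro σ _ hr
    by_contra h
    simp only [r, if_neg h] at hr
    exact absurd hr (by decide)
  · intro x y hxy hne
    rcases lt_trichotomy ((skeleton D).dist o x) k with h | h | h
    · exact hlow x y hxy h
    · rcases lt_trichotomy ((skeleton D).dist o y) k with h' | h' | h'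
      · rw [Sym2.eq_swap]
        exact hlow y x hxy.symm h'
      · exact absurd ⟨h, h'⟩ hne
      · rw [Sym2.eq_swap]
        exact hhigh y x hxy.symm h'
    · exact hhigh x y hxy h

/-- A 1-cycle on a sphere with connected 2-regular graph which is nonzero at some edge is nonzero
at all edges. -/
theorem SphereAt.eq_one_of_bd₁_eq_zero {o : V} {k : ℕ} (hS : SphereAt D o k)
    {z : Sym2 V → ZMod 2} (hz : bd₁ D z = 0)
    (hsupp : ∀ x y, (skeleton D).Adj x y →
      ¬ ((skeleton D).dist o x = k ∧ (skeleton D).dist o y = k) → z s(x, y) = 0)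
    {a b : V} (hab : (skeleton D).Adj a b) (ha : (skeleton D).dist o a = k)
    (hb : (skeleton D).dist o b = k) (hne : z s(a, b) ≠ 0) {x : V}
    (hx : (skeleton D).dist o x = k) {y : V} (hxy : (skeleton D).Adj x y)
    (hy : (skeleton D).dist o y = k) : z s(x, y) = 1 := by
  -- Only two edges of the sphere meet at `u`, so the cycle condition makes the two values equal;
  -- connectedness of the sphere then spreads the value one.
  have hkey : ∀ u, (skeleton D).dist o u = k → ∀ p, (skeleton D).Adj u p →
      (skeleton D).dist o p = k → z s(u, p) ≠ 0 → ∀ p', (skeleton D).Adj u p' →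
      (skeleton D).dist o p' = k → z s(u, p') = 1 := by
    intro u hu p hup hp hne p' hup' hp'
    obtain ⟨y₁, y₂, -, -, hy, -, a₁, a₂, l₁, l₂, -, -, hall, -, -⟩ := hS.nbrs u hu
    have h0 := congrFun hz u
    rw [bd₁_eq_add hy a₁ a₂ (fun q hq h1 h2 => hsupp u q hq
      (fun h => (hall q hq h.2).elim h1 h2))] at h0
    simp only [Pi.zero_apply] at h0
    have hc : ∀ s t : ZMod 2, s + t = 0 → (s ≠ 0 ∨ t ≠ 0) → s = 1 ∧ t = 1 := by decide
    have h1 : z s(u, y₁) = 1 ∧ z s(u, y₂) = 1 := by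
      apply hc _ _ h0
      rcases hall p hup hp with rfl | rfl
      · exact Or.inl hne
      · exact Or.inr hne
    rcases hall p' hup' hp' with rfl | rfl
    · exact h1.1
    · exact h1.2
  have hreach := hS.connected a x ha hx
  suffices H : (skeleton D).dist o x = k ∧ ∀ y, (skeleton D).Adj x y →
      (skeleton D).dist o y = k → z s(x, y) = 1 from H.2 y hxy hy
  clear hxy hy y
  induction hreach with
  | refl => exact ⟨ha, fun y => hkey a ha b hab hb hne y⟩
  | @tail c d hc hcd ih =>
    have hcl : (skeleton D).dist o c = k := by
      rcases Relation.ReflTransGen.cases_tail hc with h | ⟨e, -, he⟩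
      · rw [h]; exact ha
      · exact he.2
    refine ⟨hcd.2, fun y => hkey d hcd.2 c hcd.1.symm hcl ?_ y⟩
    rw [Sym2.eq_swap, (ih hcl).2 d hcd.1 hcd.2]
    decide

/-- The boundary of `r` consists of the path `q` and an arc of the sphere. At an inner vertex of the
arc the region has at least three triangles, because the sphere has at least two edges pointing
outwards there. Only the vertices of `q` are left in the Gauss–Bonnet inequality. The hypothesis
`hirr` says that no proper nonempty part of `q` closes up at the vertices beyond the sphere. -/
theorem SphereAt.gauss_bonnet (hD : IsDisc D)
    (hdeg : ∀ x, IsInterior D x → 6 ≤ #((skeleton D).neighborFinset x)) {o : V} {k : ℕ}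
    (hS : SphereAt D o k) {q : Sym2 V → ZMod 2} {r : Finset V → ZMod 2}
    (hr : IsOuterRegion D o k q r) {w₁ w₂ : V} (hw : w₁ ≠ w₂)
    (h₁ : (skeleton D).dist o w₁ = k) (h₂ : (skeleton D).dist o w₂ = k)
    (hq : bd₁ D q = Pi.single w₁ 1 + Pi.single w₂ 1)
    (hsupp : ∀ e, q e ≠ 0 → e ∈ (skeleton D).edgeSet ∧ ∃ x ∈ e, k < (skeleton D).dist o x)
    (hd₁ : degOf D q w₁ = 1) (hd₂ : degOf D q w₂ = 1)
    (hd : ∀ x, x ≠ w₁ → x ≠ w₂ → degOf D q x = 0 ∨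
      (k < (skeleton D).dist o x ∧ degOf D q x = 2))
    (hirr : ∀ q' : Sym2 V → ZMod 2, (∀ e, q' e ≠ 0 → q e ≠ 0) →
      (∀ x, k < (skeleton D).dist o x → bd₁ D q' x = 0) →
      (∀ e, q' e = 0) ∨ ∀ e, q e ≠ 0 → q' e ≠ 0)
    (X : Finset V) (hX : ∀ x, x ∈ X ↔ degOf D q x ≠ 0) :
    6 + ∑ x ∈ X, starCount D r x ≤ 3 * #X := by
  set z := bd₂ D r with hz
  have hz0 : bd₁ D z = 0 := bd₁_bd₂ r
  have hbd : ∀ x y, (skeleton D).Adj x y →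
      ¬ ((skeleton D).dist o x = k ∧ (skeleton D).dist o y = k) → z s(x, y) = q s(x, y) := hr.bd
  have hqz : ∀ e, q e ≠ 0 → z e = q e := by
    intro e he
    obtain ⟨hedge, u, hu, hlt⟩ := hsupp e he
    induction e with
    | _ a b =>
      apply hr.bd a b hedge
      rw [Sym2.mem_iff] at hu
      rcases hu with rfl | rfl <;> omega
  have hone : ∀ e, q e ≠ 0 → q e = 1 := fun e he => (zmod_two_eq_zero_or_one _).resolve_left he
  have hqlev : ∀ x y, (skeleton D).dist o x = k → (skeleton D).dist o y = k → q s(x, y) = 0 := by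
    intro x y hx hy
    by_contra hne
    obtain ⟨-, u, hu, hlt⟩ := hsupp _ hne
    rw [Sym2.mem_iff] at hu
    rcases hu with rfl | rfl <;> omega
  have hδ : ∀ x, bd₁ D (z + q) x = (Pi.single w₁ 1 + Pi.single w₂ 1 : V → ZMod 2) x := by
    intro x
    rw [map_add, hz0, hq, zero_add]
  have hvals : ∀ x y₁ y₂, (skeleton D).dist o x = k → y₁ ≠ y₂ → (skeleton D).Adj x y₁ →
      (skeleton D).Adj x y₂ → (skeleton D).dist o y₁ = k → (skeleton D).dist o y₂ = k →
      (∀ y, (skeleton D).Adj x y → (skeleton D).dist o y = k → y = y₁ ∨ y = y₂) →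
      z s(x, y₁) + z s(x, y₂) = (Pi.single w₁ 1 + Pi.single w₂ 1 : V → ZMod 2) x := by
    intro x y₁ y₂ hx hy a₁ a₂ l₁ l₂ hall
    rw [← hδ, bd₁_eq_add hy a₁ a₂]
    · rw [Pi.add_apply, Pi.add_apply, hqlev x y₁ hx l₁, hqlev x y₂ hx l₂, add_zero, add_zero]
    · intro y hy' n1 n2
      rw [Pi.add_apply, hbd x y hy' (fun h => (hall y hy' h.2).elim n1 n2),
        CharTwo.add_self_eq_zero]
  have hdz : ∀ x, (skeleton D).dist o x = k → ∀ y₁ y₂, y₁ ≠ y₂ → (skeleton D).Adj x y₁ →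
      (skeleton D).Adj x y₂ → (skeleton D).dist o y₁ = k → (skeleton D).dist o y₂ = k →
      (∀ y, (skeleton D).Adj x y → (skeleton D).dist o y = k → y = y₁ ∨ y = y₂) →
      degOf D z x = degOf D q x + (if z s(x, y₁) = 1 then 1 else 0) +
        (if z s(x, y₂) = 1 then 1 else 0) := by
    intro x hx y₁ y₂ hy a₁ a₂ l₁ l₂ hall
    have hsplit : {y ∈ (skeleton D).neighborFinset x | z s(x, y) = 1} =
        {y ∈ (skeleton D).neighborFinset x | q s(x, y) = 1} ∪
          {y ∈ ({y₁, y₂} : Finset V) | z s(x, y) = 1} := by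
      ext y
      simp only [mem_union, mem_filter, SimpleGraph.mem_neighborFinset, mem_insert, mem_singleton]
      constructor
      · rintro ⟨hxy, h1⟩
        by_cases hl : (skeleton D).dist o y = k
        · exact Or.inr ⟨hall y hxy hl, h1⟩
        · refine Or.inl ⟨hxy, ?_⟩
          rw [← hbd x y hxy (fun h => hl h.2)]
          exact h1
      · rintro (⟨hxy, h1⟩ | ⟨h1, h2⟩)
        · refine ⟨hxy, ?_⟩
          rw [hqz _ (by rw [h1]; decide), h1]
        · rcases h1 with rfl | rfl <;> exact ⟨by assumption, h2⟩
    rw [degOf, hsplit, card_union_of_disjoint, degOf, add_assoc]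
    · congr 1
      rw [card_filter, sum_pair hy]
    · rw [disjoint_left]
      intro y hy1 hy2
      simp only [mem_filter, mem_insert, mem_singleton] at hy1 hy2
      have : (skeleton D).dist o y = k := by rcases hy2.1 with rfl | rfl <;> assumption
      rw [hqlev x y hx this] at hy1
      exact absurd hy1.2 (by decide)
  have hdz' : ∀ x, (skeleton D).dist o x ≠ k → degOf D z x = degOf D q x := by
    intro x hx
    rw [degOf, degOf]
    congr 1
    apply filter_congr
    intro y hy
    rw [hbd x y (by simpa using hy) (fun h => hx h.1)]
  -- The values of `z` on the two sphere edges at `w₁` have odd sum, so exactly one of them joins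
  -- the path edge.
  have hw1 : degOf D z w₁ = 2 := by
    obtain ⟨y₁, y₂, -, -, hy, -, a₁, a₂, l₁, l₂, -, -, hall, -, -⟩ := hS.nbrs w₁ h₁
    have h3 := hvals w₁ y₁ y₂ h₁ hy a₁ a₂ l₁ l₂ hall
    rw [hdz w₁ h₁ y₁ y₂ hy a₁ a₂ l₁ l₂ hall, hd₁]
    simp only [Pi.add_apply, Pi.single_apply, if_true, if_neg hw, add_zero] at h3
    revert h3
    generalize z s(w₁, y₁) = a
    generalize z s(w₁, y₂) = b
    revert a b
    decide
  have hw2 : degOf D z w₂ = 2 := by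
    obtain ⟨y₁, y₂, -, -, hy, -, a₁, a₂, l₁, l₂, -, -, hall, -, -⟩ := hS.nbrs w₂ h₂
    have h3 := hvals w₂ y₁ y₂ h₂ hy a₁ a₂ l₁ l₂ hall
    rw [hdz w₂ h₂ y₁ y₂ hy a₁ a₂ l₁ l₂ hall, hd₂]
    simp only [Pi.add_apply, Pi.single_apply, if_true, if_neg hw.symm, zero_add] at h3
    revert h3
    generalize z s(w₂, y₁) = a
    generalize z s(w₂, y₂) = b
    revert a b
    decide
  have hother : ∀ x, x ≠ w₁ → x ≠ w₂ → (skeleton D).dist o x = k →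
      ∀ y₁ y₂, y₁ ≠ y₂ → (skeleton D).Adj x y₁ →
      (skeleton D).Adj x y₂ → (skeleton D).dist o y₁ = k → (skeleton D).dist o y₂ = k →
      (∀ y, (skeleton D).Adj x y → (skeleton D).dist o y = k → y = y₁ ∨ y = y₂) →
      degOf D q x = 0 ∧ (degOf D z x = 0 ∨
        (degOf D z x = 2 ∧ z s(x, y₁) = 1 ∧ z s(x, y₂) = 1)) := by
    intro x n1 n2 hx y₁ y₂ hy a₁ a₂ l₁ l₂ hall
    have hq0 : degOf D q x = 0 := by
      rcases hd x n1 n2 with h | h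
      · exact h
      · omega
    refine ⟨hq0, ?_⟩
    have h3 := hvals x y₁ y₂ hx hy a₁ a₂ l₁ l₂ hall
    rw [hdz x hx y₁ y₂ hy a₁ a₂ l₁ l₂ hall, hq0]
    simp only [Pi.add_apply, Pi.single_apply, if_neg n1, if_neg n2, add_zero] at h3
    revert h3
    generalize z s(x, y₁) = a
    generalize z s(x, y₂) = b
    revert a b
    decide
  have hd02 : ∀ x, degOf D z x = 0 ∨ degOf D z x = 2 := by
    intro x
    by_cases n1 : x = w₁
    · rw [n1]; exact Or.inr hw1
    by_cases n2 : x = w₂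
    · rw [n2]; exact Or.inr hw2
    by_cases hx : (skeleton D).dist o x = k
    · obtain ⟨y₁, y₂, -, -, hy, -, a₁, a₂, l₁, l₂, -, -, hall, -, -⟩ := hS.nbrs x hx
      rcases (hother x n1 n2 hx y₁ y₂ hy a₁ a₂ l₁ l₂ hall).2 with h | h
      · exact Or.inl h
      · exact Or.inr h.1
    · rw [hdz' x hx]
      rcases hd x n1 n2 with h | h
      · exact Or.inl h
      · exact Or.inr h.2
  have hX2 : ∀ x ∈ X, degOf D z x = 2 := by
    intro x hx
    rw [hX] at hx
    by_cases n1 : x = w₁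
    · rw [n1]; exact hw1
    by_cases n2 : x = w₂
    · rw [n2]; exact hw2
    rcases hd x n1 n2 with h | h
    · exact absurd h hx
    · rw [hdz' x (by omega)]; exact h.2
  -- The three triangles: those of the region on the two sphere edges at `x`, with distinct outer
  -- apexes `z₁` and `z₂`, and the one across the edge from `x` to `z₁`, which is not in the
  -- boundary of the region.
  have hX3 : ∀ x ∉ X, degOf D z x = 2 → 3 ≤ starCount D r x := by
    intro x hxX hx2
    rw [hX, not_not] at hxX
    have n1 : x ≠ w₁ := by rintro rfl; omega
    have n2 : x ≠ w₂ := by rintro rfl; omega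
    by_cases hx : (skeleton D).dist o x = k
    swap
    · rw [hdz' x hx] at hx2; omega
    obtain ⟨y₁, y₂, z₁, z₂, hy, hzz, a₁, a₂, l₁, l₂, m₁, m₂, hall, ap₁, ap₂⟩ := hS.nbrs x hx
    have hv : z s(x, y₁) = 1 ∧ z s(x, y₂) = 1 := by
      rcases (hother x n1 n2 hx y₁ y₂ hy a₁ a₂ l₁ l₂ hall).2 with h | h
      · omega
      · exact h.2
    have htri : ∀ y z', (skeleton D).Adj x y → z s(x, y) = 1 →
        (∀ p, k ≤ (skeleton D).dist o p → (skeleton D).Adj x p → (skeleton D).Adj y p → p = z') →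
        {x, y, z'} ∈ tri D ∧ r {x, y, z'} = 1 := by
      intro y z' hxy h1 hap
      obtain ⟨σ, hσ, hrσ⟩ := exists_tri_of_bd₂_ne_zero (D := D) (r := r) (x := x) (y := y)
        (by rw [← hz, h1]; decide)
      obtain ⟨p, hp, rfl⟩ := exists_apex_of_mem_trisOn hxy.ne hσ
      have hmem := (mem_trisOn.1 hσ).1
      have : p = z' := hap p (hr.le_dist _ hmem hrσ p (by simp))
        (adj_of_mem_tri hmem (by simp) (by simp) hp.1.symm)
        (adj_of_mem_tri hmem (by simp) (by simp) hp.2.1.symm)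
      subst this
      exact ⟨hmem, hrσ⟩
    obtain ⟨t₁, r₁⟩ := htri y₁ z₁ a₁ hv.1 ap₁
    obtain ⟨t₂, r₂⟩ := htri y₂ z₂ a₂ hv.2 ap₂
    have hxz : x ≠ z₁ := by rintro rfl; omega
    have hyz : y₁ ≠ z₁ := by rintro rfl; omega
    have hyz2 : y₂ ≠ z₁ := by rintro rfl; omega
    have hxz1 : (skeleton D).Adj x z₁ := adj_of_mem_tri t₁ (by simp) (by simp) hxz
    have hb0 : bd₂ D r s(x, z₁) = 0 := by
      rw [← hz, hbd x z₁ hxz1 (by omega)]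
      exact degOf_eq_zero_iff.1 hxX z₁ hxz1
    have hon : ({x, y₁, z₁} : Finset V) ∈ trisOn D s(x, z₁) := mem_trisOn.2 ⟨t₁, by simp, by simp⟩
    obtain ⟨hc2, hallr⟩ := hD.eq_one_of_bd₂_eq_zero hxz1 hb0 hon r₁
    obtain ⟨τ, hτ, hτne⟩ := exists_mem_ne (by omega : 1 < #(trisOn D s(x, z₁))) {x, y₁, z₁}
    have hrτ := hallr τ hτ
    rw [mem_trisOn] at hτ
    have hτ2 : τ ≠ {x, y₂, z₂} := by
      rintro rfl
      have := hτ.2.2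
      simp only [mem_insert, mem_singleton] at this
      rcases this with h | h | h
      · exact hxz h.symm
      · exact hyz2 h.symm
      · exact hzz h
    have h12 : ({x, y₁, z₁} : Finset V) ≠ {x, y₂, z₂} := by
      intro h
      have : z₁ ∈ ({x, y₂, z₂} : Finset V) := by rw [← h]; simp
      simp only [mem_insert, mem_singleton] at this
      rcases this with h | h | h
      · exact hxz h.symm
      · exact hyz2 h.symm
      · exact hzz h
    have hsub : ({τ, {x, y₁, z₁}, {x, y₂, z₂}} : Finset (Finset V)) ⊆
        {σ ∈ tri D | x ∈ σ ∧ r σ = 1} := by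
      intro σ hσ
      rw [mem_insert, mem_insert, mem_singleton] at hσ
      rw [mem_filter]
      rcases hσ with rfl | rfl | rfl
      · exact ⟨hτ.1, hτ.2.1, hrτ⟩
      · exact ⟨t₁, by simp, r₁⟩
      · exact ⟨t₂, by simp, r₂⟩
    have := card_le_card hsub
    rwa [card_eq_three.2 ⟨_, _, _, hτne, hτ2, h12, rfl⟩] at this
  have hcirc : IsCircuit D z := by
    -- A cycle inside `z` that avoids `q` lives on the sphere. If nonzero it would be the whole
    -- sphere, whereas `z` uses only one of the two sphere edges at `w₁`.
    have claim : ∀ z' : Sym2 V → ZMod 2, bd₁ D z' = 0 →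
        (∀ e, z' e ≠ 0 → e ∈ (skeleton D).edgeSet ∧ z e ≠ 0) → (∀ e, q e ≠ 0 → z' e = 0) →
        ∀ e, z' e = 0 := by
      intro z' hz' hs' hq'
      by_contra! hne
      obtain ⟨e, he⟩ := hne
      have hsup : ∀ x y, (skeleton D).Adj x y →
          ¬ ((skeleton D).dist o x = k ∧ (skeleton D).dist o y = k) → z' s(x, y) = 0 := by
        intro x y hxy hn
        by_contra h0
        have h1 := (hs' _ h0).2
        rw [hbd x y hxy hn] at h1
        exact h0 (hq' _ h1)
      induction e with
      | _ a b =>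
        have hab := (hs' _ he).1
        have hlev : (skeleton D).dist o a = k ∧ (skeleton D).dist o b = k := by
          by_contra h
          exact he (hsup a b hab h)
        obtain ⟨y₁, y₂, -, -, hy, -, a₁, a₂, l₁, l₂, -, -, hall, -, -⟩ := hS.nbrs w₁ h₁
        have v1 := hS.eq_one_of_bd₁_eq_zero hz' hsup hab hlev.1 hlev.2 he h₁ a₁ l₁
        have v2 := hS.eq_one_of_bd₁_eq_zero hz' hsup hab hlev.1 hlev.2 he h₁ a₂ l₂
        have u1 := (hs' s(w₁, y₁) (by rw [v1]; decide)).2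
        have u2 := (hs' s(w₁, y₂) (by rw [v2]; decide)).2
        have h3 := hvals w₁ y₁ y₂ h₁ hy a₁ a₂ l₁ l₂ hall
        simp only [Pi.add_apply, Pi.single_apply, if_true, if_neg hw, add_zero] at h3
        have hc : ∀ a b : ZMod 2, a ≠ 0 → b ≠ 0 → a + b ≠ 1 := by decide
        exact hc _ _ u1 u2 h3
    intro z' hz' hs'
    rcases hirr (fun e => if q e ≠ 0 then z' e else 0)
      (by intro e he h; simp [h] at he)
      (by
        intro x hx
        refine Eq.trans ?_ (congrFun hz' x)
        rw [bd₁_apply, bd₁_apply]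
        apply sum_congr rfl
        intro y hy
        by_cases h : q s(x, y) ≠ 0
        · simp [h]
        · rw [if_neg h]
          by_contra h0
          have h1 := (hs' _ (Ne.symm h0)).2
          rw [hbd x y (by simpa using hy) (by omega)] at h1
          exact h h1) with h | h
    · left
      apply claim z' hz' hs'
      intro e he
      have := h e
      simpa [he] using this
    · right
      -- When `z'` contains all of `q`, the sum `z' + z` avoids `q`.
      have h2 := claim (fun e => if e ∈ (skeleton D).edgeSet then z' e + z e else 0)
        (by
          rw [← add_zero (0 : V → ZMod 2)]
          nth_rewrite 1 [← hz']
          rw [← hz0, ← map_add]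
          apply bd₁_congr
          intro e he
          simp [he])
        (by
          intro e he
          by_cases hedge : e ∈ (skeleton D).edgeSet
          · refine ⟨hedge, fun h0 => ?_⟩
            simp only [if_pos hedge, h0, add_zero] at he
            exact (hs' e he).2 h0
          · simp [hedge] at he)
        (by
          intro e he
          have h3 := h e he
          simp only [if_pos he] at h3
          rw [if_pos (hsupp e he).1, hqz e he, hone e he,
            (zmod_two_eq_zero_or_one (z' e)).resolve_left h3, CharTwo.add_self_eq_zero])
      intro e he
      have := h2 e
      rw [if_pos he] at this
      exact CharTwo.add_eq_zero.1 this
  exact hD.gauss_bonnet hdeg hcirc X ⟨w₁, by rw [hX]; omega⟩ hd02 hX2 hX3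

end Spheres

/-! ### The link of an interior vertex, divided by distance levels -/

section Links

open Classical

variable {V : Type v} [Fintype V]

/-- Local properties of the 1-skeleton of a flag triangulated surface whose interior vertices
(those satisfying `I`) have at least six neighbours. -/
structure IsSurfaceGraph (G : SimpleGraph V) (I : V → Prop) : Prop where
  connected : G.Connected
  card_common_le : ∀ x y, G.Adj x y → #(G.neighborFinset x ∩ G.neighborFinset y) ≤ 2
  card_common : ∀ x y, I x → G.Adj x y → #(G.neighborFinset x ∩ G.neighborFinset y) = 2
  link : ∀ (x : V) (P : V → Prop) (y₀ : V), G.Adj x y₀ → P y₀ →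
    (∀ y z, G.Adj x y → P y → G.Adj x z → G.Adj y z → P z) → ∀ y, G.Adj x y → P y
  six_le_degree : ∀ x, I x → 6 ≤ #(G.neighborFinset x)

/-- The neighbours of `x` which are closer to `o`. -/
noncomputable def downNbrs (G : SimpleGraph V) (o x : V) : Finset V :=
  {y ∈ G.neighborFinset x | G.dist o y + 1 = G.dist o x}

/-- The neighbours of `x` at the same distance from `o`. -/
noncomputable def levelNbrs (G : SimpleGraph V) (o x : V) : Finset V :=
  {y ∈ G.neighborFinset x | G.dist o y = G.dist o x}

/-- The neighbours of `x` which are further away from `o`. -/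
noncomputable def upNbrs (G : SimpleGraph V) (o x : V) : Finset V :=
  {y ∈ G.neighborFinset x | G.dist o y = G.dist o x + 1}

/-- The neighbours towards `o` of a vertex at distance `k` are pairwise adjacent, and an edge of
the sphere of radius `k` has a unique common neighbour towards `o`. -/
structure DownAt (G : SimpleGraph V) (o : V) (k : ℕ) : Prop where
  adj : ∀ x, G.dist o x = k → ∀ w ∈ downNbrs G o x, ∀ w' ∈ downNbrs G o x, w ≠ w' → G.Adj w w'
  card_common : ∀ x y, G.dist o x = k → G.dist o y = k → G.Adj x y →
    #(downNbrs G o x ∩ G.neighborFinset y) = 1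

variable {G : SimpleGraph V} {I : V → Prop} {o x y : V} {k : ℕ}

theorem mem_downNbrs : y ∈ downNbrs G o x ↔ G.Adj x y ∧ G.dist o y + 1 = G.dist o x := by
  simp [downNbrs]

theorem mem_levelNbrs : y ∈ levelNbrs G o x ↔ G.Adj x y ∧ G.dist o y = G.dist o x := by
  simp [levelNbrs]

theorem mem_upNbrs : y ∈ upNbrs G o x ↔ G.Adj x y ∧ G.dist o y = G.dist o x + 1 := by
  simp [upNbrs]

theorem sum_card_inter_comm (G : SimpleGraph V) (s t : Finset V) :
    ∑ x ∈ s, #(t ∩ G.neighborFinset x) = ∑ y ∈ t, #(s ∩ G.neighborFinset y) := by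
  have h : ∀ s x, s ∩ G.neighborFinset x = {y ∈ s | G.Adj x y} := by
    intro s x; ext; simp
  simp_rw [h, card_filter]
  rw [sum_comm]
  simp_rw [G.adj_comm]

namespace IsSurfaceGraph

theorem nbr_cases (L : IsSurfaceGraph G I) (o : V) (h : G.Adj x y) :
    y ∈ downNbrs G o x ∨ y ∈ levelNbrs G o x ∨ y ∈ upNbrs G o x := by
  have h1 := dist_le_add_one L.connected o h
  have h2 := dist_le_add_one L.connected o h.symm
  simp only [mem_downNbrs, mem_levelNbrs, mem_upNbrs, h, true_and]
  omega

theorem neighborFinset_inter_eq (L : IsSurfaceGraph G I) (o x y : V) :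
    G.neighborFinset x ∩ G.neighborFinset y = (downNbrs G o x ∩ G.neighborFinset y) ∪
      ((levelNbrs G o x ∩ G.neighborFinset y) ∪ (upNbrs G o x ∩ G.neighborFinset y)) := by
  ext p
  simp only [mem_inter, mem_union, ← or_and_right]
  refine and_congr_left fun _ => ⟨fun h => L.nbr_cases o (by simpa using h), ?_⟩
  simp only [mem_downNbrs, mem_levelNbrs, mem_upNbrs, SimpleGraph.mem_neighborFinset]
  tauto

theorem card_inter_eq (L : IsSurfaceGraph G I) (o x y : V) :
    #(G.neighborFinset x ∩ G.neighborFinset y) = #(downNbrs G o x ∩ G.neighborFinset y) +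
      #(levelNbrs G o x ∩ G.neighborFinset y) + #(upNbrs G o x ∩ G.neighborFinset y) := by
  rw [L.neighborFinset_inter_eq o, card_union_of_disjoint, card_union_of_disjoint, add_assoc]
  · rw [disjoint_left]
    intro p
    simp only [mem_inter, mem_levelNbrs, mem_upNbrs]
    rintro ⟨h, -⟩ ⟨h', -⟩
    omega
  · rw [disjoint_left]
    intro p
    simp only [mem_inter, mem_union, mem_downNbrs, mem_levelNbrs, mem_upNbrs]
    rintro ⟨h, -⟩ (⟨h', -⟩ | ⟨h', -⟩) <;> omega

theorem degree_eq (L : IsSurfaceGraph G I) (o x : V) :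
    #(G.neighborFinset x) = #(downNbrs G o x) + #(levelNbrs G o x) + #(upNbrs G o x) := by
  have h : G.neighborFinset x = downNbrs G o x ∪ (levelNbrs G o x ∪ upNbrs G o x) := by
    ext p
    simp only [mem_union]
    refine ⟨fun h => L.nbr_cases o (by simpa using h), ?_⟩
    simp only [mem_downNbrs, mem_levelNbrs, mem_upNbrs, SimpleGraph.mem_neighborFinset]
    tauto
  rw [h, card_union_of_disjoint, card_union_of_disjoint, add_assoc]
  · rw [disjoint_left]
    intro p
    simp only [mem_levelNbrs, mem_upNbrs]
    omega
  · rw [disjoint_left]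
    intro p
    simp only [mem_union, mem_downNbrs, mem_levelNbrs, mem_upNbrs]
    omega

theorem card_le_of_closed (L : IsSurfaceGraph G I) {x : V} {S : Finset V} {y₀ : V}
    (h₀ : G.Adj x y₀) (hy₀ : y₀ ∈ S)
    (hS : ∀ y ∈ S, G.Adj x y → ∀ z ∈ G.neighborFinset x ∩ G.neighborFinset y, z ∈ S) :
    #(G.neighborFinset x) ≤ #S := by
  apply card_le_card
  intro y hy
  exact L.link x (· ∈ S) y₀ h₀ hy₀ (fun y z hy hyS hz hyz => hS y hyS hy z (by simp [hz, hyz])) y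
    (by simpa using hy)

theorem upNbrs_inter_eq_empty (L : IsSurfaceGraph G I) {w : V}
    (hw : w ∈ downNbrs G o x) : upNbrs G o x ∩ G.neighborFinset w = ∅ := by
  ext p
  simp only [mem_inter, mem_upNbrs, SimpleGraph.mem_neighborFinset, notMem_empty, iff_false]
  rintro ⟨⟨-, h1⟩, h2⟩
  have := dist_le_add_one L.connected o h2
  rw [mem_downNbrs] at hw
  omega

theorem exists_mem_downNbrs (L : IsSurfaceGraph G I) (hx : G.dist o x = k) (hk : 1 ≤ k) :
    ∃ w, w ∈ downNbrs G o x := by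
  obtain ⟨w, hw, hd⟩ := exists_adj_dist_eq L.connected (o := o) (x := x) (k := k - 1) (by omega)
  exact ⟨w, mem_downNbrs.2 ⟨hw, by omega⟩⟩

/-- The lower neighbours form a clique in the link, whose vertices have degree two. With three of
them the clique would be closed, hence the whole link, which has at least six vertices. -/
theorem card_downNbrs (L : IsSurfaceGraph G I) (hk : 1 ≤ k) (hd : DownAt G o k)
    (hx : G.dist o x = k) (hI : I x) : #(downNbrs G o x) = 1 ∨ #(downNbrs G o x) = 2 := by
  obtain ⟨w, hw⟩ := L.exists_mem_downNbrs hx hk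
  have hpos := card_pos.2 ⟨w, hw⟩
  by_contra hcon
  have hsub : ∀ w ∈ downNbrs G o x,
      (downNbrs G o x).erase w ⊆ G.neighborFinset x ∩ G.neighborFinset w := by
    intro w hw p hp
    rw [mem_erase] at hp
    simp only [mem_inter, SimpleGraph.mem_neighborFinset]
    exact ⟨(mem_downNbrs.1 hp.2).1, hd.adj x hx w hw p hp.2 hp.1.symm⟩
  have h3 : #(downNbrs G o x) = 3 := by
    have := card_le_card (hsub w hw)
    rw [card_erase_of_mem hw, L.card_common x w hI (mem_downNbrs.1 hw).1] at this
    omega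
  have := L.card_le_of_closed (S := downNbrs G o x) (mem_downNbrs.1 hw).1 hw (by
    intro p hp hxp z hz
    have : (downNbrs G o x).erase p = G.neighborFinset x ∩ G.neighborFinset p := by
      apply eq_of_subset_of_card_le (hsub p hp)
      rw [card_erase_of_mem hp, L.card_common x p hI hxp]
      omega
    rw [← this] at hz
    exact (mem_erase.1 hz).2)
  have := L.six_le_degree x hI
  omega

theorem card_levelNbrs_inter_down (L : IsSurfaceGraph G I) (hd : DownAt G o k)
    (hx : G.dist o x = k) (hI : I x) {w : V} (hw : w ∈ downNbrs G o x) :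
    #(levelNbrs G o x ∩ G.neighborFinset w) + #(downNbrs G o x) = 3 := by
  have h1 := L.card_inter_eq o x w
  rw [L.card_common x w hI (mem_downNbrs.1 hw).1, L.upNbrs_inter_eq_empty hw, card_empty] at h1
  have h2 : downNbrs G o x ∩ G.neighborFinset w = (downNbrs G o x).erase w := by
    ext p
    simp only [mem_inter, mem_erase, SimpleGraph.mem_neighborFinset]
    exact ⟨fun h => ⟨h.2.ne', h.1⟩, fun h => ⟨h.2, hd.adj x hx w hw p h.2 h.1.symm⟩⟩
  rw [h2, card_erase_of_mem hw] at h1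
  have := card_pos.2 ⟨w, hw⟩
  omega

/-- With `d` lower neighbours, each of them has `d - 1` of its two link neighbours below and `3 - d`
on the level. The total `d (3 - d)` is two for both `d = 1` and `d = 2`. -/
theorem sum_down_level (L : IsSurfaceGraph G I) (hk : 1 ≤ k) (hd : DownAt G o k)
    (hx : G.dist o x = k) (hI : I x) :
    ∑ w ∈ downNbrs G o x, #(levelNbrs G o x ∩ G.neighborFinset w) = 2 := by
  have h := L.card_downNbrs hk hd hx hI
  have : ∑ w ∈ downNbrs G o x, #(levelNbrs G o x ∩ G.neighborFinset w) =
      ∑ w ∈ downNbrs G o x, (3 - #(downNbrs G o x)) := by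
    apply sum_congr rfl
    intro w hw
    have := L.card_levelNbrs_inter_down hd hx hI hw
    omega
  rw [this, sum_const, smul_eq_mul]
  rcases h with h | h <;> rw [h]

/-- Every level neighbour is adjacent in the link to exactly one lower neighbour, so the total just
computed counts the level neighbours. -/
theorem card_levelNbrs (L : IsSurfaceGraph G I) (hk : 1 ≤ k) (hd : DownAt G o k)
    (hx : G.dist o x = k) (hI : I x) : #(levelNbrs G o x) = 2 := by
  rw [← L.sum_down_level hk hd hx hI, sum_card_inter_comm, card_eq_sum_ones]
  apply sum_congr rfl
  intro y hy
  rw [mem_levelNbrs] at hy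
  exact (hd.card_common x y hx (by omega) hy.1).symm

/-- Otherwise lower and level neighbours would close up to a link with at most four vertices. -/
theorem levelNbrs_inter_level (L : IsSurfaceGraph G I) (hk : 1 ≤ k) (hd : DownAt G o k)
    (hx : G.dist o x = k) (hI : I x) (hy : y ∈ levelNbrs G o x) :
    levelNbrs G o x ∩ G.neighborFinset y = ∅ := by
  have h2 := L.card_levelNbrs hk hd hx hI
  have h3 := L.card_downNbrs hk hd hx hI
  by_contra hne
  obtain ⟨y', hy'⟩ := nonempty_of_ne_empty hne
  simp only [mem_inter, SimpleGraph.mem_neighborFinset] at hy'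
  have hpair : levelNbrs G o x = {y, y'} := by
    symm
    apply eq_of_subset_of_card_le
    · intro p hp
      simp only [mem_insert, mem_singleton] at hp
      rcases hp with rfl | rfl
      · exact hy
      · exact hy'.1
    · rw [h2, card_pair hy'.2.ne]
  have hno : ∀ p ∈ levelNbrs G o x, upNbrs G o x ∩ G.neighborFinset p = ∅ := by
    intro p hp
    have hc := L.card_inter_eq o x p
    have hp' := mem_levelNbrs.1 hp
    rw [L.card_common x p hI hp'.1, hd.card_common x p hx (by omega) hp'.1] at hc
    have : 1 ≤ #(levelNbrs G o x ∩ G.neighborFinset p) := by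
      rw [hpair] at hp
      simp only [mem_insert, mem_singleton] at hp
      apply card_pos.2
      rcases hp with rfl | rfl
      · exact ⟨y', by simp [hy'.1, hy'.2]⟩
      · exact ⟨y, by simp [hy, hy'.2.symm]⟩
    rw [← card_eq_zero]
    omega
  have := L.card_le_of_closed (S := downNbrs G o x ∪ levelNbrs G o x) (mem_levelNbrs.1 hy).1
    (mem_union_right _ hy) (by
      intro p hp _ z hz
      rw [L.neighborFinset_inter_eq o x p] at hz
      have hup : upNbrs G o x ∩ G.neighborFinset p = ∅ := by
        rcases mem_union.1 hp with h | h
        · exact L.upNbrs_inter_eq_empty h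
        · exact hno p h
      rw [hup, union_empty, ← union_inter_distrib_right] at hz
      exact (mem_inter.1 hz).1)
  have h4 := card_union_le (downNbrs G o x) (levelNbrs G o x)
  have := L.six_le_degree x hI
  omega

theorem card_upNbrs_inter_level (L : IsSurfaceGraph G I) (hk : 1 ≤ k) (hd : DownAt G o k)
    (hx : G.dist o x = k) (hI : I x) (hy : y ∈ levelNbrs G o x) :
    #(upNbrs G o x ∩ G.neighborFinset y) = 1 := by
  have hc := L.card_inter_eq o x y
  have hy' := mem_levelNbrs.1 hy
  rw [L.card_common x y hI hy'.1, hd.card_common x y hx (by omega) hy'.1,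
    L.levelNbrs_inter_level hk hd hx hI hy, card_empty] at hc
  omega

theorem sum_up_level (L : IsSurfaceGraph G I) (hk : 1 ≤ k) (hd : DownAt G o k)
    (hx : G.dist o x = k) (hI : I x) :
    ∑ p ∈ upNbrs G o x, #(levelNbrs G o x ∩ G.neighborFinset p) = 2 := by
  rw [sum_card_inter_comm, ← L.card_levelNbrs hk hd hx hI, card_eq_sum_ones]
  exact sum_congr rfl fun y hy => L.card_upNbrs_inter_level hk hd hx hI hy

theorem downNbrs_inter_up (L : IsSurfaceGraph G I) {p : V} (hp : p ∈ upNbrs G o x) :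
    downNbrs G o x ∩ G.neighborFinset p = ∅ := by
  ext w
  simp only [mem_inter, SimpleGraph.mem_neighborFinset, notMem_empty, iff_false]
  rintro ⟨h1, h2⟩
  have := L.upNbrs_inter_eq_empty h1
  exact notMem_empty p (this ▸ mem_inter.2 ⟨hp, by simpa using h2.symm⟩)

theorem card_up_inter_up (L : IsSurfaceGraph G I) (hI : I x) {p : V} (hp : p ∈ upNbrs G o x) :
    #(levelNbrs G o x ∩ G.neighborFinset p) + #(upNbrs G o x ∩ G.neighborFinset p) = 2 := by
  have hc := L.card_inter_eq o x p
  rw [L.card_common x p hI (mem_upNbrs.1 hp).1, L.downNbrs_inter_up hp, card_empty] at hc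
  omega

/-- Each upper neighbour has link degree two, and two of the link edges leave the upper part towards
the level. The internal edges therefore number one less than the upper neighbours, each counted
twice here. -/
theorem sum_up_up (L : IsSurfaceGraph G I) (hk : 1 ≤ k) (hd : DownAt G o k)
    (hx : G.dist o x = k) (hI : I x) :
    ∑ p ∈ upNbrs G o x, #(upNbrs G o x ∩ G.neighborFinset p) + 2 = 2 * #(upNbrs G o x) := by
  have h1 := L.sum_up_level hk hd hx hI
  have h2 : ∑ p ∈ upNbrs G o x, (#(levelNbrs G o x ∩ G.neighborFinset p) +
      #(upNbrs G o x ∩ G.neighborFinset p)) = ∑ p ∈ upNbrs G o x, 2 :=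
    sum_congr rfl fun p hp => L.card_up_inter_up hI hp
  rw [sum_add_distrib, h1, sum_const, smul_eq_mul] at h2
  omega

/-- A shared upper neighbour would close the link after at most `2 + 2 + 1 = 5` vertices; this is
where degree six is sharp. -/
theorem disjoint_up_level (L : IsSurfaceGraph G I) (hk : 1 ≤ k) (hd : DownAt G o k)
    (hx : G.dist o x = k) (hI : I x) {y' : V} (hy : y ∈ levelNbrs G o x)
    (hy' : y' ∈ levelNbrs G o x) (hne : y ≠ y') {p : V} (hp : p ∈ upNbrs G o x)
    (h : G.Adj y p) : ¬ G.Adj y' p := by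
  intro h'
  have h2 := L.card_levelNbrs hk hd hx hI
  have h3 := L.card_downNbrs hk hd hx hI
  have hpair : levelNbrs G o x = {y, y'} := by
    symm
    apply eq_of_subset_of_card_le
    · intro p hp
      simp only [mem_insert, mem_singleton] at hp
      rcases hp with rfl | rfl <;> assumption
    · rw [h2, card_pair hne]
  have hcl : ∀ q ∈ levelNbrs G o x, upNbrs G o x ∩ G.neighborFinset q = {p} := by
    intro q hq
    obtain ⟨p', hp'⟩ := card_eq_one.1 (L.card_upNbrs_inter_level hk hd hx hI hq)
    have : p ∈ upNbrs G o x ∩ G.neighborFinset q := by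
      rw [hpair] at hq
      simp only [mem_insert, mem_singleton] at hq
      rcases hq with rfl | rfl <;> simp [hp, h, h']
    rw [hp'] at this ⊢
    rw [mem_singleton.1 this]
  have hpup : upNbrs G o x ∩ G.neighborFinset p = ∅ := by
    have h4 := L.card_up_inter_up hI hp
    have : levelNbrs G o x ∩ G.neighborFinset p = {y, y'} := by
      rw [hpair]
      ext q
      simp only [mem_inter, mem_insert, mem_singleton, SimpleGraph.mem_neighborFinset]
      refine ⟨fun h => h.1, fun hq => ⟨hq, ?_⟩⟩
      rcases hq with rfl | rfl
      · exact h.symm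
      · exact h'.symm
    rw [this, card_pair hne] at h4
    rw [← card_eq_zero]
    omega
  have := L.card_le_of_closed (S := insert p (downNbrs G o x ∪ levelNbrs G o x))
    (mem_levelNbrs.1 hy).1 (mem_insert_of_mem (mem_union_right _ hy)) (by
      intro q hq _ z hz
      rw [L.neighborFinset_inter_eq o x q] at hz
      have hup : upNbrs G o x ∩ G.neighborFinset q ⊆ {p} := by
        rcases mem_insert.1 hq with rfl | h
        · rw [hpup]; exact empty_subset _
        rcases mem_union.1 h with h | h
        · rw [L.upNbrs_inter_eq_empty h]; exact empty_subset _
        · rw [hcl q h]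
      rcases mem_union.1 hz with hz | hz
      · exact mem_insert_of_mem (mem_union_left _ (mem_inter.1 hz).1)
      rcases mem_union.1 hz with hz | hz
      · exact mem_insert_of_mem (mem_union_right _ (mem_inter.1 hz).1)
      · rw [mem_singleton.1 (hup hz)]
        exact mem_insert_self _ _)
  have h4 := card_union_le (downNbrs G o x) (levelNbrs G o x)
  have h5 := card_insert_le p (downNbrs G o x ∪ levelNbrs G o x)
  have := L.six_le_degree x hI
  omega

/-- The handshake lemma for the subgraph induced on `C`. -/
theorem even_sum_card_inter (G : SimpleGraph V) (C : Finset V) :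
    Even (∑ p ∈ C, #(C ∩ G.neighborFinset p)) := by
  obtain ⟨H, hH⟩ : ∃ H : SimpleGraph V, ∀ a b, H.Adj a b ↔ G.Adj a b ∧ a ∈ C ∧ b ∈ C :=
    ⟨{  Adj := fun a b => G.Adj a b ∧ a ∈ C ∧ b ∈ C
        symm := ⟨fun a b h => ⟨h.1.symm, h.2.2, h.2.1⟩⟩
        loopless := ⟨fun a h => G.irrefl h.1⟩ }, fun _ _ => Iff.rfl⟩
  have h := sum_sum_neighbor H (fun _ => 1)
  have h1 : ∀ x, ∑ y ∈ H.neighborFinset x, 1 = if x ∈ C then #(C ∩ G.neighborFinset x) else 0 := by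
    intro x
    rw [← card_eq_sum_ones]
    split_ifs with hx
    · congr 1
      ext y
      simp [hH, hx, and_comm]
    · rw [card_eq_zero]
      ext y
      simp [hH, hx]
  simp_rw [h1] at h
  rw [sum_ite_mem, univ_inter] at h
  rw [h, ← smul_sum]
  exact ⟨_, two_nsmul _⟩

/-- The neighbours of `x` away from `o` span a connected graph. -/
theorem up_connected (L : IsSurfaceGraph G I) (hk : 1 ≤ k) (hd : DownAt G o k)
    (hx : G.dist o x = k) (hI : I x) {p p' : V} (hp : p ∈ upNbrs G o x)
    (hp' : p' ∈ upNbrs G o x) :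
    Relation.ReflTransGen (fun a b => G.Adj a b ∧ G.dist o b = k + 1) p p' := by
  let R := Relation.ReflTransGen (fun a b => G.Adj a b ∧ G.dist o b = k + 1)
  let C : V → Finset V := fun a => {b ∈ upNbrs G o x | R a b}
  have hself : ∀ a ∈ upNbrs G o x, a ∈ C a := fun a ha => mem_filter.2 ⟨ha, .refl⟩
  have hclosed : ∀ a, ∀ b ∈ C a, ∀ c ∈ upNbrs G o x, G.Adj b c → c ∈ C a := by
    intro a b hb c hc hbc
    refine mem_filter.2 ⟨hc, (mem_filter.1 hb).2.tail ⟨hbc, ?_⟩⟩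
    rw [(mem_upNbrs.1 hc).2, hx]
  have hinter : ∀ a, ∀ b ∈ C a, C a ∩ G.neighborFinset b = upNbrs G o x ∩ G.neighborFinset b := by
    intro a b hb
    ext c
    simp only [mem_inter, SimpleGraph.mem_neighborFinset]
    exact ⟨fun h => ⟨(mem_filter.1 h.1).1, h.2⟩, fun h => ⟨hclosed a b hb c h.1 h.2, h.2⟩⟩
  have hlev := L.card_levelNbrs hk hd hx hI
  have hsum2 : ∀ a, ∑ b ∈ C a, #(levelNbrs G o x ∩ G.neighborFinset b) +
      ∑ b ∈ C a, #(C a ∩ G.neighborFinset b) = 2 * #(C a) := by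
    intro a
    rw [← sum_add_distrib, mul_comm, ← smul_eq_mul, ← sum_const]
    apply sum_congr rfl
    intro b hb
    rw [hinter a b hb]
    exact L.card_up_inter_up hI (mem_filter.1 hb).1
  -- A component of the upper part without an edge to the level would be a closed piece of the
  -- connected link.
  have hpos : ∀ a ∈ upNbrs G o x, ∑ b ∈ C a, #(levelNbrs G o x ∩ G.neighborFinset b) ≠ 0 := by
    intro a ha h0
    have hz : ∀ b ∈ C a, levelNbrs G o x ∩ G.neighborFinset b = ∅ := fun b hb =>
      card_eq_zero.1 (sum_eq_zero_iff.1 h0 b hb)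
    have hall := L.link x (· ∈ C a) a (mem_upNbrs.1 ha).1 (hself a ha) (by
      intro b c hb hbC hc hbc
      have hmem : c ∈ G.neighborFinset x ∩ G.neighborFinset b := by simp [hc, hbc]
      rw [L.neighborFinset_inter_eq o, L.downNbrs_inter_up (mem_filter.1 hbC).1, hz b hbC,
        empty_union, empty_union] at hmem
      exact hclosed a b hbC c (mem_inter.1 hmem).1 hbc)
    obtain ⟨y, hy⟩ := card_pos.1 (by omega : 0 < #(levelNbrs G o x))
    have hy' := mem_levelNbrs.1 hy
    have := mem_upNbrs.1 (mem_filter.1 (hall y hy'.1)).1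
    omega
  -- By parity each component sends an even number of edges to the level. Only two such edges exist
  -- in total, so there is a single component.
  have htwo : ∀ a ∈ upNbrs G o x, 2 ≤ ∑ b ∈ C a, #(levelNbrs G o x ∩ G.neighborFinset b) := by
    intro a ha
    have h1 := hpos a ha
    have h2 := hsum2 a
    obtain ⟨m, hm⟩ := even_sum_card_inter G (C a)
    omega
  by_contra hcon
  have hdisj : Disjoint (C p) (C p') := by
    rw [disjoint_left]
    intro b hb hb'
    rw [mem_filter] at hb hb'
    have hsymm : ∀ a c, R a c → G.dist o a = k + 1 → R c a := by
      intro a c h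
      induction h with
      | refl => intro _; exact .refl
      | @tail c d hc hcd ih =>
        intro ha
        have hcl : G.dist o c = k + 1 := by
          rcases Relation.ReflTransGen.cases_tail hc with h | ⟨e, -, he⟩
          · rw [h]; exact ha
          · exact he.2
        exact Relation.ReflTransGen.head ⟨hcd.1.symm, hcl⟩ (ih ha)
    exact hcon (hb.2.trans (hsymm _ _ hb'.2 (by rw [(mem_upNbrs.1 hp').2, hx])))
  have hle : ∑ b ∈ C p ∪ C p', #(levelNbrs G o x ∩ G.neighborFinset b) ≤
      ∑ b ∈ upNbrs G o x, #(levelNbrs G o x ∩ G.neighborFinset b) :=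
    sum_le_sum_of_subset (union_subset (filter_subset _ _) (filter_subset _ _))
  rw [sum_union hdisj, L.sum_up_level hk hd hx hI] at hle
  have h1 := htwo p hp
  have h2 := htwo p' hp'
  omega

theorem downAt_one (L : IsSurfaceGraph G I) (o : V) : DownAt G o 1 := by
  have h : ∀ x, G.dist o x = 1 → downNbrs G o x = {o} := by
    intro x hx
    ext w
    rw [mem_downNbrs, mem_singleton]
    constructor
    · rintro ⟨-, h⟩
      exact (L.connected.dist_eq_zero_iff.1 (by omega : G.dist o w = 0)).symm
    · rintro rfl
      refine ⟨(SimpleGraph.dist_eq_one_iff_adj.1 hx).symm, by simp [hx]⟩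
  refine ⟨fun x hx w hw w' hw' hne => ?_, fun x y hx hy _ => ?_⟩
  · rw [h x hx, mem_singleton] at hw hw'
    exact absurd (hw.trans hw'.symm) hne
  · rw [h x hx, card_eq_one]
    refine ⟨o, ?_⟩
    ext p
    simp only [mem_inter, mem_singleton, SimpleGraph.mem_neighborFinset]
    refine ⟨fun h => h.1, ?_⟩
    rintro rfl
    exact ⟨rfl, (SimpleGraph.dist_eq_one_iff_adj.1 hy).symm⟩

theorem sphere_connected_one (L : IsSurfaceGraph G I) {x y : V} (hx : G.dist o x = 1)
    (hy : G.dist o y = 1) :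
    Relation.ReflTransGen (fun a b => G.Adj a b ∧ G.dist o b = 1) x y :=
  L.link o (fun y => Relation.ReflTransGen (fun a b => G.Adj a b ∧ G.dist o b = 1) x y) x
    (SimpleGraph.dist_eq_one_iff_adj.1 hx) .refl
    (fun _ _ _ hp hz hyz => hp.tail ⟨hyz, SimpleGraph.dist_eq_one_iff_adj.2 hz⟩) y
    (SimpleGraph.dist_eq_one_iff_adj.1 hy)

/-- Adjacent vertices of the lower sphere share an upper neighbour, and the upper neighbours of one
vertex are connected among themselves. A path in the lower sphere thus lifts to the next one. -/
theorem sphere_connected_succ (L : IsSurfaceGraph G I) (hk : 1 ≤ k) (hd : DownAt G o k)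
    (hI : ∀ x, G.dist o x = k → I x)
    (hc : ∀ x y, G.dist o x = k → G.dist o y = k →
      Relation.ReflTransGen (fun a b => G.Adj a b ∧ G.dist o b = k) x y)
    {x y : V} (hx : G.dist o x = k + 1) (hy : G.dist o y = k + 1) :
    Relation.ReflTransGen (fun a b => G.Adj a b ∧ G.dist o b = k + 1) x y := by
  obtain ⟨w, hxw, hw⟩ := exists_adj_dist_eq L.connected hx
  obtain ⟨w', hyw', hw'⟩ := exists_adj_dist_eq L.connected hy
  have hp : x ∈ upNbrs G o w := mem_upNbrs.2 ⟨hxw.symm, by omega⟩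
  have hp' : y ∈ upNbrs G o w' := mem_upNbrs.2 ⟨hyw'.symm, by omega⟩
  have hreach := hc w w' hw hw'
  clear hyw' hy
  induction hreach generalizing y with
  | refl => exact L.up_connected hk hd hw (hI w hw) hp hp'
  | @tail b c hb hbc ih =>
    have hbl : G.dist o b = k := by
      rcases Relation.ReflTransGen.cases_tail hb with h | ⟨e, -, he⟩
      · rw [h]; exact hw
      · exact he.2
    obtain ⟨q, hq⟩ := card_eq_one.1 (L.card_upNbrs_inter_level hk hd hbl (hI b hbl)
      (mem_levelNbrs.2 ⟨hbc.1, by omega⟩ : c ∈ levelNbrs G o b))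
    have hq' : q ∈ upNbrs G o b ∩ G.neighborFinset c := by rw [hq]; simp
    simp only [mem_inter, SimpleGraph.mem_neighborFinset] at hq'
    have hqc : q ∈ upNbrs G o c :=
      mem_upNbrs.2 ⟨hq'.2, by rw [(mem_upNbrs.1 hq'.1).2, hbl, hbc.2]⟩
    exact (ih hbl hq'.1).trans (L.up_connected hk hd hbc.2 (hI c hbc.2) hqc hp')

end IsSurfaceGraph

end Links

/-! ### Paths with three edges as chains -/

section PathChain

open Classical

variable {V : Type v}

/-- The 1-chain of a path with three edges. -/
noncomputable def pathChain (w₁ x y w₂ : V) : Sym2 V → ZMod 2 :=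
  Pi.single s(x, y) 1 + Pi.single s(x, w₁) 1 + Pi.single s(y, w₂) 1

theorem pathChain_apply {w₁ x y w₂ : V} (n1 : w₁ ≠ w₂) (n2 : x ≠ w₁) (n3 : x ≠ w₂)
    (n4 : y ≠ w₁) (n6 : x ≠ y) (e : Sym2 V) :
    pathChain w₁ x y w₂ e = if e = s(x, y) ∨ e = s(x, w₁) ∨ e = s(y, w₂) then 1 else 0 := by
  have e1 : s(x, y) ≠ s(x, w₁) := by rw [Ne, Sym2.eq_iff]; tauto
  have e2 : s(x, y) ≠ s(y, w₂) := by rw [Ne, Sym2.eq_iff]; tauto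
  have e3 : s(x, w₁) ≠ s(y, w₂) := by rw [Ne, Sym2.eq_iff]; tauto
  simp only [pathChain, Pi.add_apply, Pi.single_apply]
  by_cases a : e = s(x, y)
  · simp [a, e1, e2]
  · by_cases b : e = s(x, w₁)
    · simp [b, e1.symm, e3]
    · simp [a, b]

theorem pathChain_ne_zero_iff {w₁ x y w₂ : V} (n1 : w₁ ≠ w₂) (n2 : x ≠ w₁) (n3 : x ≠ w₂)
    (n4 : y ≠ w₁) (n6 : x ≠ y) (e : Sym2 V) :
    pathChain w₁ x y w₂ e ≠ 0 ↔ e = s(x, y) ∨ e = s(x, w₁) ∨ e = s(y, w₂) := by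
  rw [pathChain_apply n1 n2 n3 n4 n6]
  simp only [ne_eq, ite_eq_right_iff, one_ne_zero, imp_false, not_not]

end PathChain

/-! ### Induction on the radius: the structure of balls -/

section Balls

open Classical

variable {V : Type v} [Fintype V] {D : AbstractSimplicialComplex V}

theorem IsDisc.apexes_eq (hD : IsDisc D)
    (hdeg : ∀ x, IsInterior D x → 6 ≤ #((skeleton D).neighborFinset x)) {x y : V}
    (h : (skeleton D).Adj x y) :
    apexes D x y = ((skeleton D).neighborFinset x ∩ (skeleton D).neighborFinset y : Finset V) := by
  ext p
  simp only [coe_inter, SimpleGraph.coe_neighborFinset, Set.mem_inter_iff,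
    SimpleGraph.mem_neighborSet]
  constructor
  · intro hp
    have hm := (mem_apexes_iff h.ne).1 hp
    exact ⟨adj_of_mem_tri hm (by simp) (by simp) hp.1.symm,
      adj_of_mem_tri hm (by simp) (by simp) hp.2.1.symm⟩
  · rintro ⟨h1, h2⟩
    exact (mem_apexes_iff h.ne).2 (hD.flag hdeg h h1 h2)

theorem IsDisc.isSurfaceGraph (hD : IsDisc D)
    (hdeg : ∀ x, IsInterior D x → 6 ≤ #((skeleton D).neighborFinset x)) :
    IsSurfaceGraph (skeleton D) (IsInterior D) where
  connected := hD.connected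
  card_common_le x y h := by
    rw [← Set.ncard_coe_finset, ← hD.apexes_eq hdeg h]
    rcases hD.link_degree x y h with h | h <;> omega
  card_common x y hx h := by
    rw [← Set.ncard_coe_finset, ← hD.apexes_eq hdeg h, ← card_trisOn_eq_ncard h.ne]
    exact IsInterior.card_trisOn hD hx h
  link x P y₀ h₀ hP hstep := by
    refine hD.link_induction x P h₀ hP fun y z hy hPy hz => ?_
    have hne := (mem_apexes_iff hy.ne).2 hz
    exact hstep y z hy hPy (adj_of_mem_tri hz (by simp) (by simp) hne.1.symm)
      (adj_of_mem_tri hz (by simp) (by simp) hne.2.1.symm)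
  six_le_degree := hdeg

theorem IsSurfaceGraph.sphereAt (L : IsSurfaceGraph (skeleton D) (IsInterior D)) {o : V} {k : ℕ}
    (hk : 1 ≤ k) (hd : DownAt (skeleton D) o k)
    (hI : ∀ x, (skeleton D).dist o x = k → IsInterior D x)
    (hc : ∀ x y, (skeleton D).dist o x = k → (skeleton D).dist o y = k →
      Relation.ReflTransGen (fun a b => (skeleton D).Adj a b ∧ (skeleton D).dist o b = k) x y) :
    SphereAt D o k where
  connected := hc
  nbrs x hx := by
    have hIx := hI x hx
    obtain ⟨y₁, y₂, hne, hpair⟩ := card_eq_two.1 (L.card_levelNbrs hk hd hx hIx)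
    have m₁ : y₁ ∈ levelNbrs (skeleton D) o x := by rw [hpair]; simp
    have m₂ : y₂ ∈ levelNbrs (skeleton D) o x := by rw [hpair]; simp
    obtain ⟨z₁, hz₁⟩ := card_eq_one.1 (L.card_upNbrs_inter_level hk hd hx hIx m₁)
    obtain ⟨z₂, hz₂⟩ := card_eq_one.1 (L.card_upNbrs_inter_level hk hd hx hIx m₂)
    have u₁ : z₁ ∈ upNbrs (skeleton D) o x ∩ (skeleton D).neighborFinset y₁ := by rw [hz₁]; simp
    have u₂ : z₂ ∈ upNbrs (skeleton D) o x ∩ (skeleton D).neighborFinset y₂ := by rw [hz₂]; simp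
    simp only [mem_inter, SimpleGraph.mem_neighborFinset] at u₁ u₂
    have hap : ∀ y ∈ levelNbrs (skeleton D) o x, ∀ z,
        upNbrs (skeleton D) o x ∩ (skeleton D).neighborFinset y = {z} →
        ∀ p, k ≤ (skeleton D).dist o p → (skeleton D).Adj x p → (skeleton D).Adj y p → p = z := by
      intro y hy z hz p hp hxp hyp
      have hmem : p ∈ (skeleton D).neighborFinset x ∩ (skeleton D).neighborFinset y := by
        simp [hxp, hyp]
      rw [L.neighborFinset_inter_eq o, L.levelNbrs_inter_level hk hd hx hIx hy, hz, empty_union,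
        mem_union, mem_singleton] at hmem
      rcases hmem with h | h
      · have := mem_downNbrs.1 (mem_inter.1 h).1
        omega
      · exact h
    refine ⟨y₁, y₂, z₁, z₂, hne, ?_, (mem_levelNbrs.1 m₁).1, (mem_levelNbrs.1 m₂).1,
      (mem_levelNbrs.1 m₁).2.trans hx, (mem_levelNbrs.1 m₂).2.trans hx,
      (mem_upNbrs.1 u₁.1).2.trans (by rw [hx]), (mem_upNbrs.1 u₂.1).2.trans (by rw [hx]), ?_,
      hap y₁ m₁ z₁ hz₁, hap y₂ m₂ z₂ hz₂⟩
    · rintro rfl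
      exact L.disjoint_up_level hk hd hx hIx m₁ m₂ hne u₁.1 u₁.2 u₂.2
    · intro y hxy hy
      have : y ∈ levelNbrs (skeleton D) o x := mem_levelNbrs.2 ⟨hxy, by omega⟩
      rw [hpair] at this
      simpa using this

/-- Gauss–Bonnet for the path from `w₁` through `x` to `w₂`: three vertices have at most `9 - 6 = 3`
triangles together, so only one sits at `x`, and it contains both `w₁` and `w₂`. -/
theorem SphereAt.down_adj (hD : IsDisc D)
    (hdeg : ∀ x, IsInterior D x → 6 ≤ #((skeleton D).neighborFinset x)) {o : V} {k : ℕ}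
    (hS : SphereAt D o k) {x : V} (hx : (skeleton D).dist o x = k + 1) {w₁ w₂ : V}
    (h₁ : w₁ ∈ downNbrs (skeleton D) o x) (h₂ : w₂ ∈ downNbrs (skeleton D) o x)
    (hw : w₁ ≠ w₂) : (skeleton D).Adj w₁ w₂ := by
  rw [mem_downNbrs] at h₁ h₂
  obtain ⟨a₁, l₁⟩ := h₁
  obtain ⟨a₂, l₂⟩ := h₂
  have n₁ := a₁.ne
  have n₂ := a₂.ne
  let q : Sym2 V → ZMod 2 := fun e => if e = s(x, w₁) ∨ e = s(x, w₂) then 1 else 0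
  have hqne : ∀ e, q e ≠ 0 ↔ e = s(x, w₁) ∨ e = s(x, w₂) := by
    intro e
    simp only [q, ne_eq, ite_eq_right_iff, one_ne_zero, imp_false, not_not]
  have hq1 : q s(x, w₁) = 1 := by simp [q]
  have hq2 : q s(x, w₂) = 1 := by simp [q]
  have hq0 : ∀ {q' : Sym2 V → ZMod 2}, (∀ e, q' e ≠ 0 → q e ≠ 0) →
      ∀ e, e ≠ s(x, w₁) → e ≠ s(x, w₂) → q' e = 0 := by
    intro q' hq' e h1 h2
    by_contra h
    exact ((hqne e).1 (hq' e h)).elim h1 h2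
  have hqsum : q = Pi.single s(x, w₁) 1 + Pi.single s(x, w₂) 1 := by
    ext e
    have h1 : s(x, w₁) ≠ s(x, w₂) := by rw [Ne, Sym2.eq_iff]; tauto
    simp only [q, Pi.add_apply, Pi.single_apply]
    by_cases a : e = s(x, w₁)
    · simp [a, h1]
    · simp [a]
  have hbd : bd₁ D q = Pi.single w₁ 1 + Pi.single w₂ 1 := by
    rw [hqsum, map_add, bd₁_single a₁, bd₁_single a₂]
    ext i
    simp only [Pi.add_apply]
    generalize (Pi.single x 1 : V → ZMod 2) i = a
    generalize (Pi.single w₁ 1 : V → ZMod 2) i = b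
    generalize (Pi.single w₂ 1 : V → ZMod 2) i = c
    revert a b c
    decide
  have hsupp : ∀ e, q e ≠ 0 → e ∈ (skeleton D).edgeSet ∧ ∃ x ∈ e, k < (skeleton D).dist o x := by
    intro e he
    rcases (hqne e).1 he with rfl | rfl
    · exact ⟨a₁, x, by simp, by omega⟩
    · exact ⟨a₂, x, by simp, by omega⟩
  obtain ⟨r, hr⟩ := hD.exists_outerRegion o k (by omega) (by omega) hbd hsupp
  have d₁ : degOf D q w₁ = 1 := by
    rw [← card_singleton x]
    apply degOf_eq_card
    · intro y hy
      rw [mem_singleton.1 hy, Sym2.eq_swap]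
      exact ⟨a₁.symm, hq1⟩
    · intro y hy _
      rw [mem_singleton] at hy
      apply hq0 (fun _ => id) <;> rw [Ne, Sym2.eq_iff] <;> tauto
  have d₂ : degOf D q w₂ = 1 := by
    rw [← card_singleton x]
    apply degOf_eq_card
    · intro y hy
      rw [mem_singleton.1 hy, Sym2.eq_swap]
      exact ⟨a₂.symm, hq2⟩
    · intro y hy _
      rw [mem_singleton] at hy
      apply hq0 (fun _ => id) <;> rw [Ne, Sym2.eq_iff] <;> tauto
  have dx : degOf D q x = 2 := by
    rw [← card_pair hw]
    apply degOf_eq_card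
    · intro y hy
      rw [mem_insert, mem_singleton] at hy
      rcases hy with rfl | rfl
      · exact ⟨a₁, hq1⟩
      · exact ⟨a₂, hq2⟩
    · intro y hy _
      rw [mem_insert, mem_singleton] at hy
      apply hq0 (fun _ => id) <;> rw [Ne, Sym2.eq_iff] <;> tauto
  have d0 : ∀ u, u ≠ x → u ≠ w₁ → u ≠ w₂ → degOf D q u = 0 := by
    intro u h1 h2 h3
    rw [degOf_eq_zero_iff]
    intro y _
    apply hq0 (fun _ => id) <;> rw [Ne, Sym2.eq_iff] <;> tauto
  have hgb := hS.gauss_bonnet hD hdeg hr hw (by omega) (by omega) hbd hsupp d₁ d₂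
    (by
      intro u h1 h2
      by_cases hu : u = x
      · subst hu
        exact Or.inr ⟨by omega, dx⟩
      · exact Or.inl (d0 u hu h1 h2))
    (by
      intro q' hq' hb
      have := hb x (by omega)
      rw [bd₁_eq_add hw a₁ a₂ (fun y _ h1 h2 => by
        apply hq0 hq' <;> rw [Ne, Sym2.eq_iff] <;> tauto)] at this
      have hc : ∀ a b : ZMod 2, a + b = 0 → (a = 0 ∧ b = 0) ∨ (a ≠ 0 ∧ b ≠ 0) := by decide
      rcases hc _ _ this with h | h
      · left
        intro e
        by_contra he
        rcases (hqne e).1 (hq' e he) with rfl | rfl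
        · exact he h.1
        · exact he h.2
      · right
        intro e he
        rcases (hqne e).1 he with rfl | rfl
        · exact h.1
        · exact h.2)
    {x, w₁, w₂}
    (by
      intro u
      rw [mem_insert, mem_insert, mem_singleton]
      constructor
      · rintro (rfl | rfl | rfl) <;> omega
      · intro h
        by_contra hcon
        push Not at hcon
        exact h (d0 u hcon.1 hcon.2.1 hcon.2.2))
  have b₁ : bd₂ D r s(x, w₁) ≠ 0 := by
    rw [hr.bd x w₁ a₁ (by omega), hq1]; decide
  have b₂ : bd₂ D r s(x, w₂) ≠ 0 := by
    rw [hr.bd x w₂ a₂ (by omega), hq2]; decide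
  have c₁ := one_le_starCount (Sym2.eq_swap ▸ b₁)
  have c₂ := one_le_starCount (Sym2.eq_swap ▸ b₂)
  rw [card_eq_three.2 ⟨x, w₁, w₂, n₁, n₂, hw, rfl⟩, sum_insert (by simp [n₁, n₂]),
    sum_pair hw] at hgb
  have htri := (mem_tri_of_starCount_le_one (by omega) a₁ a₂ hw b₁ b₂).1
  exact adj_of_mem_tri htri (by simp) (by simp) hw

theorem bd₁_pathChain {w₁ x y w₂ : V} (hxy : (skeleton D).Adj x y)
    (a₁ : (skeleton D).Adj x w₁) (a₂ : (skeleton D).Adj y w₂) :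
    bd₁ D (pathChain w₁ x y w₂) = Pi.single w₁ 1 + Pi.single w₂ 1 := by
  simp only [pathChain]
  rw [map_add, map_add, bd₁_single hxy, bd₁_single a₁, bd₁_single a₂]
  ext i
  simp only [Pi.add_apply]
  generalize (Pi.single x 1 : V → ZMod 2) i = a
  generalize (Pi.single y 1 : V → ZMod 2) i = d
  generalize (Pi.single w₁ 1 : V → ZMod 2) i = b
  generalize (Pi.single w₂ 1 : V → ZMod 2) i = c
  revert a b c d
  decide

/-- The general inequality with the four path vertices as `X`, so the right side is `3 * 4`. The
path is irreducible since the cycle condition at `x` and at `y` makes the values on its three edges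
equal. -/
theorem SphereAt.gauss_bonnet_path (hD : IsDisc D)
    (hdeg : ∀ x, IsInterior D x → 6 ≤ #((skeleton D).neighborFinset x)) {o : V} {k : ℕ}
    (hS : SphereAt D o k) {x y w₁ w₂ : V} (hx : (skeleton D).dist o x = k + 1)
    (hy : (skeleton D).dist o y = k + 1) (l₁ : (skeleton D).dist o w₁ = k)
    (l₂ : (skeleton D).dist o w₂ = k) (hxy : (skeleton D).Adj x y)
    (a₁ : (skeleton D).Adj x w₁) (a₂ : (skeleton D).Adj y w₂) (n1 : w₁ ≠ w₂)
    {r : Finset V → ZMod 2} (hr : IsOuterRegion D o k (pathChain w₁ x y w₂) r)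
    (hsupp : ∀ e, pathChain w₁ x y w₂ e ≠ 0 →
      e ∈ (skeleton D).edgeSet ∧ ∃ x ∈ e, k < (skeleton D).dist o x) :
    6 + (starCount D r x + (starCount D r y + (starCount D r w₁ + starCount D r w₂))) ≤ 12 := by
  have n2 : x ≠ w₁ := by rintro rfl; omega
  have n3 : x ≠ w₂ := by rintro rfl; omega
  have n4 : y ≠ w₁ := by rintro rfl; omega
  have n5 : y ≠ w₂ := by rintro rfl; omega
  have n6 := hxy.ne
  have hqne := pathChain_ne_zero_iff n1 n2 n3 n4 n6
  have hqv := pathChain_apply n1 n2 n3 n4 n6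
  have hq1 : pathChain w₁ x y w₂ s(x, y) = 1 := by rw [hqv]; simp
  have hq2 : pathChain w₁ x y w₂ s(x, w₁) = 1 := by rw [hqv]; simp
  have hq3 : pathChain w₁ x y w₂ s(y, w₂) = 1 := by rw [hqv]; simp
  have hq0 : ∀ {q' : Sym2 V → ZMod 2}, (∀ e, q' e ≠ 0 → pathChain w₁ x y w₂ e ≠ 0) →
      ∀ e, e ≠ s(x, y) → e ≠ s(x, w₁) → e ≠ s(y, w₂) → q' e = 0 := by
    intro q' hq' e h1 h2 h3
    by_contra h
    exact ((hqne e).1 (hq' e h)).elim h1 (fun h => h.elim h2 h3)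
  have d₁ : degOf D (pathChain w₁ x y w₂) w₁ = 1 := by
    rw [← card_singleton x]
    apply degOf_eq_card
    · intro p hp
      rw [mem_singleton.1 hp, Sym2.eq_swap]
      exact ⟨a₁.symm, hq2⟩
    · intro p hp _
      rw [mem_singleton] at hp
      apply hq0 (fun _ => id) <;> rw [Ne, Sym2.eq_iff] <;> tauto
  have d₂ : degOf D (pathChain w₁ x y w₂) w₂ = 1 := by
    rw [← card_singleton y]
    apply degOf_eq_card
    · intro p hp
      rw [mem_singleton.1 hp, Sym2.eq_swap]
      exact ⟨a₂.symm, hq3⟩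
    · intro p hp _
      rw [mem_singleton] at hp
      apply hq0 (fun _ => id) <;> rw [Ne, Sym2.eq_iff] <;> tauto
  have dx : degOf D (pathChain w₁ x y w₂) x = 2 := by
    rw [← card_pair n4]
    apply degOf_eq_card
    · intro p hp
      rw [mem_insert, mem_singleton] at hp
      rcases hp with rfl | rfl
      · exact ⟨hxy, hq1⟩
      · exact ⟨a₁, hq2⟩
    · intro p hp _
      rw [mem_insert, mem_singleton] at hp
      apply hq0 (fun _ => id) <;> rw [Ne, Sym2.eq_iff] <;> tauto
  have dy : degOf D (pathChain w₁ x y w₂) y = 2 := by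
    rw [← card_pair n3]
    apply degOf_eq_card
    · intro p hp
      rw [mem_insert, mem_singleton] at hp
      rcases hp with rfl | rfl
      · rw [Sym2.eq_swap]
        exact ⟨hxy.symm, hq1⟩
      · exact ⟨a₂, hq3⟩
    · intro p hp _
      rw [mem_insert, mem_singleton] at hp
      apply hq0 (fun _ => id) <;> rw [Ne, Sym2.eq_iff] <;> tauto
  have d0 : ∀ u, u ≠ x → u ≠ y → u ≠ w₁ → u ≠ w₂ → degOf D (pathChain w₁ x y w₂) u = 0 := by
    intro u h1 h2 h3 h4
    rw [degOf_eq_zero_iff]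
    intro p _
    apply hq0 (fun _ => id) <;> rw [Ne, Sym2.eq_iff] <;> tauto
  have hgb := hS.gauss_bonnet hD hdeg hr n1 l₁ l₂ (bd₁_pathChain hxy a₁ a₂) hsupp d₁ d₂
    (by
      intro u h1 h2
      by_cases hu : u = x
      · subst hu
        exact Or.inr ⟨by omega, dx⟩
      by_cases hu' : u = y
      · subst hu'
        exact Or.inr ⟨by omega, dy⟩
      · exact Or.inl (d0 u hu hu' h1 h2))
    (by
      intro q' hq' hb
      have e1 := hb x (by omega)
      rw [bd₁_eq_add n4 hxy a₁ (fun p _ h1 h2 => by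
        apply hq0 hq' <;> rw [Ne, Sym2.eq_iff] <;> tauto)] at e1
      have e2 := hb y (by omega)
      rw [bd₁_eq_add n3 hxy.symm a₂ (fun p _ h1 h2 => by
        apply hq0 hq' <;> rw [Ne, Sym2.eq_iff] <;> tauto), Sym2.eq_swap] at e2
      have hc : ∀ a b c : ZMod 2, a + b = 0 → a + c = 0 →
        (a = 0 ∧ b = 0 ∧ c = 0) ∨ (a ≠ 0 ∧ b ≠ 0 ∧ c ≠ 0) := by decide
      rcases hc _ _ _ e1 e2 with h | h
      · left
        intro e
        by_contra he
        rcases (hqne e).1 (hq' e he) with rfl | rfl | rfl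
        · exact he h.1
        · exact he h.2.1
        · exact he h.2.2
      · right
        intro e he
        rcases (hqne e).1 he with rfl | rfl | rfl
        · exact h.1
        · exact h.2.1
        · exact h.2.2)
    {x, y, w₁, w₂}
    (by
      intro u
      rw [mem_insert, mem_insert, mem_insert, mem_singleton]
      constructor
      · rintro (rfl | rfl | rfl | rfl) <;> omega
      · intro h
        by_contra hcon
        push Not at hcon
        exact h (d0 u hcon.1 hcon.2.1 hcon.2.2.1 hcon.2.2.2))
  have hcard : #({x, y, w₁, w₂} : Finset V) = 4 := by
    rw [card_insert_of_notMem (by simp [n6, n2, n3]),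
      card_eq_three.2 ⟨y, w₁, w₂, n4, n5, n1, rfl⟩]
  rwa [hcard, sum_insert (by simp [n6, n2, n3]), sum_insert (by simp [n4, n5]),
    sum_pair n1] at hgb

theorem bd₂_single {w x w' : V} (htri : {w, x, w'} ∈ tri D) (hne : w ≠ w') {a b : V}
    (hab : (skeleton D).Adj a b) (h : s(a, b) ≠ s(w, w')) :
    bd₂ D (Pi.single {w, x, w'} 1) s(a, b) =
      (Pi.single s(x, w) 1 + Pi.single s(x, w') 1 : Sym2 V → ZMod 2) s(a, b) := by
  have hab' := hab.ne
  have e1 : s(x, w) ≠ s(x, w') := by rw [Ne, Sym2.congr_right]; exact hne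
  have hiff : ({w, x, w'} : Finset V) ∈ trisOn D s(a, b) ↔
      s(a, b) = s(x, w) ∨ s(a, b) = s(x, w') := by
    rw [Ne, Sym2.eq_iff] at h
    rw [mem_trisOn]
    simp only [htri, true_and, mem_insert, mem_singleton, Sym2.eq_iff]
    clear e1 hab htri
    constructor
    · rintro ⟨rfl | rfl | rfl, rfl | rfl | rfl⟩ <;> simp_all
    · rintro ((⟨rfl, rfl⟩ | ⟨rfl, rfl⟩) | (⟨rfl, rfl⟩ | ⟨rfl, rfl⟩)) <;> simp
  rw [bd₂_apply]
  simp only [Pi.add_apply, Pi.single_apply, sum_ite_eq', hiff]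
  by_cases h1 : s(a, b) = s(x, w)
  · simp [h1, e1]
  · simp [h1]

/-- Suppose not, and enclose a region by the path from `w₁` through `x` and `y` to `w₂`. The
vertices `x` and `y` each need two triangles of the region, since a single one would exhibit a
common lower neighbour. The total of at most six leaves one triangle at `w₁`; cutting it off moves
`w₁` along the sphere and shrinks the region, so infinite descent applies. -/
theorem SphereAt.exists_common_down (hD : IsDisc D)
    (hdeg : ∀ x, IsInterior D x → 6 ≤ #((skeleton D).neighborFinset x)) {o : V} {k : ℕ}
    (hS : SphereAt D o k) {x y : V} (hx : (skeleton D).dist o x = k + 1)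
    (hy : (skeleton D).dist o y = k + 1) (hxy : (skeleton D).Adj x y) :
    ∃ w ∈ downNbrs (skeleton D) o x, (skeleton D).Adj y w := by
  by_contra! hno
  have hlev : ∀ w₁ w₂, w₁ ∈ downNbrs (skeleton D) o x → w₂ ∈ downNbrs (skeleton D) o y →
      (skeleton D).Adj x w₁ ∧ (skeleton D).Adj y w₂ ∧ (skeleton D).dist o w₁ = k ∧
        (skeleton D).dist o w₂ = k ∧ w₁ ≠ w₂ ∧ x ≠ w₁ ∧ x ≠ w₂ ∧ y ≠ w₁ ∧ y ≠ w₂ := by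
    intro w₁ w₂ h₁ h₂
    have h₁' := mem_downNbrs.1 h₁
    have h₂' := mem_downNbrs.1 h₂
    refine ⟨h₁'.1, h₂'.1, by omega, by omega, ?_, ?_, ?_, ?_, ?_⟩
    · rintro rfl
      exact hno _ h₁ h₂'.1
    all_goals rintro rfl; omega
  have hsupp : ∀ w₁ w₂, w₁ ∈ downNbrs (skeleton D) o x → w₂ ∈ downNbrs (skeleton D) o y →
      ∀ e, pathChain w₁ x y w₂ e ≠ 0 → e ∈ (skeleton D).edgeSet ∧ ∃ x ∈ e, k < (skeleton D).dist o x := by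
    intro w₁ w₂ h₁ h₂ e he
    obtain ⟨a₁, a₂, -, -, n1, n2, n3, n4, n5⟩ := hlev w₁ w₂ h₁ h₂
    rw [pathChain_ne_zero_iff n1 n2 n3 n4 hxy.ne] at he
    rcases he with rfl | rfl | rfl
    · exact ⟨hxy, x, by simp, by omega⟩
    · exact ⟨a₁, x, by simp, by omega⟩
    · exact ⟨a₂, y, by simp, by omega⟩
  have main : ∀ (m : ℕ) (w₁ w₂ : V) (r : Finset V → ZMod 2),
      w₁ ∈ downNbrs (skeleton D) o x → w₂ ∈ downNbrs (skeleton D) o y →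
      IsOuterRegion D o k (pathChain w₁ x y w₂) r → #{σ ∈ tri D | r σ = 1} = m → False := by
    intro m
    induction m with
    | zero =>
      intro w₁ w₂ r h₁ h₂ hr hm
      have : bd₂ D r s(x, y) ≠ 0 := by
        obtain ⟨-, -, -, -, n1, n2, n3, n4, -⟩ := hlev w₁ w₂ h₁ h₂
        rw [hr.bd x y hxy (by omega), pathChain_ne_zero_iff n1 n2 n3 n4 hxy.ne]
        exact Or.inl rfl
      obtain ⟨σ, hσ, hrσ⟩ := exists_tri_of_bd₂_ne_zero this
      rw [card_eq_zero, filter_eq_empty_iff] at hm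
      exact hm (mem_trisOn.1 hσ).1 hrσ
    | succ m ih =>
      intro w₁ w₂ r h₁ h₂ hr hm
      obtain ⟨a₁, a₂, l₁, l₂, n1, n2, n3, n4, n5⟩ := hlev w₁ w₂ h₁ h₂
      have n6 := hxy.ne
      have hqne := pathChain_ne_zero_iff n1 n2 n3 n4 n6
      have hgb := hS.gauss_bonnet_path hD hdeg hx hy l₁ l₂ hxy a₁ a₂ n1 hr (hsupp w₁ w₂ h₁ h₂)
      have b₁ : bd₂ D r s(x, w₁) ≠ 0 := by
        rw [hr.bd x w₁ a₁ (by omega), hqne]; exact Or.inr (Or.inl rfl)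
      have b₂ : bd₂ D r s(y, w₂) ≠ 0 := by
        rw [hr.bd y w₂ a₂ (by omega), hqne]; exact Or.inr (Or.inr rfl)
      have b₃ : bd₂ D r s(x, y) ≠ 0 := by
        rw [hr.bd x y hxy (by omega), hqne]; exact Or.inl rfl
      have c₂ := one_le_starCount (Sym2.eq_swap ▸ b₂)
      have cx : 2 ≤ starCount D r x := by
        by_contra hcon
        have htri := (mem_tri_of_starCount_le_one (by omega) hxy a₁ n4 b₃ b₁).1
        exact hno w₁ h₁ (adj_of_mem_tri htri (by simp) (by simp) n4)
      have cy : 2 ≤ starCount D r y := by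
        by_contra hcon
        have htri := (mem_tri_of_starCount_le_one (by omega) hxy.symm a₂ n3
          (Sym2.eq_swap ▸ b₃) b₂).1
        have hadj := adj_of_mem_tri htri (x := x) (y := w₂) (by simp) (by simp) n3
        exact hno w₂ (mem_downNbrs.2 ⟨hadj, by omega⟩) a₂
      have hw1 : starCount D r w₁ ≤ 1 := by omega
      -- The boundary of the region is a cycle, so it leaves `w₁` by an edge other than the one to
      -- `x`. That edge is not in the path and hence runs along the sphere.
      obtain ⟨w', hw', hxw', hbw'⟩ : ∃ w', (skeleton D).Adj w₁ w' ∧ w' ≠ x ∧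
          bd₂ D r s(w₁, w') ≠ 0 := by
        by_contra! hcon
        have h0 := congrFun (bd₁_bd₂ (D := D) r) w₁
        rw [bd₁_apply, sum_eq_single x] at h0
        · exact b₁ (Sym2.eq_swap ▸ h0)
        · intro p hp hpx
          exact hcon p (by simpa using hp) hpx
        · intro h
          exact absurd (by simpa using a₁.symm) h
      have hlw' : (skeleton D).dist o w' = k := by
        by_contra hl
        rw [hr.bd w₁ w' hw' (fun h => hl h.2), hqne] at hbw'
        simp only [Sym2.eq_iff] at hbw'
        tauto
      obtain ⟨htri, hrt⟩ := mem_tri_of_starCount_le_one hw1 a₁.symm hw' hxw'.symm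
        (Sym2.eq_swap ▸ b₁) hbw'
      have hxw : (skeleton D).Adj x w' := adj_of_mem_tri htri (by simp) (by simp) hxw'.symm
      have h₁' : w' ∈ downNbrs (skeleton D) o x := mem_downNbrs.2 ⟨hxw, by omega⟩
      -- Adding a triangle of the region modulo two removes it. Up to sphere edges its boundary
      -- exchanges the edge from `x` to `w₁` for the edge from `x` to `w'`.
      refine ih w' w₂ (r + Pi.single {w₁, x, w'} 1) h₁' h₂ ⟨?_, ?_⟩ ?_
      · intro σ hσ hσ1
        by_cases h : σ = {w₁, x, w'}
        · rw [h]
          intro u hu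
          rw [mem_insert, mem_insert, mem_singleton] at hu
          rcases hu with rfl | rfl | rfl <;> omega
        · refine hr.le_dist σ hσ ?_
          simpa [h] using hσ1
      · intro a b hab hn
        have hs : bd₂ D (Pi.single {w₁, x, w'} 1) s(a, b) =
            (Pi.single s(x, w₁) 1 + Pi.single s(x, w') 1 : Sym2 V → ZMod 2) s(a, b) := by
          refine bd₂_single htri hw'.ne hab fun h => hn ?_
          rcases Sym2.eq_iff.1 h with ⟨rfl, rfl⟩ | ⟨rfl, rfl⟩
          · exact ⟨l₁, hlw'⟩
          · exact ⟨hlw', l₁⟩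
        rw [map_add, Pi.add_apply, hr.bd a b hab hn, hs]
        simp only [pathChain, Pi.add_apply]
        generalize (Pi.single s(x, w₁) 1 : Sym2 V → ZMod 2) s(a, b) = c1
        generalize (Pi.single s(x, w') 1 : Sym2 V → ZMod 2) s(a, b) = c2
        generalize (Pi.single s(x, y) 1 : Sym2 V → ZMod 2) s(a, b) = c3
        generalize (Pi.single s(y, w₂) 1 : Sym2 V → ZMod 2) s(a, b) = c4
        revert c1 c2 c3 c4
        decide
      · have : {σ ∈ tri D | (r + Pi.single {w₁, x, w'} 1 : Finset V → ZMod 2) σ = 1} =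
            {σ ∈ tri D | r σ = 1}.erase {w₁, x, w'} := by
          ext σ
          rw [mem_filter, mem_erase, mem_filter, Pi.add_apply]
          by_cases h : σ = {w₁, x, w'}
          · subst h
            rw [hrt, Pi.single_eq_same]
            simp only [ne_eq, not_true_eq_false, false_and, iff_false, not_and]
            intro _
            decide
          · simp [h]
        rw [this, card_erase_of_mem (mem_filter.2 ⟨htri, hrt⟩), hm]
        rfl
  obtain ⟨w₁, a₁, l₁⟩ := exists_adj_dist_eq hD.connected hx
  obtain ⟨w₂, a₂, l₂⟩ := exists_adj_dist_eq hD.connected hy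
  have h₁ : w₁ ∈ downNbrs (skeleton D) o x := mem_downNbrs.2 ⟨a₁, by omega⟩
  have h₂ : w₂ ∈ downNbrs (skeleton D) o y := mem_downNbrs.2 ⟨a₂, by omega⟩
  obtain ⟨r, hr⟩ := hD.exists_outerRegion o k l₁ l₂ (bd₁_pathChain hxy a₁ a₂) (hsupp w₁ w₂ h₁ h₂)
  exact main _ w₁ w₂ r h₁ h₂ hr rfl

/-- Only uniqueness of the common lower neighbour is new. Two of them would be adjacent and span an
edge of the smaller sphere; `x`, `y` and the lower common neighbour of that edge would then be three
common neighbours of its ends. -/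
theorem SphereAt.downAt_succ (hD : IsDisc D)
    (hdeg : ∀ x, IsInterior D x → 6 ≤ #((skeleton D).neighborFinset x)) {o : V} {k : ℕ}
    (hS : SphereAt D o k) (hd : DownAt (skeleton D) o k) : DownAt (skeleton D) o (k + 1) := by
  have hadj : ∀ x, (skeleton D).dist o x = k + 1 → ∀ w ∈ downNbrs (skeleton D) o x,
      ∀ w' ∈ downNbrs (skeleton D) o x, w ≠ w' → (skeleton D).Adj w w' :=
    fun x hx w hw w' hw' hne => hS.down_adj hD hdeg hx hw hw' hne
  refine ⟨hadj, fun x y hx hy hxy => ?_⟩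
  obtain ⟨w, hw, hyw⟩ := hS.exists_common_down hD hdeg hx hy hxy
  rw [card_eq_one]
  refine ⟨w, ?_⟩
  ext w'
  rw [mem_inter, mem_singleton, SimpleGraph.mem_neighborFinset]
  constructor
  · rintro ⟨hw', hyw'⟩
    by_contra hne
    have hww' := hadj x hx w hw w' hw' (Ne.symm hne)
    have m := mem_downNbrs.1 hw
    have m' := mem_downNbrs.1 hw'
    obtain ⟨p, hp⟩ := card_eq_one.1 (hd.card_common w w' (by omega) (by omega) hww')
    have hp' : p ∈ downNbrs (skeleton D) o w ∩ (skeleton D).neighborFinset w' := by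
      rw [hp]; simp
    rw [mem_inter, mem_downNbrs, SimpleGraph.mem_neighborFinset] at hp'
    have hle := (hD.isSurfaceGraph hdeg).card_common_le w w' hww'
    have hsub : ({x, y, p} : Finset V) ⊆
        (skeleton D).neighborFinset w ∩ (skeleton D).neighborFinset w' := by
      intro u hu
      rw [mem_insert, mem_insert, mem_singleton] at hu
      rw [mem_inter, SimpleGraph.mem_neighborFinset, SimpleGraph.mem_neighborFinset]
      rcases hu with rfl | rfl | rfl
      · exact ⟨m.1.symm, m'.1.symm⟩
      · exact ⟨hyw.symm, hyw'.symm⟩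
      · exact ⟨hp'.1.1, hp'.2⟩
    have hc := card_le_card hsub
    rw [card_eq_three.2 ⟨x, y, p, hxy.ne, by rintro rfl; omega, by rintro rfl; omega, rfl⟩] at hc
    omega
  · rintro rfl
    exact ⟨hw, hyw⟩

/-- Connectedness of the sphere is carried along in the induction, being needed for `SphereAt`.
Interior vertices are required only below level `k`, so the last sphere may meet the boundary. -/
theorem IsDisc.downAt (hD : IsDisc D)
    (hdeg : ∀ x, IsInterior D x → 6 ≤ #((skeleton D).neighborFinset x)) (o : V) {k : ℕ}
    (hk : 1 ≤ k) (hI : ∀ x, (skeleton D).dist o x < k → IsInterior D x) :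
    DownAt (skeleton D) o k := by
  have L := hD.isSurfaceGraph hdeg
  suffices H : DownAt (skeleton D) o k ∧
      ∀ x y, (skeleton D).dist o x = k → (skeleton D).dist o y = k →
        Relation.ReflTransGen (fun a b => (skeleton D).Adj a b ∧ (skeleton D).dist o b = k) x y
    from H.1
  induction k, hk using Nat.le_induction with
  | base => exact ⟨L.downAt_one o, fun x y hx hy => L.sphere_connected_one hx hy⟩
  | succ k hk ih =>
    obtain ⟨hd, hc⟩ := ih fun x hx => hI x (by omega)
    have hIk : ∀ x, (skeleton D).dist o x = k → IsInterior D x := fun x hx => hI x (by omega)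
    have hS := L.sphereAt hk hd hIk hc
    exact ⟨hS.downAt_succ hD hdeg hd,
      fun x y hx hy => L.sphere_connected_succ hk hd hIk hc hx hy⟩

end Balls

/-! ### Counting triangles between consecutive spheres -/

section Counting

open Classical

variable {V : Type v} [Fintype V]

theorem sum_sum_card (S : Finset V) (T : V → Finset V) (U : V → V → Finset V) :
    ∑ x ∈ S, ∑ y ∈ T x, #(U x y) =
      ∑ x, ∑ y, ∑ z, if x ∈ S ∧ y ∈ T x ∧ z ∈ U x y then 1 else 0 := by
  rw [← sum_subset (subset_univ S)]
  · apply sum_congr rfl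
    intro x hx
    rw [← sum_subset (subset_univ (T x))]
    · apply sum_congr rfl
      intro y hy
      simp [hx, hy]
    · intro y _ hy
      simp [hy]
  · intro x _ hx
    simp [hx]

/-- Double counting of triples, rotating the order of summation. -/
theorem sum_rotate {S S' : Finset V} {T T' : V → Finset V} {U U' : V → V → Finset V}
    (h : ∀ x y z, x ∈ S ∧ y ∈ T x ∧ z ∈ U x y ↔ y ∈ S' ∧ z ∈ T' y ∧ x ∈ U' y z) :
    ∑ x ∈ S, ∑ y ∈ T x, #(U x y) = ∑ y ∈ S', ∑ z ∈ T' y, #(U' y z) := by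
  rw [sum_sum_card, sum_sum_card, sum_comm]
  apply sum_congr rfl
  intro y _
  rw [sum_comm]
  apply sum_congr rfl
  intro z _
  apply sum_congr rfl
  intro x _
  simp only [h]

variable {G : SimpleGraph V} {I : V → Prop} {o x y : V} {k : ℕ}

/-- The edges spanned by the vertices at distance `k` from `o`. -/
noncomputable def sphereFinset (G : SimpleGraph V) (o : V) (k : ℕ) : Finset (Sym2 V) :=
  {e ∈ G.edgeFinset | ∀ x ∈ e, G.dist o x = k}

theorem two_mul_card_edges (G : SimpleGraph V) (Q : Sym2 V → Prop) [DecidablePred Q] :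
    ∑ x, #{y ∈ G.neighborFinset x | Q s(x, y)} = 2 * #{e ∈ G.edgeFinset | Q e} := by
  simp only [card_filter]
  rw [sum_sum_neighbor G (fun e => if Q e then 1 else 0), mul_sum]
  simp

theorem sum_card_levelNbrs (G : SimpleGraph V) (o : V) (k : ℕ) :
    ∑ x with G.dist o x = k, #(levelNbrs G o x) = 2 * #(sphereFinset G o k) := by
  rw [sphereFinset, ← two_mul_card_edges, sum_filter]
  apply sum_congr rfl
  intro x _
  split_ifs with hx
  · congr 1
    ext y
    simp [mem_levelNbrs, hx]
  · symm
    rw [card_eq_zero, filter_eq_empty_iff]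
    intro y _ h
    exact hx (h x (by simp))

theorem levelNbrs_self (hG : G.Connected) (o : V) : levelNbrs G o o = ∅ := by
  ext y
  simp only [mem_levelNbrs, SimpleGraph.dist_self, notMem_empty, iff_false]
  rintro ⟨h, h'⟩
  exact h.ne (hG.dist_eq_zero_iff.1 h')

namespace IsSurfaceGraph

theorem card_sphere (L : IsSurfaceGraph G I) (hk : 1 ≤ k) (hd : DownAt G o k)
    (hI : ∀ x, G.dist o x = k → I x) :
    #(sphereFinset G o k) = #{x | G.dist o x = k} := by
  have h := sum_card_levelNbrs G o k
  have h' : ∑ x with G.dist o x = k, #(levelNbrs G o x) = ∑ x with G.dist o x = k, 2 := by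
    apply sum_congr rfl
    intro x hx
    have hx : G.dist o x = k := by simpa using hx
    exact L.card_levelNbrs hk hd hx (hI x hx)
  rw [h', sum_const, smul_eq_mul] at h
  omega

theorem card_sphere_zero (L : IsSurfaceGraph G I) : #(sphereFinset G o 0) = 0 := by
  have h := sum_card_levelNbrs G o 0
  have h' : ∑ x with G.dist o x = 0, #(levelNbrs G o x) = 0 := by
    apply sum_eq_zero
    intro x hx
    have hx : G.dist o x = 0 := by simpa using hx
    rw [L.connected.dist_eq_zero_iff] at hx
    subst hx
    rw [levelNbrs_self L.connected, card_empty]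
  omega

/-- Each edge of a sphere has one common neighbour towards `o`. -/
theorem sum_up_up_eq (hd : DownAt G o (k + 1)) :
    ∑ x with G.dist o x = k, ∑ p ∈ upNbrs G o x, #(upNbrs G o x ∩ G.neighborFinset p) =
      2 * #(sphereFinset G o (k + 1)) := by
  have h1 : ∑ x with G.dist o x = k, ∑ p ∈ upNbrs G o x, #(upNbrs G o x ∩ G.neighborFinset p) =
      ∑ p with G.dist o p = k + 1, ∑ p' ∈ levelNbrs G o p,
        #(downNbrs G o p ∩ G.neighborFinset p') := by
    apply sum_rotate
    intro x p p'
    simp only [mem_filter, mem_univ, true_and, mem_inter, mem_upNbrs, mem_levelNbrs, mem_downNbrs,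
      SimpleGraph.mem_neighborFinset]
    constructor
    · rintro ⟨h1, ⟨h2, h3⟩, ⟨h4, h5⟩, h6⟩
      exact ⟨by omega, ⟨h6, by omega⟩, ⟨h2.symm, by omega⟩, h4.symm⟩
    · rintro ⟨h1, ⟨h2, h3⟩, ⟨h4, h5⟩, h6⟩
      exact ⟨by omega, ⟨h4.symm, by omega⟩, ⟨h6.symm, by omega⟩, h2⟩
  rw [h1, ← sum_card_levelNbrs]
  apply sum_congr rfl
  intro p hp
  have hp : G.dist o p = k + 1 := by simpa using hp
  rw [card_eq_sum_ones]
  apply sum_congr rfl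
  intro p' hp'
  rw [mem_levelNbrs] at hp'
  exact hd.card_common p p' hp (by omega) hp'.1

/-- Each edge of an interior sphere has one common neighbour away from `o`. -/
theorem sum_down_down_eq (L : IsSurfaceGraph G I) (hd : 1 ≤ k → DownAt G o k)
    (hI : ∀ x, G.dist o x = k → I x) :
    ∑ x with G.dist o x = k + 1, ∑ w ∈ downNbrs G o x, #(downNbrs G o x ∩ G.neighborFinset w) =
      2 * #(sphereFinset G o k) := by
  have h1 : ∑ x with G.dist o x = k + 1, ∑ w ∈ downNbrs G o x,
        #(downNbrs G o x ∩ G.neighborFinset w) =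
      ∑ w with G.dist o w = k, ∑ w' ∈ levelNbrs G o w,
        #(upNbrs G o w ∩ G.neighborFinset w') := by
    apply sum_rotate
    intro x p p'
    simp only [mem_filter, mem_univ, true_and, mem_inter, mem_upNbrs, mem_levelNbrs, mem_downNbrs,
      SimpleGraph.mem_neighborFinset]
    constructor
    · rintro ⟨h1, ⟨h2, h3⟩, ⟨h4, h5⟩, h6⟩
      exact ⟨by omega, ⟨h6, by omega⟩, ⟨h2.symm, by omega⟩, h4.symm⟩
    · rintro ⟨h1, ⟨h2, h3⟩, ⟨h4, h5⟩, h6⟩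
      exact ⟨by omega, ⟨h4.symm, by omega⟩, ⟨h6.symm, by omega⟩, h2⟩
  rw [h1, ← sum_card_levelNbrs]
  apply sum_congr rfl
  intro w hw
  have hw : G.dist o w = k := by simpa using hw
  rw [card_eq_sum_ones]
  apply sum_congr rfl
  intro w' hw'
  have hk : 1 ≤ k := by
    by_contra hk
    have : o = w := L.connected.dist_eq_zero_iff.1 (by omega)
    subst this
    rw [levelNbrs_self L.connected] at hw'
    exact notMem_empty _ hw'
  exact L.card_upNbrs_inter_level hk (hd hk) hw (hI w hw) hw'

/-- The clique of `d` lower neighbours gives `d (d - 1) + 2`, which equals `2d` for `d = 1` and `d =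
2`. -/
theorem sum_down_down (L : IsSurfaceGraph G I) (hk : 1 ≤ k) (hd : DownAt G o k)
    (hx : G.dist o x = k) (hI : I x) :
    ∑ w ∈ downNbrs G o x, #(downNbrs G o x ∩ G.neighborFinset w) + 2 =
      2 * #(downNbrs G o x) := by
  have h : ∑ w ∈ downNbrs G o x, #(downNbrs G o x ∩ G.neighborFinset w) =
      ∑ w ∈ downNbrs G o x, (#(downNbrs G o x) - 1) := by
    apply sum_congr rfl
    intro w hw
    rw [← card_erase_of_mem hw]
    congr 1
    ext p
    simp only [mem_inter, mem_erase, SimpleGraph.mem_neighborFinset]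
    exact ⟨fun h => ⟨h.2.ne', h.1⟩, fun h => ⟨h.2, hd.adj x hx w hw p h.2 h.1.symm⟩⟩
  rw [h, sum_const, smul_eq_mul]
  rcases L.card_downNbrs hk hd hx hI with h | h <;> rw [h]

/-- At a vertex with `d` lower, two level and `u` upper neighbours, the lower and upper parts of the
link contain `d - 1` and `u - 1` edges. These are bases of triangles on the two adjacent spheres,
each base belonging to one triangle with apex on the middle level, and `(d - 1) + (u - 1) + 4` is
the degree. -/
theorem card_sphere_add (L : IsSurfaceGraph G I) (k : ℕ)
    (hd : ∀ j, 1 ≤ j → j ≤ k + 2 → DownAt G o j) (hI : ∀ x, G.dist o x ≤ k + 1 → I x) :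
    #(sphereFinset G o (k + 2)) + #(sphereFinset G o k) + 4 * #{x | G.dist o x = k + 1} =
      ∑ x with G.dist o x = k + 1, #(G.neighborFinset x) := by
  have h1 := sum_up_up_eq (hd (k + 1 + 1) (by omega) (by omega))
  rw [show k + 1 + 1 = k + 2 from rfl] at h1
  have h2 := L.sum_down_down_eq (fun h => hd k h (by omega)) (fun x hx => hI x (by omega))
  have h3 : ∀ x ∈ ({x | G.dist o x = k + 1} : Finset V),
      ∑ p ∈ upNbrs G o x, #(upNbrs G o x ∩ G.neighborFinset p) +
      ∑ w ∈ downNbrs G o x, #(downNbrs G o x ∩ G.neighborFinset w) + 8 =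
        2 * #(G.neighborFinset x) := by
    intro x hx
    have hx : G.dist o x = k + 1 := by simpa using hx
    have hIx := hI x hx.le
    have hdx := hd (k + 1) (by omega) (by omega)
    have a1 := L.sum_down_down (by omega) hdx hx hIx
    have a2 := L.sum_up_up (by omega) hdx hx hIx
    have a3 := L.card_levelNbrs (by omega) hdx hx hIx
    have a4 := L.degree_eq o x
    omega
  have h4 := sum_congr rfl h3
  rw [sum_add_distrib, sum_add_distrib, h1, h2, sum_const, ← mul_sum, smul_eq_mul] at h4
  omega

end IsSurfaceGraph

/-- The combinatorics of an alternating pair, in the ball of radius `m` about `o`. -/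
structure IsAlternatingBall (G : SimpleGraph V) (o : V) (m t : ℕ) (A B : Finset V) : Prop where
  mem_or : ∀ x, G.dist o x ≤ m → x ∈ A ∨ x ∈ B
  disjoint : Disjoint A B
  nbr_left : ∀ x ∈ A, ∀ y, G.Adj x y → G.dist o y ≤ m → y ∈ B
  apex : ∀ x ∈ B, ∀ y ∈ B, ∀ p, G.Adj x y → G.Adj x p → G.Adj y p → G.dist o p ≤ m → p ∈ A
  card_right : ∀ x ∈ B, G.dist o x < m → 2 * #{y ∈ G.neighborFinset x | y ∈ B} = t

namespace IsAlternatingBall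

variable {m t : ℕ} {A B : Finset V}

/-- An edge between two `B`-vertices on levels `k` and `k + 1` lies in two triangles, with apexes in
`A` on one of these levels. Conversely, the link of an `A`-vertex consists of `B`-vertices: two of
its edges join the level part to the upper part, and two join it to the lower part. The centre has
no level neighbours, so it counts zero. -/
theorem sum_up_right (hAB : IsAlternatingBall G o m t A B) (L : IsSurfaceGraph G I)
    (hk : k + 1 ≤ m) (hd : ∀ j, 1 ≤ j → j ≤ k + 1 → DownAt G o j)
    (hI : ∀ x, G.dist o x ≤ k + 1 → I x) :
    ∑ b ∈ B with G.dist o b = k, #(upNbrs G o b ∩ B) =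
      (if k = 0 then 0 else #{a ∈ A | G.dist o a = k}) + #{a ∈ A | G.dist o a = k + 1} := by
  have h1 : ∑ b ∈ B with G.dist o b = k, ∑ b' ∈ upNbrs G o b ∩ B,
      #{p ∈ G.neighborFinset b ∩ G.neighborFinset b' | G.dist o p = k} =
      ∑ a ∈ A with G.dist o a = k, ∑ b ∈ levelNbrs G o a,
        #(upNbrs G o a ∩ G.neighborFinset b) := by
    symm
    apply sum_rotate
    intro a b b'
    simp only [mem_filter, mem_inter, mem_upNbrs, mem_levelNbrs, SimpleGraph.mem_neighborFinset]
    constructor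
    · rintro ⟨⟨h1, h2⟩, ⟨h3, h4⟩, ⟨h5, h6⟩, h7⟩
      exact ⟨⟨hAB.nbr_left a h1 b h3 (by omega), by omega⟩,
        ⟨⟨h7, by omega⟩, hAB.nbr_left a h1 b' h5 (by omega)⟩, ⟨h3.symm, h5.symm⟩, h2⟩
    · rintro ⟨⟨h1, h2⟩, ⟨⟨h3, h4⟩, h5⟩, ⟨h6, h7⟩, h8⟩
      exact ⟨⟨hAB.apex b h1 b' h5 a h3 h6 h7 (by omega), h8⟩, ⟨h6.symm, by omega⟩,
        ⟨h7.symm, by omega⟩, h3⟩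
  have h2 : ∑ b ∈ B with G.dist o b = k, ∑ b' ∈ upNbrs G o b ∩ B,
      #{p ∈ G.neighborFinset b ∩ G.neighborFinset b' | ¬ G.dist o p = k} =
      ∑ a ∈ A with G.dist o a = k + 1, ∑ b ∈ downNbrs G o a,
        #(levelNbrs G o a ∩ G.neighborFinset b) := by
    symm
    apply sum_rotate
    intro a b b'
    simp only [mem_filter, mem_inter, mem_upNbrs, mem_levelNbrs, mem_downNbrs,
      SimpleGraph.mem_neighborFinset]
    constructor
    · rintro ⟨⟨h1, h2⟩, ⟨h3, h4⟩, ⟨h5, h6⟩, h7⟩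
      exact ⟨⟨hAB.nbr_left a h1 b h3 (by omega), by omega⟩,
        ⟨⟨h7, by omega⟩, hAB.nbr_left a h1 b' h5 (by omega)⟩, ⟨h3.symm, h5.symm⟩, by omega⟩
    · rintro ⟨⟨h1, h2⟩, ⟨⟨h3, h4⟩, h5⟩, ⟨h6, h7⟩, h8⟩
      have l1 := dist_le_add_one L.connected o h6
      have l2 := dist_le_add_one L.connected o h7.symm
      exact ⟨⟨hAB.apex b h1 b' h5 a h3 h6 h7 (by omega), by omega⟩, ⟨h6.symm, by omega⟩,
        ⟨h7.symm, by omega⟩, h3⟩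
  have h3 : ∑ b ∈ B with G.dist o b = k, ∑ b' ∈ upNbrs G o b ∩ B,
      (#{p ∈ G.neighborFinset b ∩ G.neighborFinset b' | G.dist o p = k} +
        #{p ∈ G.neighborFinset b ∩ G.neighborFinset b' | ¬ G.dist o p = k}) =
      ∑ b ∈ B with G.dist o b = k, 2 * #(upNbrs G o b ∩ B) := by
    apply sum_congr rfl
    intro b hb
    rw [mul_comm, ← smul_eq_mul, ← sum_const]
    apply sum_congr rfl
    intro b' hb'
    rw [card_filter_add_card_filter_not]
    rw [mem_filter] at hb
    exact L.card_common b b' (hI b (by omega)) (mem_upNbrs.1 (mem_inter.1 hb').1).1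
  have h4 : ∑ a ∈ A with G.dist o a = k, ∑ b ∈ levelNbrs G o a,
      #(upNbrs G o a ∩ G.neighborFinset b) =
        2 * if k = 0 then 0 else #{a ∈ A | G.dist o a = k} := by
    split_ifs with h0
    · subst h0
      apply sum_eq_zero
      intro a ha
      have : o = a := L.connected.dist_eq_zero_iff.1 (mem_filter.1 ha).2
      subst this
      rw [levelNbrs_self L.connected, sum_empty]
    · rw [mul_comm, ← smul_eq_mul, ← sum_const]
      apply sum_congr rfl
      intro a ha
      have ha := (mem_filter.1 ha).2
      rw [sum_card_inter_comm]
      exact L.sum_up_level (by omega) (hd k (by omega) (by omega)) ha (hI a (by omega))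
  have h5 : ∑ a ∈ A with G.dist o a = k + 1, ∑ b ∈ downNbrs G o a,
      #(levelNbrs G o a ∩ G.neighborFinset b) = 2 * #{a ∈ A | G.dist o a = k + 1} := by
    rw [mul_comm, ← smul_eq_mul, ← sum_const]
    apply sum_congr rfl
    intro a ha
    have ha := (mem_filter.1 ha).2
    exact L.sum_down_level (by omega) (hd (k + 1) (by omega) (by omega)) ha (hI a (by omega))
  simp_rw [sum_add_distrib] at h3
  rw [h1, h2, h4, h5, ← mul_sum] at h3
  omega

/-- Every vertex has two level neighbours, and those of an `A`-vertex are all in `B`. The level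
edges from `B` to `A` therefore number two for each `A`-vertex. -/
theorem sum_level_right (hAB : IsAlternatingBall G o m t A B) (L : IsSurfaceGraph G I)
    (hk : 1 ≤ k) (hkm : k ≤ m) (hd : DownAt G o k) (hI : ∀ x, G.dist o x = k → I x) :
    ∑ b ∈ B with G.dist o b = k, #(levelNbrs G o b ∩ B) + 2 * #{a ∈ A | G.dist o a = k} =
      2 * #{b ∈ B | G.dist o b = k} := by
  have h1 : ∑ b ∈ B with G.dist o b = k, (#(levelNbrs G o b ∩ B) + #(levelNbrs G o b ∩ A)) =
      2 * #{b ∈ B | G.dist o b = k} := by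
    rw [mul_comm, ← smul_eq_mul, ← sum_const]
    apply sum_congr rfl
    intro b hb
    have hb := (mem_filter.1 hb).2
    rw [← L.card_levelNbrs hk hd hb (hI b hb), ← card_union_of_disjoint]
    · congr 1
      rw [← inter_union_distrib_left, inter_eq_left]
      intro y hy
      rw [mem_levelNbrs] at hy
      rw [mem_union, or_comm]
      exact hAB.mem_or y (by omega)
    · exact (hAB.disjoint.symm.mono inter_subset_right inter_subset_right)
  have h2 : ∑ b ∈ B with G.dist o b = k, #(levelNbrs G o b ∩ A) =
      2 * #{a ∈ A | G.dist o a = k} := by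
    have e1 : ∀ b ∈ ({b ∈ B | G.dist o b = k} : Finset V),
        #(levelNbrs G o b ∩ A) = #({a ∈ A | G.dist o a = k} ∩ G.neighborFinset b) := by
      intro b hb
      rw [mem_filter] at hb
      congr 1
      ext a
      simp only [mem_inter, mem_levelNbrs, mem_filter, SimpleGraph.mem_neighborFinset, hb.2]
      tauto
    rw [sum_congr rfl e1, sum_card_inter_comm, mul_comm, ← smul_eq_mul, ← sum_const]
    apply sum_congr rfl
    intro a ha
    rw [mem_filter] at ha
    rw [← L.card_levelNbrs hk hd ha.2 (hI a ha.2)]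
    congr 1
    ext b
    simp only [mem_inter, mem_levelNbrs, mem_filter, SimpleGraph.mem_neighborFinset, ha.2]
    constructor
    · rintro ⟨⟨h1, h2⟩, h3⟩
      exact ⟨h3, h2⟩
    · rintro ⟨h1, h2⟩
      exact ⟨⟨hAB.nbr_left a ha.1 b h1 (by omega), h2⟩, h1⟩
  rw [sum_add_distrib, h2] at h1
  exact h1

theorem sum_down_right (k : ℕ) :
    ∑ b ∈ B with G.dist o b = k + 1, #(downNbrs G o b ∩ B) =
      ∑ b ∈ B with G.dist o b = k, #(upNbrs G o b ∩ B) := by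
  have e1 : ∀ b ∈ ({b ∈ B | G.dist o b = k + 1} : Finset V),
      #(downNbrs G o b ∩ B) = #({a ∈ B | G.dist o a = k} ∩ G.neighborFinset b) := by
    intro b hb
    rw [mem_filter] at hb
    congr 1
    ext a
    simp only [mem_inter, mem_downNbrs, mem_filter, SimpleGraph.mem_neighborFinset, hb.2,
      add_left_inj]
    tauto
  have e2 : ∀ b ∈ ({b ∈ B | G.dist o b = k} : Finset V),
      #(upNbrs G o b ∩ B) = #({a ∈ B | G.dist o a = k + 1} ∩ G.neighborFinset b) := by
    intro b hb
    rw [mem_filter] at hb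
    congr 1
    ext a
    simp only [mem_inter, mem_upNbrs, mem_filter, SimpleGraph.mem_neighborFinset, hb.2]
    tauto
  rw [sum_congr rfl e1, sum_congr rfl e2, sum_card_inter_comm]

/-- Half of the `t` neighbours of a `B`-vertex are in `B`. Summed over level `k + 1`, with `a` and
`b` counting `A`- and `B`-vertices on a level, the lower, level and upper ones contribute `a k + a
(k+1)`, then `2 b (k+1) - 2 a (k+1)`, then `a (k+1) + a (k+2)`; the terms `a (k+1)` cancel. -/
theorem card_left_add (hAB : IsAlternatingBall G o m t A B) (L : IsSurfaceGraph G I)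
    (hk : k + 2 ≤ m) (hd : ∀ j, 1 ≤ j → j ≤ k + 2 → DownAt G o j)
    (hI : ∀ x, G.dist o x ≤ k + 2 → I x) :
    2 * #{a ∈ A | G.dist o a = k + 2} +
        2 * (if k = 0 then 0 else #{a ∈ A | G.dist o a = k}) +
        4 * #{b ∈ B | G.dist o b = k + 1} =
      t * #{b ∈ B | G.dist o b = k + 1} := by
  have h1 := hAB.sum_up_right L (k := k) (by omega) (fun j h h' => hd j h (by omega))
    (fun x hx => hI x (by omega))
  have h2 := hAB.sum_up_right L (k := k + 1) (by omega) (fun j h h' => hd j h (by omega))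
    (fun x hx => hI x (by omega))
  have h3 := hAB.sum_level_right L (k := k + 1) (by omega) (by omega) (hd _ (by omega) (by omega))
    (fun x hx => hI x (by omega))
  have h4 := sum_down_right (G := G) (o := o) (B := B) k
  have h5 : ∑ b ∈ B with G.dist o b = k + 1, 2 * (#(downNbrs G o b ∩ B) +
      #(levelNbrs G o b ∩ B) + #(upNbrs G o b ∩ B)) = t * #{b ∈ B | G.dist o b = k + 1} := by
    rw [mul_comm, ← smul_eq_mul, ← sum_const]
    apply sum_congr rfl
    intro b hb
    rw [mem_filter] at hb
    rw [← hAB.card_right b hb.1 (by omega), ← card_union_of_disjoint, ← card_union_of_disjoint]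
    · congr 2
      ext y
      simp only [mem_union, mem_inter, mem_filter, ← or_and_right]
      refine and_congr_left fun _ => ⟨?_, fun h => ?_⟩
      · simp only [mem_downNbrs, mem_levelNbrs, mem_upNbrs, SimpleGraph.mem_neighborFinset]
        tauto
      · have := L.nbr_cases o (by simpa using h : G.Adj b y)
        tauto
    · rw [disjoint_left]
      intro p
      simp only [mem_union, mem_inter, mem_downNbrs, mem_levelNbrs, mem_upNbrs]
      omega
    · rw [disjoint_left]
      intro p
      simp only [mem_inter, mem_downNbrs, mem_levelNbrs]
      omega
  rw [← mul_sum, sum_add_distrib, sum_add_distrib, h4, h1, h2] at h5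
  simp only [Nat.add_eq_zero_iff, one_ne_zero, and_false, if_false] at h5
  rw [show k + 1 + 1 = k + 2 from rfl] at h5
  omega

end IsAlternatingBall

end Counting

/-! ### From counts in the ball to relations between the sequences -/

section Recurrences

open Classical

variable {V : Type v} [Fintype V] {D : AbstractSimplicialComplex V} {o : V} {k : ℕ}

theorem ncard_neighborSet (G : SimpleGraph V) (x : V) :
    (G.neighborSet x).ncard = #(G.neighborFinset x) := by
  rw [← Set.ncard_coe_finset, SimpleGraph.coe_neighborFinset]

theorem ncard_sphere (D : AbstractSimplicialComplex V) (o : V) (k : ℕ) :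
    (sphere D o k).ncard = #(sphereFinset (skeleton D) o k) := by
  rw [← Set.ncard_coe_finset]
  congr 1
  ext e
  simp [sphere, sphereFinset]

theorem mem_sphereVerts {A : Set V} {x : V} :
    x ∈ sphereVerts D A o k ↔ x ∈ A ∧ (skeleton D).dist o x = k ∧
      (levelNbrs (skeleton D) o x).Nonempty := by
  constructor
  · rintro ⟨hA, e, he, hx⟩
    obtain ⟨y, rfl⟩ := hx
    have h1 : (skeleton D).dist o x = k := he.2 x (by simp)
    have h2 : (skeleton D).dist o y = k := he.2 y (by simp)
    exact ⟨hA, h1, y, mem_levelNbrs.2 ⟨he.1, by omega⟩⟩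
  · rintro ⟨hA, hx, y, hy⟩
    rw [mem_levelNbrs] at hy
    refine ⟨hA, s(x, y), ⟨hy.1, ?_⟩, by simp⟩
    intro p hp
    rw [Sym2.mem_iff] at hp
    rcases hp with rfl | rfl <;> omega

/-- For positive radius every vertex of an interior sphere lies on a sphere edge. At radius zero
there are no edges, and the centre is not counted. -/
theorem IsSurfaceGraph.ncard_sphereVerts (L : IsSurfaceGraph (skeleton D) (IsInterior D))
    (A : Set V) (hd : 1 ≤ k → DownAt (skeleton D) o k)
    (hI : ∀ x, (skeleton D).dist o x = k → IsInterior D x) :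
    (sphereVerts D A o k).ncard =
      if k = 0 then 0 else #{a ∈ ({a | a ∈ A} : Finset V) | (skeleton D).dist o a = k} := by
  split_ifs with h0
  · subst h0
    rw [Set.ncard_eq_zero, Set.eq_empty_iff_forall_notMem]
    intro x hx
    rw [mem_sphereVerts] at hx
    have : o = x := L.connected.dist_eq_zero_iff.1 hx.2.1
    subst this
    rw [levelNbrs_self L.connected] at hx
    exact not_nonempty_empty hx.2.2
  · rw [← Set.ncard_coe_finset]
    congr 1
    ext x
    rw [mem_sphereVerts]
    simp only [coe_filter, mem_filter, mem_univ, true_and, Set.mem_ofPred_eq]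
    refine and_congr_right fun _ => ⟨fun h => h.1, fun hx => ⟨hx, ?_⟩⟩
    rw [← card_pos, L.card_levelNbrs (by omega) (hd (by omega)) hx (hI x hx)]
    norm_num

theorem two_mul_card_even {t : ℕ} (ht : Even t) : 2 * #{i : Fin t | Even i.val} = t := by
  obtain ⟨m, rfl⟩ := ht
  rw [card_filter, Fin.sum_univ_eq_sum_range (fun i => if Even i then 1 else 0)]
  induction m with
  | zero => simp
  | succ m ih =>
    rw [show m + 1 + (m + 1) = m + m + 1 + 1 by ring, sum_range_succ, sum_range_succ]
    have h1 : Even (m + m) := ⟨m, rfl⟩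
    have h2 : ¬ Even (m + m + 1) := by simp [Nat.even_add_one, h1]
    rw [if_pos h1, if_neg h2]
    omega

theorem IsAlternating.isAlternatingBall {s t : ℕ} {A B : Set V} (h : IsAlternating D s t A B)
    (ht : Even t) (hD : (skeleton D).Connected) {m : ℕ}
    (hI : ∀ x, (skeleton D).dist o x ≤ m → IsInterior D x) :
    IsAlternatingBall (skeleton D) o m t {a | a ∈ A} {b | b ∈ B} where
  mem_or x hx := by
    have : x ∈ A ∪ B := by rw [h.union]; exact hI x hx
    simpa using this
  disjoint := by
    rw [disjoint_left]
    intro x hx hx'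
    simp only [mem_filter, mem_univ, true_and] at hx hx'
    exact Set.disjoint_left.1 h.disjoint hx hx'
  nbr_left x hx y hxy hy := by
    simp only [mem_filter, mem_univ, true_and] at hx ⊢
    exact (h.nbrs_left x hx y hxy).resolve_right (hI y hy)
  apex x hx y hy p hxy hxp hyp hp := by
    simp only [mem_filter, mem_univ, true_and] at hx hy ⊢
    obtain ⟨c, -, hrange, hadj, heven, hodd⟩ := h.nbrs_right x hx
    obtain ⟨i, rfl⟩ : y ∈ Set.range c := by rw [hrange]; exact hxy
    obtain ⟨j, rfl⟩ : p ∈ Set.range c := by rw [hrange]; exact hxp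
    have hi : Even i.val := by
      by_contra hi
      rw [Nat.not_even_iff_odd] at hi
      rcases hodd i hi with h1 | h1
      · exact Set.disjoint_left.1 h.disjoint h1 hy
      · exact (h.right hy).1 h1
    have hj : Odd j.val := by
      have hij := (hadj i j).1 hyp
      rw [Nat.even_iff] at hi ht
      rw [Nat.odd_iff]
      -- As `t` is even, parity of the position also alternates where the cycle wraps around.
      have hmod : ∀ a, (a % t) % 2 = a % 2 := fun a => Nat.mod_mod_of_dvd a (by omega)
      rcases hij with h1 | h1
      · have := hmod (i.val + 1)
        omega
      · have := hmod (j.val + 1)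
        omega
    exact (hodd j hj).resolve_right (hI _ hp)
  card_right x hx hxm := by
    simp only [mem_filter, mem_univ, true_and] at hx ⊢
    obtain ⟨c, hinj, hrange, -, heven, hodd⟩ := h.nbrs_right x hx
    have hnb : ∀ i, (skeleton D).Adj x (c i) := fun i => by
      have : c i ∈ (skeleton D).neighborSet x := hrange ▸ ⟨i, rfl⟩
      exact this
    have hint : ∀ i, IsInterior D (c i) := fun i => by
      have := dist_le_add_one hD o (hnb i)
      exact hI _ (by omega)
    rw [← two_mul_card_even ht, ← card_image_of_injective _ hinj]
    congr 2
    ext y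
    simp only [mem_filter, SimpleGraph.mem_neighborFinset, mem_image, mem_univ, true_and]
    constructor
    · rintro ⟨hxy, hy⟩
      obtain ⟨i, rfl⟩ : y ∈ Set.range c := by rw [hrange]; exact hxy
      refine ⟨i, ?_, rfl⟩
      by_contra hi
      rw [Nat.not_even_iff_odd] at hi
      exact Set.disjoint_left.1 h.disjoint ((hodd i hi).resolve_right (hint i)) hy
    · rintro ⟨i, hi, rfl⟩
      exact ⟨hnb i, (heven i hi).resolve_right (hint i)⟩

variable {s t : ℕ} {A B : Set V}

theorem IsSurfaceGraph.ncard_sphere_alternating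
    (L : IsSurfaceGraph (skeleton D) (IsInterior D)) (h : IsAlternating D s t A B)
    (hd : 1 ≤ k → DownAt (skeleton D) o k)
    (hI : ∀ x, (skeleton D).dist o x = k → IsInterior D x) :
    (sphere D o k).ncard = (sphereVerts D A o k).ncard + (sphereVerts D B o k).ncard := by
  rw [ncard_sphere, L.ncard_sphereVerts A hd hI, L.ncard_sphereVerts B hd hI]
  split_ifs with h0
  · subst h0
    exact L.card_sphere_zero
  · rw [L.card_sphere (by omega) (hd (by omega)) hI, ← card_union_of_disjoint]
    · congr 1
      ext x
      simp only [mem_filter, mem_univ, true_and, mem_union, ← or_and_right]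
      refine ⟨fun hx => ⟨?_, hx⟩, fun hx => hx.2⟩
      have : x ∈ A ∪ B := by rw [h.union]; exact hI x hx
      exact this
    · rw [disjoint_left]
      intro x hx hx'
      simp only [mem_filter, mem_univ, true_and] at hx hx'
      exact Set.disjoint_left.1 h.disjoint hx.1 hx'.1

theorem IsSurfaceGraph.ncard_sphere_add (L : IsSurfaceGraph (skeleton D) (IsInterior D))
    (h : IsAlternating D s t A B)
    (hd : ∀ j, 1 ≤ j → j ≤ k + 2 → DownAt (skeleton D) o j)
    (hI : ∀ x, (skeleton D).dist o x ≤ k + 1 → IsInterior D x) :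
    (sphere D o (k + 2)).ncard + (sphere D o k).ncard + 4 * (sphere D o (k + 1)).ncard =
      s * (sphereVerts D A o (k + 1)).ncard + t * (sphereVerts D B o (k + 1)).ncard := by
  have hI' : ∀ x, (skeleton D).dist o x = k + 1 → IsInterior D x := fun x hx => hI x hx.le
  have hd' : 1 ≤ k + 1 → DownAt (skeleton D) o (k + 1) := fun h => hd _ h (by omega)
  have h1 := L.card_sphere_add k hd hI
  rw [← L.card_sphere (by omega) (hd' (by omega)) hI'] at h1
  rw [ncard_sphere, ncard_sphere, ncard_sphere, L.ncard_sphereVerts A hd' hI',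
    L.ncard_sphereVerts B hd' hI', h1, if_neg (by omega), if_neg (by omega)]
  have hsplit : ({x | (skeleton D).dist o x = k + 1} : Finset V) =
      {a ∈ ({a | a ∈ A} : Finset V) | (skeleton D).dist o a = k + 1} ∪
      {a ∈ ({a | a ∈ B} : Finset V) | (skeleton D).dist o a = k + 1} := by
    ext x
    simp only [mem_filter, mem_univ, true_and, mem_union, ← or_and_right]
    refine ⟨fun hx => ⟨?_, hx⟩, fun hx => hx.2⟩
    have : x ∈ A ∪ B := by rw [h.union]; exact hI' x hx
    exact this
  rw [hsplit, sum_union]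
  · rw [mul_comm s, mul_comm t, ← smul_eq_mul, ← smul_eq_mul, ← sum_const, ← sum_const]
    congr 1
    · apply sum_congr rfl
      intro x hx
      simp only [mem_filter, mem_univ, true_and] at hx
      rw [← ncard_neighborSet]
      exact (h.left hx.1).2
    · apply sum_congr rfl
      intro x hx
      simp only [mem_filter, mem_univ, true_and] at hx
      rw [← ncard_neighborSet]
      exact (h.right hx.1).2
  · rw [disjoint_left]
    intro x hx hx'
    simp only [mem_filter, mem_univ, true_and] at hx hx'
    exact Set.disjoint_left.1 h.disjoint hx.1 hx'.1

theorem IsSurfaceGraph.ncard_left_add (L : IsSurfaceGraph (skeleton D) (IsInterior D))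
    (h : IsAlternating D s t A B) (ht : Even t)
    (hd : ∀ j, 1 ≤ j → j ≤ k + 2 → DownAt (skeleton D) o j)
    (hI : ∀ x, (skeleton D).dist o x ≤ k + 2 → IsInterior D x) :
    2 * (sphereVerts D A o (k + 2)).ncard + 2 * (sphereVerts D A o k).ncard +
        4 * (sphereVerts D B o (k + 1)).ncard =
      t * (sphereVerts D B o (k + 1)).ncard := by
  have h1 := (h.isAlternatingBall ht L.connected hI).card_left_add L le_rfl hd hI
  rw [L.ncard_sphereVerts A (fun h => hd _ h le_rfl) (fun x hx => hI x hx.le),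
    L.ncard_sphereVerts A (fun h => hd _ h (by omega)) (fun x hx => hI x (by omega)),
    L.ncard_sphereVerts B (fun h => hd _ h (by omega)) (fun x hx => hI x (by omega)),
    if_neg (by omega : ¬ k + 2 = 0), if_neg (by omega : ¬ k + 1 = 0)]
  exact h1

/-- This is half of `IsAlternatingBall.sum_level_right`, whose sum counts each edge between
`B`-vertices twice. -/
theorem IsSurfaceGraph.ncard_sphereEdges_right
    (L : IsSurfaceGraph (skeleton D) (IsInterior D)) (h : IsAlternating D s t A B) (ht : Even t)
    (hd : 1 ≤ k → DownAt (skeleton D) o k)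
    (hI : ∀ x, (skeleton D).dist o x ≤ k → IsInterior D x) :
    (sphereEdges D B B o k).ncard + (sphereVerts D A o k).ncard =
      (sphereVerts D B o k).ncard := by
  have hI' : ∀ x, (skeleton D).dist o x = k → IsInterior D x := fun x hx => hI x hx.le
  have hF : (sphereEdges D B B o k).ncard = #{e ∈ (skeleton D).edgeFinset |
      (∀ x ∈ e, (skeleton D).dist o x = k) ∧ ∀ x ∈ e, x ∈ B} := by
    rw [← Set.ncard_coe_finset]
    congr 1
    ext e
    simp only [sphereEdges, sphere, coe_filter, SimpleGraph.mem_edgeFinset, Set.mem_ofPred_eq,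
      and_assoc]
    refine and_congr_right fun _ => and_congr_right fun _ => ?_
    constructor
    · rintro ⟨a, ha, b, hb, rfl⟩ x hx
      rw [Sym2.mem_iff] at hx
      rcases hx with rfl | rfl <;> assumption
    · intro hx
      induction e with
      | _ a b => exact ⟨a, hx a (by simp), b, hx b (by simp), rfl⟩
  rw [L.ncard_sphereVerts A hd hI', L.ncard_sphereVerts B hd hI']
  split_ifs with h0
  · subst h0
    have h1 := L.card_sphere_zero (o := o)
    have h2 : (sphereEdges D B B o 0).ncard ≤ (sphere D o 0).ncard :=
      Set.ncard_le_ncard (fun e he => he.1) (Set.toFinite _)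
    rw [ncard_sphere, h1] at h2
    omega
  · have h1 := two_mul_card_edges (skeleton D) (fun e =>
      (∀ x ∈ e, (skeleton D).dist o x = k) ∧ ∀ x ∈ e, x ∈ B)
    rw [← hF] at h1
    have h2 := (h.isAlternatingBall ht L.connected hI).sum_level_right L (by omega) le_rfl
      (hd (by omega)) hI'
    have h3 : ∑ x, #{y ∈ (skeleton D).neighborFinset x |
        (∀ p ∈ s(x, y), (skeleton D).dist o p = k) ∧ ∀ p ∈ s(x, y), p ∈ B} =
        ∑ b ∈ ({b | b ∈ B} : Finset V) with (skeleton D).dist o b = k,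
          #(levelNbrs (skeleton D) o b ∩ ({b | b ∈ B} : Finset V)) := by
      symm
      apply sum_subset_zero_on_sdiff (subset_univ _)
      · intro x hx
        rw [card_eq_zero, filter_eq_empty_iff]
        rintro y _ ⟨h1, h2⟩
        simp only [mem_sdiff, mem_univ, true_and, mem_filter, not_and] at hx
        exact hx (h2 x (by simp)) (h1 x (by simp))
      · intro x hx
        simp only [mem_filter, mem_univ, true_and] at hx
        congr 1
        ext y
        simp [mem_levelNbrs, hx.1, hx.2, and_assoc]
    rw [h3] at h1
    omega

/-- No edge of an interior sphere joins two `A`-vertices. -/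
theorem IsSurfaceGraph.ncard_sphereEdges_add
    (L : IsSurfaceGraph (skeleton D) (IsInterior D)) (h : IsAlternating D s t A B) (ht : Even t)
    (hI : ∀ x, (skeleton D).dist o x ≤ k → IsInterior D x) :
    (sphereEdges D A B o k).ncard + (sphereEdges D B B o k).ncard = (sphere D o k).ncard := by
  have hAB := h.isAlternatingBall ht L.connected hI
  rw [← Set.ncard_union_eq]
  · congr 1
    ext e
    constructor
    · rintro (he | he) <;> exact he.1
    · intro he
      induction e with
      | _ a b =>
        have ha : (skeleton D).dist o a = k := he.2 a (by simp)
        have hb : (skeleton D).dist o b = k := he.2 b (by simp)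
        have hadj : (skeleton D).Adj a b := he.1
        have m1 := hAB.mem_or a (by omega)
        have m2 := hAB.mem_or b (by omega)
        have n1 := hAB.nbr_left a
        simp only [mem_filter, mem_univ, true_and] at m1 m2 n1
        rcases m1 with h1 | h1
        · exact Or.inl ⟨he, a, h1, b, n1 h1 b hadj (by omega), rfl⟩
        · rcases m2 with h2 | h2
          · exact Or.inl ⟨he, b, h2, a, h1, Sym2.eq_swap⟩
          · exact Or.inr ⟨he, a, h1, b, h2, rfl⟩
  · rw [Set.disjoint_left]
    rintro e ⟨-, a, ha, b, hb, rfl⟩ ⟨-, c, hc, d, hd, hcd⟩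
    rcases Sym2.eq_iff.1 hcd with ⟨rfl, rfl⟩ | ⟨rfl, rfl⟩
    · exact Set.disjoint_left.1 h.disjoint ha hc
    · exact Set.disjoint_left.1 h.disjoint ha hd

/-- The splitting of a sphere into types is used only up to level `k + 3`. The length at level `k +
4` comes from the degree count at level `k + 3`, so that sphere need not be interior. -/
theorem IsDisc.recAt_sphere (hD : IsDisc D)
    (hdeg : ∀ x, IsInterior D x → 6 ≤ #((skeleton D).neighborFinset x))
    (h : IsAlternating D s t A B) (ht : Even t)
    (hI : ∀ x, (skeleton D).dist o x < k + 4 → IsInterior D x) :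
    RecAt s t (fun k => (sphere D o k).ncard) (k + 4) := by
  have L := hD.isSurfaceGraph hdeg
  have hd : ∀ j, 1 ≤ j → j ≤ k + 4 → DownAt (skeleton D) o j := fun j hj hj' =>
    hD.downAt hdeg o hj fun x hx => hI x (by omega)
  have eN : ∀ j, j ≤ k + 2 → ((sphere D o (j + 2)).ncard + (sphere D o j).ncard +
      4 * (sphere D o (j + 1)).ncard : ℚ) =
      s * (sphereVerts D A o (j + 1)).ncard + t * (sphereVerts D B o (j + 1)).ncard := by
    intro j hj
    exact_mod_cast L.ncard_sphere_add (k := j) h (fun i hi hi' => hd i hi (by omega))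
      (fun x hx => hI x (by omega))
  have eV : ∀ j, j ≤ k + 1 → (2 * (sphereVerts D A o (j + 2)).ncard +
      2 * (sphereVerts D A o j).ncard + 4 * (sphereVerts D B o (j + 1)).ncard : ℚ) =
      t * (sphereVerts D B o (j + 1)).ncard := by
    intro j hj
    exact_mod_cast L.ncard_left_add (k := j) h ht (fun i hi hi' => hd i hi (by omega))
      (fun x hx => hI x (by omega))
  have hN : ∀ j, j ≤ k + 3 → ((sphere D o j).ncard : ℚ) =
      (sphereVerts D A o j).ncard + (sphereVerts D B o j).ncard := by
    intro j hj
    exact_mod_cast L.ncard_sphere_alternating (k := j) h (fun hi => hd j hi (by omega))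
      (fun x hx => hI x (by omega))
  have n2 := eN (k + 2) (by omega)
  have n1 := eN (k + 1) (by omega)
  have n0 := eN k (by omega)
  have v1 := eV (k + 1) (by omega)
  have v0 := eV k (by omega)
  have s3 := hN (k + 3) (by omega)
  have s2 := hN (k + 2) (by omega)
  have s1 := hN (k + 1) (by omega)
  have s0 := hN k (by omega)
  simp only [add_assoc, Nat.reduceAdd] at n2 n1 n0 v1 v0
  change ((sphere D o (k + 4)).ncard : ℚ) = ((t : ℚ) - 4) / 2 * (sphere D o (k + 3)).ncard +
    (((s : ℚ) - 4) * ((t : ℚ) - 4) / 2 - 2) * (sphere D o (k + 2)).ncard +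
    ((t : ℚ) - 4) / 2 * (sphere D o (k + 1)).ncard - (sphere D o k).ncard
  rw [s3, s2] at n2
  rw [s3, s2, s1] at n1
  rw [s2, s1, s0] at n0
  rw [s3, s2, s1, s0]
  -- In total this is `n2 + n0 + (T/2) n1 + ((S - T)/2) v1`; the `v0` terms cancel. Adding `n2` and
  -- `n0` produces the outer terms, and `n1` and `v1` then rewrite the sums of types on levels `k +
  -- 3` and `k + 1`.
  linear_combination n2 + (((t : ℚ) - 4) / 2) * (n1 - v1 / 2) + (n0 - v0 / 2)
    + v0 / 2 + ((s : ℚ) - 4) * v1 / 2 - (((t : ℚ) - 4) / 2) * v1 / 2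

end Recurrences

/-! ### Elimination, the regular case and the theorem -/

section MainResults

open Classical

variable {V : Type v} [Fintype V] {D : AbstractSimplicialComplex V} {o : V} {k : ℕ}
variable {s t : ℕ} {A B : Set V}

/-- The relations `eV` and `eW` form a two-term linear system for the two vertex sequences. Adding a
relation to its shift by two levels and substituting the other eliminates one sequence. The edge
counts satisfy the same recurrence because `eE` and `eF` express them linearly in the vertex counts.
-/
theorem IsDisc.recAt_alternating (hD : IsDisc D)
    (hdeg : ∀ x, IsInterior D x → 6 ≤ #((skeleton D).neighborFinset x))
    (h : IsAlternating D s t A B) (ht : Even t)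
    (hI : ∀ x, (skeleton D).dist o x ≤ k + 4 → IsInterior D x) :
    RecAt s t (fun k => (sphereVerts D A o k).ncard) (k + 4) ∧
      RecAt s t (fun k => (sphereVerts D B o k).ncard) (k + 4) ∧
      RecAt s t (fun k => (sphereEdges D A B o k).ncard) (k + 4) ∧
      RecAt s t (fun k => (sphereEdges D B B o k).ncard) (k + 4) := by
  have L := hD.isSurfaceGraph hdeg
  have hd : ∀ j, 1 ≤ j → j ≤ k + 4 → DownAt (skeleton D) o j := fun j hj hj' =>
    hD.downAt hdeg o hj fun x hx => hI x (by omega)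
  have hN : ∀ j, j ≤ k + 4 → ((sphere D o j).ncard : ℚ) =
      (sphereVerts D A o j).ncard + (sphereVerts D B o j).ncard := by
    intro j hj
    exact_mod_cast L.ncard_sphere_alternating (k := j) h (fun hi => hd j hi (by omega))
      (fun x hx => hI x (by omega))
  have eV : ∀ j, j ≤ k + 2 → (2 * (sphereVerts D A o (j + 2)).ncard +
      2 * (sphereVerts D A o j).ncard + 4 * (sphereVerts D B o (j + 1)).ncard : ℚ) =
      t * (sphereVerts D B o (j + 1)).ncard := by
    intro j hj
    exact_mod_cast L.ncard_left_add (k := j) h ht (fun i hi hi' => hd i hi (by omega))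
      (fun x hx => hI x (by omega))
  have eW : ∀ j, j ≤ k + 2 → ((sphereVerts D B o (j + 2)).ncard +
      (sphereVerts D B o j).ncard : ℚ) = (s - 4) * (sphereVerts D A o (j + 1)).ncard +
        (t - 4) / 2 * (sphereVerts D B o (j + 1)).ncard := by
    intro j hj
    have e : ((sphere D o (j + 2)).ncard + (sphere D o j).ncard +
        4 * (sphere D o (j + 1)).ncard : ℚ) =
        s * (sphereVerts D A o (j + 1)).ncard + t * (sphereVerts D B o (j + 1)).ncard := by
      exact_mod_cast L.ncard_sphere_add (k := j) h (fun i hi hi' => hd i hi (by omega))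
        (fun x hx => hI x (by omega))
    rw [hN (j + 2) (by omega), hN (j + 1) (by omega), hN j (by omega)] at e
    linear_combination e - eV j hj / 2
  have eF : ∀ j, j ≤ k + 4 → ((sphereEdges D B B o j).ncard : ℚ) =
      (sphereVerts D B o j).ncard - (sphereVerts D A o j).ncard := by
    intro j hj
    have e : ((sphereEdges D B B o j).ncard + (sphereVerts D A o j).ncard : ℚ) =
        (sphereVerts D B o j).ncard := by
      exact_mod_cast L.ncard_sphereEdges_right (k := j) h ht (fun hi => hd j hi (by omega))
        (fun x hx => hI x (by omega))
    linear_combination e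
  have eE : ∀ j, j ≤ k + 4 → ((sphereEdges D A B o j).ncard : ℚ) =
      2 * (sphereVerts D A o j).ncard := by
    intro j hj
    have e : ((sphereEdges D A B o j).ncard + (sphereEdges D B B o j).ncard : ℚ) =
        (sphere D o j).ncard := by
      exact_mod_cast L.ncard_sphereEdges_add (k := j) h ht (fun x hx => hI x (by omega))
    linear_combination e - eF j hj + hN j hj
  have v2 := eV (k + 2) (by omega)
  have v1 := eV (k + 1) (by omega)
  have v0 := eV k (by omega)
  have w2 := eW (k + 2) (by omega)
  have w1 := eW (k + 1) (by omega)
  have w0 := eW k (by omega)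
  simp only [add_assoc, Nat.reduceAdd] at v2 v1 v0 w2 w1 w0
  have hA : ((sphereVerts D A o (k + 4)).ncard : ℚ) =
      ((t : ℚ) - 4) / 2 * (sphereVerts D A o (k + 3)).ncard +
      (((s : ℚ) - 4) * ((t : ℚ) - 4) / 2 - 2) * (sphereVerts D A o (k + 2)).ncard +
      ((t : ℚ) - 4) / 2 * (sphereVerts D A o (k + 1)).ncard - (sphereVerts D A o k).ncard := by
    linear_combination v2 / 2 - ((t : ℚ) - 4) / 2 * (v1 / 2) + v0 / 2 + ((t : ℚ) - 4) / 2 * w1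
  have hB : ((sphereVerts D B o (k + 4)).ncard : ℚ) =
      ((t : ℚ) - 4) / 2 * (sphereVerts D B o (k + 3)).ncard +
      (((s : ℚ) - 4) * ((t : ℚ) - 4) / 2 - 2) * (sphereVerts D B o (k + 2)).ncard +
      ((t : ℚ) - 4) / 2 * (sphereVerts D B o (k + 1)).ncard - (sphereVerts D B o k).ncard := by
    linear_combination w2 + w0 + ((s : ℚ) - 4) * (v1 / 2)
  refine ⟨hA, hB, ?_, ?_⟩
  · change ((sphereEdges D A B o (k + 4)).ncard : ℚ) =
      ((t : ℚ) - 4) / 2 * (sphereEdges D A B o (k + 3)).ncard +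
      (((s : ℚ) - 4) * ((t : ℚ) - 4) / 2 - 2) * (sphereEdges D A B o (k + 2)).ncard +
      ((t : ℚ) - 4) / 2 * (sphereEdges D A B o (k + 1)).ncard - (sphereEdges D A B o k).ncard
    rw [eE (k + 4) le_rfl, eE (k + 3) (by omega), eE (k + 2) (by omega), eE (k + 1) (by omega),
      eE k (by omega)]
    linear_combination 2 * hA
  · change ((sphereEdges D B B o (k + 4)).ncard : ℚ) =
      ((t : ℚ) - 4) / 2 * (sphereEdges D B B o (k + 3)).ncard +
      (((s : ℚ) - 4) * ((t : ℚ) - 4) / 2 - 2) * (sphereEdges D B B o (k + 2)).ncard +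
      ((t : ℚ) - 4) / 2 * (sphereEdges D B B o (k + 1)).ncard - (sphereEdges D B B o k).ncard
    rw [eF (k + 4) le_rfl, eF (k + 3) (by omega), eF (k + 2) (by omega), eF (k + 1) (by omega),
      eF k (by omega)]
    linear_combination hB - hA

/-- The recurrence when all interior vertices have the same number of neighbours. -/
theorem IsDisc.recAt_sphere_regular (hD : IsDisc D) (ht : 6 ≤ t)
    (hreg : ∀ x, IsInterior D x → x ∈ kVertices D t)
    (hI : ∀ x, (skeleton D).dist o x < k + 4 → IsInterior D x) :
    RecAt t t (fun k => (sphere D o k).ncard) (k + 4) := by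
  have hdegt : ∀ x, IsInterior D x → #((skeleton D).neighborFinset x) = t := by
    intro x hx
    rw [← ncard_neighborSet]
    exact (hreg x hx).2
  have hdeg : ∀ x, IsInterior D x → 6 ≤ #((skeleton D).neighborFinset x) := by
    intro x hx
    rwa [hdegt x hx]
  have L := hD.isSurfaceGraph hdeg
  have hd : ∀ j, 1 ≤ j → j ≤ k + 4 → DownAt (skeleton D) o j := fun j hj hj' =>
    hD.downAt hdeg o hj fun x hx => hI x (by omega)
  have eN : ∀ j, j ≤ k + 2 → ((sphere D o (j + 2)).ncard + (sphere D o j).ncard : ℚ) =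
      (t - 4) * (sphere D o (j + 1)).ncard := by
    intro j hj
    have h1 := L.card_sphere_add (o := o) j (fun i hi hi' => hd i hi (by omega))
      (fun x hx => hI x (by omega))
    have h2 : ∑ x with (skeleton D).dist o x = j + 1, #((skeleton D).neighborFinset x) =
        ∑ x with (skeleton D).dist o x = j + 1, t := by
      apply sum_congr rfl
      intro x hx
      simp only [mem_filter, mem_univ, true_and] at hx
      exact hdegt x (hI x (by omega))
    rw [h2, sum_const, smul_eq_mul, ← L.card_sphere (by omega) (hd _ (by omega) (by omega))
      (fun x hx => hI x (by omega)), ← ncard_sphere, ← ncard_sphere, ← ncard_sphere] at h1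
    have h3 : ((sphere D o (j + 2)).ncard + (sphere D o j).ncard +
        4 * (sphere D o (j + 1)).ncard : ℚ) = (sphere D o (j + 1)).ncard * t := by
      exact_mod_cast h1
    linear_combination h3
  have n2 := eN (k + 2) (by omega)
  have n1 := eN (k + 1) (by omega)
  have n0 := eN k (by omega)
  simp only [add_assoc, Nat.reduceAdd] at n2 n1 n0
  change ((sphere D o (k + 4)).ncard : ℚ) = ((t : ℚ) - 4) / 2 * (sphere D o (k + 3)).ncard +
    (((t : ℚ) - 4) * ((t : ℚ) - 4) / 2 - 2) * (sphere D o (k + 2)).ncard +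
    ((t : ℚ) - 4) / 2 * (sphere D o (k + 1)).ncard - (sphere D o k).ncard
  -- The sum `n2 + n0` has `T (N (k+3) + N (k+1))` on the right; `n1` converts half of it to `(T * T
  -- / 2) N (k+2)`.
  linear_combination n2 + ((t : ℚ) - 4) / 2 * n1 + n0

theorem RecAt.congr {x y : ℕ → ℕ} {n : ℕ} (hx : RecAt s t x n) (h : ∀ j, j ≤ n → y j = x j) :
    RecAt s t y n := by
  rw [RecAt] at hx ⊢
  rwa [h n le_rfl, h (n - 1) (by omega), h (n - 2) (by omega), h (n - 3) (by omega),
    h (n - 4) (by omega)]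

theorem sphereEdges_kVertices_eq {V : Type v} {D : AbstractSimplicialComplex V} {o : V} {k t : ℕ}
    (hreg : ∀ x, IsInterior D x → x ∈ kVertices D t)
    (hI : ∀ x, (skeleton D).dist o x = k → IsInterior D x) :
    sphereEdges D (kVertices D t) (kVertices D t) o k = sphere D o k := by
  ext e
  refine ⟨fun h => h.1, fun h => ⟨h, ?_⟩⟩
  induction e with
  | _ a b =>
    exact ⟨a, hreg a (hI a (h.2 a (by simp))), b, hreg b (hI b (h.2 b (by simp))), rfl⟩

theorem IsSurfaceGraph.ncard_sphereVerts_kVertices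
    (L : IsSurfaceGraph (skeleton D) (IsInterior D))
    (hreg : ∀ x, IsInterior D x → x ∈ kVertices D t) (hd : 1 ≤ k → DownAt (skeleton D) o k)
    (hI : ∀ x, (skeleton D).dist o x = k → IsInterior D x) :
    (sphereVerts D (kVertices D t) o k).ncard = (sphere D o k).ncard := by
  rw [L.ncard_sphereVerts _ hd hI, ncard_sphere]
  split_ifs with h0
  · subst h0
    exact L.card_sphere_zero.symm
  · rw [L.card_sphere (by omega) (hd (by omega)) hI]
    congr 1
    ext x
    simp only [mem_filter, mem_univ, true_and]
    exact ⟨fun h => h.2, fun h => ⟨hreg x (hI x h), h⟩⟩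

theorem IsAlternating.six_le_degree (h : IsAlternating D s t A B) (hs : 6 ≤ s) (ht : 6 ≤ t)
    (x : V) (hx : IsInterior D x) : 6 ≤ #((skeleton D).neighborFinset x) := by
  rw [← ncard_neighborSet]
  have : x ∈ A ∪ B := by rw [h.union]; exact hx
  rcases this with hx | hx
  · rw [(h.left hx).2]; exact hs
  · rw [(h.right hx).2]; exact ht

end MainResults

end STUniform

theorem theorem3p1 {U : Type u} (X : AbstractSimplicialComplex U) (s t : ℕ)
    (hs : 6 ≤ s) (ht : 6 ≤ t) (hst : Even t ∨ s = t)
    (hX : STUniform.IsUniform.{u, v} X s t)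
    (γ : (STUniform.skeleton X).Subgraph) (hγ : STUniform.IsLoop γ)
    {V : Type v} (D : AbstractSimplicialComplex V) (f : V → U)
    (hD : STUniform.IsMinimalFilling γ D f)
    (o : V) (ho : STUniform.IsInterior D o) (n : ℕ) (hn : 4 ≤ n) :
    -- the lengths of spheres, as long as the vertices strictly inside the sphere are interior
    ((∀ x, (STUniform.skeleton D).dist o x < n → STUniform.IsInterior D x) →
      STUniform.RecAt s t (fun k => (STUniform.sphere D o k).ncard) n) ∧
    -- the numbers of vertices and edges of each type, for spheres in the interior;
    -- for `s ≠ t` the types are given by the numbers of neighbours, and for `s = t` (even)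
    -- also by any alternating assignment of the two roles to the interior vertices
    ((∀ x, (STUniform.skeleton D).dist o x ≤ n → STUniform.IsInterior D x) →
      ∀ A B : Set V,
        (A = STUniform.kVertices D s ∧ B = STUniform.kVertices D t) ∨
          (s = t ∧ Even t ∧ STUniform.IsAlternating D s t A B) →
        STUniform.RecAt s t (fun k => (STUniform.sphereVerts D A o k).ncard) n ∧
        STUniform.RecAt s t (fun k => (STUniform.sphereVerts D B o k).ncard) n ∧
        STUniform.RecAt s t (fun k => (STUniform.sphereEdges D A B o k).ncard) n ∧
        STUniform.RecAt s t (fun k => (STUniform.sphereEdges D B B o k).ncard) n) := by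
  have hdisc := hD.1.disc
  have := hdisc.finite
  have := Fintype.ofFinite V
  obtain ⟨k, rfl⟩ : ∃ k, n = k + 4 := ⟨n - 4, by omega⟩
  by_cases heq : s = t
  · subst heq
    have hreg := hX.of_eq rfl γ hγ V D f hD
    have hdeg : ∀ x, STUniform.IsInterior D x →
        6 ≤ ((STUniform.skeleton D).neighborSet x).ncard := by
      intro x hx
      rw [(hreg x hx).2]
      exact hs
    simp only [STUniform.ncard_neighborSet] at hdeg
    refine ⟨fun hI => hdisc.recAt_sphere_regular hs hreg hI, fun hI A B hAB => ?_⟩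
    rcases hAB with ⟨rfl, rfl⟩ | ⟨-, heven, hAB⟩
    -- With `s = t` and both sets equal to all `t`-vertices, all four counts equal the sphere
    -- length, so no parity of `t` is needed.
    · have hrec := hdisc.recAt_sphere_regular (k := k) hs hreg (fun x hx => hI x hx.le)
      have L := hdisc.isSurfaceGraph hdeg
      have hverts : ∀ j, j ≤ k + 4 → (STUniform.sphereVerts D (STUniform.kVertices D s) o j).ncard =
          (STUniform.sphere D o j).ncard := fun j hj =>
        L.ncard_sphereVerts_kVertices hreg
          (fun h => hdisc.downAt hdeg o h fun x hx => hI x (by omega)) fun x hx => hI x (by omega)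
      have hedges : ∀ j, j ≤ k + 4 → (STUniform.sphereEdges D (STUniform.kVertices D s)
          (STUniform.kVertices D s) o j).ncard = (STUniform.sphere D o j).ncard := fun j hj => by
        rw [STUniform.sphereEdges_kVertices_eq hreg fun x hx => hI x (by omega)]
      exact ⟨hrec.congr hverts, hrec.congr hverts, hrec.congr hedges, hrec.congr hedges⟩
    · exact hdisc.recAt_alternating hdeg hAB heven hI
  · have heven : Even t := hst.resolve_right heq
    have halt := hX.of_ne heq γ hγ V D f hD
    have hdeg := halt.six_le_degree hs ht
    refine ⟨fun hI => hdisc.recAt_sphere hdeg halt heven hI, fun hI A B hAB => ?_⟩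
    rcases hAB with ⟨rfl, rfl⟩ | ⟨h, -⟩
    · exact hdisc.recAt_alternating hdeg halt heven hI
    · exact absurd h heq
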